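/- Let $t_0>0$ and let $p(z)=t_1z+t_2z^2+\cdots+t_{n+1}z^{n+1}$ be a complex polynomial with $t_1=0$ and $|t_2|<1/2$. Let $V(z)=\frac1{t_0}\bigl(|z|^2-p(z)-\overline{p(z)}\bigr)$ be the associated Elbau–Felder potential, and let $\Sigma\subset\mathbb C$ be the closure of a bounded open set containing the origin. For a finite compactly supported Borel measure $\nu$ write $U^\nu(z)=\int\log|z-w|^{-1}\,d\nu(w)$. Let $\mu$ be an equilibrium measure of $V$ on $\Sigma$, that is, a minimizer of $I^V(\nu)=\int (V+U^\nu)\,d\nu$ among the Borel probability measures $\nu$ on $\Sigma$, and assume that $\mu(\partial\Sigma)=0$. Let $D$ be the support of $\mu$, and assume that $\gamma=\partial D$ is a simple closed analytic polynomial curve: $\gamma=h(\{|w|=1\})$ with $h(w)=rw+a_0+a_1w^{-1}+\cdots+a_mw^{-m}$, $r>0$, $a_j\in\mathbb C$, where $h$ is injective on $|w|=1$, $h'\neq0$ on $|w|=1$, and $h$ traverses $\gamma$ counterclockwise around the interior $\dot D$ of $D$. Let $S$ be the Schwarz function of $\gamma$, that is, the analytic function on a neighbourhood of $\gamma$ with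 $S(z)=\bar z$ on $\gamma$. Let $\mathcal H(D)$ be the space of functions that are holomorphic on $\dot D$ and continuous on its closure. Then for every $f\in\mathcal H(D)$ $$\int_D f\,d\mu=\frac1{2\pi i t_0}\oint_\gamma f(z)\,S(z)\,dz .$$ Moreover, if $\widehat\mu$ is the balayage of $\mu$ onto $\gamma$, that is, a probability measure carried by $\gamma$ with $U^{\widehat\mu}=U^{\mu}$ almost everywhere on $\gamma$ (with respect to arc length), then $d\widehat\mu(z)=\frac{1}{2\pi i t_0}S(z)\,dz$ as functionals on $\mathcal H(D)$: $$\int_\gamma f\,d\widehat\mu=\frac1{2\pi i t_0}\oint_\gamma f(z)\,S(z)\,dz\qquad\text{for every } f\in\mathcal H(D).$$ -/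

import Mathlib

open MeasureTheory Set Metric
open scoped ENNReal Real ComplexConjugate

noncomputable section

namespace ElbauFelder

/-- The integral of an extended-real valued function: positive part minus negative part.
It is only used for functions bounded below on the support of a finite measure, so that the
negative part is finite and the value `⊤` is meaningful. -/
def erealIntegral (μ : Measure ℂ) (f : ℂ → EReal) : EReal :=
  ((∫⁻ z, (f z).toENNReal ∂μ : ℝ≥0∞) : EReal) - ((∫⁻ z, (-f z).toENNReal ∂μ : ℝ≥0∞) : EReal)

/-- The logarithmic kernel `log (1 / |z - w|)`, equal to `+∞` on the diagonal. -/
def logKernel (z w : ℂ) : EReal := -ENNReal.log (edist z w)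

/-- The logarithmic potential `U^μ(z) = ∫ log (1 / |z - w|) dμ(w)`. -/
def logPotential (μ : Measure ℂ) (z : ℂ) : EReal :=
  erealIntegral μ (fun w => logKernel z w)

/-- The total energy `I^V(μ) = ∫ (V + U^μ) dμ`. -/
def energy (V : ℂ → ℝ) (μ : Measure ℂ) : EReal :=
  erealIntegral μ (fun z => (V z : EReal) + logPotential μ z)

/-- `μ` is a Borel probability measure on `K` that minimizes the energy `I^V` among all Borel
probability measures on `K`. -/
structure IsEquilibriumMeasure (V : ℂ → ℝ) (K : Set ℂ) (μ : Measure ℂ) : Prop where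
  prob : IsProbabilityMeasure μ
  carried : μ Kᶜ = 0
  minimal : ∀ ν : Measure ℂ, IsProbabilityMeasure ν → ν Kᶜ = 0 → energy V μ ≤ energy V ν

/-- The data of an Elbau-Felder potential: `t₀ > 0` and `p(z) = t₁ z + t₂ z² + ⋯` a polynomial
(of any degree) with `t₁ = 0` and `|t₂| < 1/2`. -/
structure IsElbauFelder (t₀ : ℝ) (p : Polynomial ℂ) : Prop where
  t₀_pos : 0 < t₀
  coeff_zero : p.coeff 0 = 0
  coeff_one : p.coeff 1 = 0
  coeff_two : ‖p.coeff 2‖ < 1 / 2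

/-- `V(z) = (|z|² - p(z) - conj p(z)) / t₀`. -/
def potential (t₀ : ℝ) (p : Polynomial ℂ) (z : ℂ) : ℝ :=
  (‖z‖ ^ 2 - 2 * (p.eval z).re) / t₀

/-- `h(w) = r w + a₀ + a₁ w⁻¹ + ⋯ + aₙ w⁻ⁿ`. -/
def polyMap (r : ℝ) (n : ℕ) (a : ℕ → ℂ) (w : ℂ) : ℂ :=
  r * w + ∑ j ∈ Finset.range (n + 1), a j * w⁻¹ ^ j

/-- The image `γ` of the unit circle under `h`. -/
def polyCurve (r : ℝ) (n : ℕ) (a : ℕ → ℂ) : Set ℂ :=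
  polyMap r n a '' sphere 0 1

/-- `h` restricted to the unit circle parametrizes a simple closed analytic (regular) curve. -/
structure IsSimpleAnalytic (r : ℝ) (n : ℕ) (a : ℕ → ℂ) : Prop where
  r_pos : 0 < r
  simple : InjOn (polyMap r n a) (sphere 0 1)
  regular : ∀ w ∈ sphere (0 : ℂ) 1, deriv (polyMap r n a) w ≠ 0

/-- The contour integral `∮_γ g(z) dz` along `γ`, in the parametrization `h`. -/
def contourIntegral (r : ℝ) (n : ℕ) (a : ℕ → ℂ) (g : ℂ → ℂ) : ℂ :=
  ∮ w in C(0, 1), g (polyMap r n a w) * deriv (polyMap r n a) w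

/-- `h` traverses `γ` once counterclockwise around every point of `G`. -/
def PositivelyOrientedAround (r : ℝ) (n : ℕ) (a : ℕ → ℂ) (G : Set ℂ) : Prop :=
  ∀ z₀ ∈ G, contourIntegral r n a (fun z => (z - z₀)⁻¹) = 2 * π * Complex.I

/-- `S` is a Schwarz function of `γ`: analytic on an open neighbourhood of `γ`, and equal to
complex conjugation on `γ`. -/
def IsSchwarzFunction (S : ℂ → ℂ) (γ : Set ℂ) : Prop :=
  ∃ Ω : Set ℂ, IsOpen Ω ∧ γ ⊆ Ω ∧ AnalyticOnNhd ℂ S Ω ∧ ∀ z ∈ γ, S z = conj z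

/-- `ν'` solves the balayage problem for the measure `ν` on the open set `G`: it is a probability
measure on `∂G` whose logarithmic potential agrees with that of `ν` almost everywhere on `∂G`,
with respect to arc length (one-dimensional Hausdorff measure). -/
structure IsBalayage (G : Set ℂ) (ν ν' : Measure ℂ) : Prop where
  prob : IsProbabilityMeasure ν'
  carried : ν' (frontier G)ᶜ = 0
  potential_eq : ∀ᵐ z ∂((μH[1] : Measure ℂ).restrict (frontier G)),
    logPotential ν z = logPotential ν' z

end ElbauFelder

end

noncomputable section

namespace ElbauFelder

open Filter Topology

/-! ### Logarithmic potentials -/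

/-! Quadrature identity. Comparing μ with (1-t)μ + tν, where ν is uniform on a circle inside Σ,
gives the Euler-Lagrange relations: V + 2U^μ is at least its μ-mean at interior points of Σ where
the potential converges, hence equals that mean μ-almost everywhere. Kept on circles of positive
radius, the same inequality bounds the density of μ (`IsEquilibriumMeasure.le_smul_volume`). So U^μ
is continuous and V + 2U^μ is constant on the whole support. The first Fourier coefficient of this
constant on circles shrinking to z gives ∫ (z-w)⁻¹ dμ(w) = (z̄ - p'(z))/t₀ inside D
(`IsEquilibriumMeasure.cauchyTransform_eq`), and by continuity on γ. There S = z̄ is t₀ times the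
Cauchy transform plus p'. After multiplication by f and integration over γ, the term f p' vanishes
by Cauchy's theorem, and the other gives 2πi t₀ ∫ f dμ by Fubini and Cauchy's formula.

Cauchy's formula is needed for f merely continuous up to γ. The polynomial wⁿ(h(w) - z) has n + 1
roots, and winding number one around z forces all of them into the unit disc. Hence h sends the
exterior of the disc off the closed domain and a thin inner annulus into the domain, so the Jordan
curve theorem is not needed. Cauchy integrals over γ and over a nearby inner curve then glue to an
entire function vanishing at infinity, and Liouville's theorem gives the formula
(`IsCurveDomain.cauchy_formula`).

Balayage. Two probability measures on the closed domain with equal potentials almost everywhere on γ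
integrate the functions of H(D) equally (`IsCurveDomain.integral_eq_of_logPotential_eq`). Since the
roots of h - z lie in the closed disc, the values log|h(e^{iθ}) - z| determine h'(v)/(h(v) - z) for
|v| > 1; thus the exterior Cauchy transforms agree. Finally f is uniformly approximated by Cauchy
integrals over the curves h(|w| = t), t ↓ 1, whose integrals depend only on those transforms. -/

lemma abs_log_eq_two_mul_posLog_sub_log (t : ℝ) :
    |Real.log t| = 2 * Real.posLog t - Real.log t := by
  rcases le_total 0 (Real.log t) with h | h
  · rw [Real.posLog, max_eq_right h, abs_of_nonneg h]; ring
  · rw [Real.posLog, max_eq_left h, abs_of_nonpos h]; ring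

/-- The logarithmic kernel is integrable on a product as soon as its partial potentials are
bounded on one side. -/
lemma integrable_log_norm_sub_prod {α : Type*} [MeasurableSpace α] (τ : Measure α)
    [IsFiniteMeasure τ] {c : α → ℂ} (hc : Measurable c) (σ : Measure ℂ) [IsFiniteMeasure σ]
    {R M : ℝ} (hR : ∀ᵐ w ∂σ, ∀ᵐ x ∂τ, ‖c x - w‖ ≤ R)
    (hint : ∀ᵐ w ∂σ, Integrable (fun x => Real.log ‖c x - w‖) τ)
    (hM : ∀ᵐ w ∂σ, -M ≤ ∫ x, Real.log ‖c x - w‖ ∂τ) :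
    Integrable (fun p : α × ℂ => Real.log ‖c p.1 - p.2‖) (τ.prod σ) := by
  have hmeas : Measurable (fun p : α × ℂ => Real.log ‖c p.1 - p.2‖) := by fun_prop
  refine (integrable_prod_iff' hmeas.aestronglyMeasurable).2 ⟨hint, ?_⟩
  refine Integrable.mono' (integrable_const (2 * Real.posLog R * τ.real univ + M))
    (hmeas.norm.stronglyMeasurable.integral_prod_left').aestronglyMeasurable ?_
  filter_upwards [hR, hint, hM] with w h1 h2 h3
  rw [Real.norm_of_nonneg (integral_nonneg fun _ => norm_nonneg _)]
  have h4 : ∫ x, ‖Real.log ‖c x - w‖‖ ∂τ ≤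
      ∫ x, (2 * Real.posLog R - Real.log ‖c x - w‖) ∂τ := by
    refine integral_mono_ae h2.norm ((integrable_const _).sub h2) ?_
    filter_upwards [h1] with x hx
    rw [Real.norm_eq_abs, abs_log_eq_two_mul_posLog_sub_log]
    have := Real.posLog_le_posLog (norm_nonneg _) hx
    linarith
  refine h4.trans ?_
  rw [integral_sub (integrable_const _) h2, integral_const, smul_eq_mul]
  linarith

lemma erealIntegral_congr_ae {μ : Measure ℂ} {f g : ℂ → EReal} (h : f =ᵐ[μ] g) :
    erealIntegral μ f = erealIntegral μ g := by
  unfold erealIntegral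
  rw [lintegral_congr_ae (h.mono fun z hz => congrArg EReal.toENNReal hz),
    lintegral_congr_ae (h.mono fun z hz => congrArg (fun x : EReal => (-x).toENNReal) hz)]

lemma erealIntegral_coe {μ : Measure ℂ} {g : ℂ → ℝ} (hg : Integrable g μ) :
    erealIntegral μ (fun z => (g z : EReal)) = ((∫ z, g z ∂μ : ℝ) : EReal) := by
  unfold erealIntegral
  have h1 : ∫⁻ z, ENNReal.ofReal (g z) ∂μ ≠ ⊤ :=
    (lt_of_le_of_lt (lintegral_mono fun z => Real.ofReal_le_enorm (g z)) hg.2).ne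
  have h2 : ∫⁻ z, ENNReal.ofReal (-g z) ∂μ ≠ ⊤ :=
    (lt_of_le_of_lt (lintegral_mono fun z => Real.ofReal_le_enorm (-g z)) hg.neg.2).ne
  have h3 : ∀ z, (-(g z : EReal)).toENNReal = ENNReal.ofReal (-g z) := fun z => by
    rw [← EReal.coe_neg, EReal.real_coe_toENNReal]
  simp only [h3, EReal.real_coe_toENNReal]
  rw [integral_eq_lintegral_pos_part_sub_lintegral_neg_part hg, EReal.coe_sub,
    EReal.coe_ennreal_toReal h1, EReal.coe_ennreal_toReal h2]

lemma logKernel_of_ne {z w : ℂ} (h : z ≠ w) :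
    logKernel z w = ((-Real.log ‖z - w‖ : ℝ) : EReal) := by
  rw [logKernel, edist_dist, dist_eq_norm, ENNReal.log_ofReal_of_pos (norm_sub_pos_iff.2 h),
    EReal.coe_neg]

lemma logKernel_self (z : ℂ) : logKernel z z = ⊤ := by
  simp [logKernel]

lemma logPotential_eq_coe {ν : Measure ℂ} {z : ℂ} (hz : ν {z} = 0)
    (hi : Integrable (fun w => Real.log ‖z - w‖) ν) :
    logPotential ν z = ((-∫ w, Real.log ‖z - w‖ ∂ν : ℝ) : EReal) := by
  have h : (fun w => logKernel z w) =ᵐ[ν] fun w => ((-Real.log ‖z - w‖ : ℝ) : EReal) := by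
    have : ∀ᵐ w ∂ν, w ≠ z := by simpa [ae_iff] using hz
    filter_upwards [this] with w hw using logKernel_of_ne hw.symm
  rw [logPotential, erealIntegral_congr_ae h, erealIntegral_coe hi.fun_neg, integral_neg]

/-- The absence of atoms lets the real logarithm replace the extended kernel: on the diagonal the
kernel is `⊤`, whereas `Real.log 0 = 0`. -/
lemma energy_eq_coe {V : ℂ → ℝ} {ν : Measure ℂ} [IsFiniteMeasure ν] [NullSingletonClass ν]
    (hV : Integrable V ν)
    (hi : Integrable (fun p : ℂ × ℂ => Real.log ‖p.1 - p.2‖) (ν.prod ν)) :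
    energy V ν = ((∫ z, V z ∂ν - ∫ z, ∫ w, Real.log ‖z - w‖ ∂ν ∂ν : ℝ) : EReal) := by
  have h : (fun z => (V z : EReal) + logPotential ν z) =ᵐ[ν]
      fun z => ((V z - ∫ w, Real.log ‖z - w‖ ∂ν : ℝ) : EReal) := by
    filter_upwards [hi.prod_right_ae] with z hz
    rw [logPotential_eq_coe (measure_singleton z) hz, ← EReal.coe_add, sub_eq_add_neg]
  have hj : Integrable (fun z => ∫ w, Real.log ‖z - w‖ ∂ν) ν := hi.integral_prod_left
  rw [energy, erealIntegral_congr_ae h,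
    erealIntegral_coe (g := fun z => V z - ∫ w, Real.log ‖z - w‖ ∂ν) (hV.sub hj),
    integral_sub hV hj]

lemma measurable_logKernel : Measurable (fun p : ℂ × ℂ => logKernel p.1 p.2) := by
  unfold logKernel
  fun_prop

/-- On the diagonal the right side is `⊤`, so the default value `Real.log 0 = 0` is harmless; off
it, only the positive part of the logarithm needs the bound R. -/
lemma enorm_log_le (z w : ℂ) {R : ℝ} (h : ‖z - w‖ ≤ R) :
    ‖Real.log ‖z - w‖‖ₑ ≤ (logKernel z w).toENNReal + ENNReal.ofReal (Real.posLog R) := by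
  rcases eq_or_ne z w with rfl | hne
  · simp [logKernel_self]
  rw [logKernel_of_ne hne, EReal.real_coe_toENNReal, Real.enorm_eq_ofReal_abs]
  rcases le_total 0 (Real.log ‖z - w‖) with h0 | h0
  · rw [abs_of_nonneg h0]
    refine le_trans ?_ le_add_self
    exact ENNReal.ofReal_le_ofReal
      ((le_max_right _ _).trans (Real.posLog_le_posLog (norm_nonneg _) h))
  · rw [abs_of_nonpos h0]
    exact le_self_add

lemma neg_logKernel_toENNReal_le (z w : ℂ) {R : ℝ} (h : ‖z - w‖ ≤ R) :
    (-logKernel z w).toENNReal ≤ ENNReal.ofReal (Real.posLog R) := by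
  rcases eq_or_ne z w with rfl | hne
  · simp [logKernel_self]
  rw [logKernel_of_ne hne, ← EReal.coe_neg, EReal.real_coe_toENNReal, neg_neg]
  exact ENNReal.ofReal_le_ofReal
      ((le_max_right _ _).trans (Real.posLog_le_posLog (norm_nonneg _) h))

/-- A measure of finite energy has no atoms and an integrable logarithmic kernel. -/
lemma integrable_log_of_energy_ne_top {V : ℂ → ℝ} {ν : Measure ℂ} [IsFiniteMeasure ν]
    {R M : ℝ} (hR : ∀ᵐ z ∂ν, ∀ᵐ w ∂ν, ‖z - w‖ ≤ R) (hM : ∀ᵐ z ∂ν, -M ≤ V z)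
    (hE : energy V ν ≠ ⊤) :
    Integrable (fun p : ℂ × ℂ => Real.log ‖p.1 - p.2‖) (ν.prod ν) ∧ NullSingletonClass ν := by
  set P : ℂ → ℝ≥0∞ := fun z => ∫⁻ w, (logKernel z w).toENNReal ∂ν with hP
  set N : ℂ → ℝ≥0∞ := fun z => ∫⁻ w, (-logKernel z w).toENNReal ∂ν with hN
  set L : ℝ := Real.posLog R * ν.real univ with hL
  have hL0 : 0 ≤ L := mul_nonneg Real.posLog_nonneg measureReal_nonneg
  have hNle : ∀ᵐ z ∂ν, N z ≤ ENNReal.ofReal L := by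
    filter_upwards [hR] with z hz
    calc N z ≤ ∫⁻ _, ENNReal.ofReal (Real.posLog R) ∂ν :=
          lintegral_mono_ae (hz.mono fun w hw => neg_logKernel_toENNReal_le z w hw)
      _ = ENNReal.ofReal L := by
          rw [lintegral_const, hL, ENNReal.ofReal_mul Real.posLog_nonneg, Measure.real,
            ENNReal.ofReal_toReal (measure_ne_top _ _)]
  have hU : ∀ z, logPotential ν z = (P z : EReal) - (N z : EReal) := fun z => rfl
  -- In `EReal`, `⊤ - ⊤ = ⊥`, so P can be recovered from V + U only because N is bounded by L.
  have key1 : ∀ᵐ z ∂ν, P z ≤ ((V z : EReal) + logPotential ν z).toENNReal +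
      ENNReal.ofReal (L + M) := by
    filter_upwards [hNle, hM] with z hz hMz
    rw [hU]
    by_cases hPt : P z = ⊤
    · have hn : (N z : EReal) ≠ ⊤ := by
        rw [Ne, EReal.coe_ennreal_eq_top_iff]
        exact (hz.trans_lt ENNReal.ofReal_lt_top).ne
      lift (N z : EReal) to ℝ using ⟨hn, EReal.coe_ennreal_ne_bot _⟩ with n
      rw [hPt, EReal.coe_ennreal_top, EReal.top_sub_coe, EReal.coe_add_top]
      simp
    · have hn : N z ≠ ⊤ := (hz.trans_lt ENNReal.ofReal_lt_top).ne
      rw [← EReal.coe_ennreal_toReal hPt, ← EReal.coe_ennreal_toReal hn, ← EReal.coe_sub,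
        ← EReal.coe_add, EReal.real_coe_toENNReal, ← ENNReal.ofReal_toReal hPt]
      have h1 : (N z).toReal ≤ L := by
        simpa [ENNReal.toReal_ofReal hL0] using
          ENNReal.toReal_mono ENNReal.ofReal_ne_top hz
      refine le_trans (ENNReal.ofReal_le_ofReal ?_) ENNReal.ofReal_add_le
      rw [ENNReal.toReal_ofReal ENNReal.toReal_nonneg]
      linarith
  have key2 : ∀ᵐ z ∂ν, (-((V z : EReal) + logPotential ν z)).toENNReal ≤
      ENNReal.ofReal (L + M) := by
    filter_upwards [hNle, hM] with z hz hMz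
    have hn : N z ≠ ⊤ := (hz.trans_lt ENNReal.ofReal_lt_top).ne
    have h1 : (N z).toReal ≤ L := by
      simpa [ENNReal.toReal_ofReal hL0] using ENNReal.toReal_mono ENNReal.ofReal_ne_top hz
    rw [hU]
    have h2 : ((-(L + M) : ℝ) : EReal) ≤ (V z : EReal) + ((P z : EReal) - (N z : EReal)) := by
      rw [← EReal.coe_ennreal_toReal hn]
      calc ((-(L + M) : ℝ) : EReal) ≤ ((V z + (0 - (N z).toReal) : ℝ) : EReal) := by
            rw [EReal.coe_le_coe_iff]; linarith
        _ ≤ _ := by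
            rw [EReal.coe_add, EReal.coe_sub]
            gcongr
            exact EReal.sub_le_sub (EReal.coe_ennreal_nonneg _) le_rfl
    calc _ ≤ (-((-(L + M) : ℝ) : EReal)).toENNReal :=
          EReal.toENNReal_le_toENNReal (EReal.neg_le_neg_iff.2 h2)
      _ = _ := by rw [← EReal.coe_neg, EReal.real_coe_toENNReal, neg_neg]
  have hneg : ∫⁻ z, (-((V z : EReal) + logPotential ν z)).toENNReal ∂ν ≠ ⊤ :=
    ((lintegral_mono_ae key2).trans_lt (by
      rw [lintegral_const]; exact ENNReal.mul_lt_top ENNReal.ofReal_lt_top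
        (measure_lt_top _ _))).ne
  have hpos : ∫⁻ z, ((V z : EReal) + logPotential ν z).toENNReal ∂ν ≠ ⊤ := by
    intro htop
    apply hE
    rw [energy, erealIntegral, htop, ← EReal.coe_ennreal_toReal hneg, EReal.coe_ennreal_top,
      EReal.top_sub_coe]
  have hPfin : ∫⁻ z, P z ∂ν ≠ ⊤ := by
    refine ((lintegral_mono_ae key1).trans_lt ?_).ne
    rw [lintegral_add_right _ measurable_const, lintegral_const]
    exact ENNReal.add_lt_top.2 ⟨hpos.lt_top,
      ENNReal.mul_lt_top ENNReal.ofReal_lt_top (measure_lt_top _ _)⟩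
  have hκm : Measurable (fun p : ℂ × ℂ => (logKernel p.1 p.2).toENNReal) :=
    measurable_logKernel.ereal_toENNReal
  have hκ : ∫⁻ p, (logKernel p.1 p.2).toENNReal ∂(ν.prod ν) ≠ ⊤ := by
    rwa [lintegral_prod _ hκm.aemeasurable]
  have hRp : ∀ᵐ p ∂(ν.prod ν), ‖p.1 - p.2‖ ≤ R := by
    refine (Measure.ae_prod_iff_ae_ae ?_).2 hR
    exact measurableSet_le (by fun_prop) measurable_const
  refine ⟨⟨(by fun_prop : Measurable fun p : ℂ × ℂ =>
    Real.log ‖p.1 - p.2‖).aestronglyMeasurable, ?_⟩, ⟨fun z => ?_⟩⟩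
  · refine (lintegral_mono_ae (hRp.mono fun p hp => enorm_log_le p.1 p.2 hp)).trans_lt ?_
    rw [lintegral_add_right _ measurable_const, lintegral_const]
    exact ENNReal.add_lt_top.2 ⟨hκ.lt_top,
      ENNReal.mul_lt_top ENNReal.ofReal_lt_top (measure_lt_top _ _)⟩
  -- The kernel is infinite on the diagonal, so the point (z, z) is null for the product measure,
  -- and its mass is the square of the mass of {z}.
  · have h1 : ∀ᵐ p ∂(ν.prod ν), p ≠ (z, z) := by
      filter_upwards [ae_lt_top hκm hκ] with p hp
      rintro rfl
      simp [logKernel_self] at hp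
    have h2 : (ν.prod ν) ({z} ×ˢ {z}) = 0 := by
      rw [singleton_prod_singleton]
      simpa [ae_iff] using h1
    rw [Measure.prod_prod] at h2
    simpa using h2

/-! ### Arc length on a circle -/

/-- Normalized Lebesgue measure on the parameter interval of a circle. -/
def angleMeasure : Measure ℝ := ENNReal.ofReal (2 * π)⁻¹ • volume.restrict (Ioc 0 (2 * π))

instance : IsProbabilityMeasure angleMeasure := by
  constructor
  rw [angleMeasure, Measure.smul_apply, Measure.restrict_apply_univ, Real.volume_Ioc, sub_zero,
    smul_eq_mul, ← ENNReal.ofReal_mul (by positivity), inv_mul_cancel₀ (by positivity),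
    ENNReal.ofReal_one]

lemma integral_angleMeasure {E : Type*} [NormedAddCommGroup E] [NormedSpace ℝ E] (g : ℝ → E) :
    ∫ θ, g θ ∂angleMeasure = (2 * π)⁻¹ • ∫ θ in (0 : ℝ)..2 * π, g θ := by
  rw [angleMeasure, integral_smul_measure, ENNReal.toReal_ofReal (by positivity),
    intervalIntegral.integral_of_le (by positivity)]

lemma integral_angleMeasure_circleMap {E : Type*} [NormedAddCommGroup E] [NormedSpace ℝ E]
    (g : ℂ → E) (z : ℂ) (ρ : ℝ) :
    ∫ θ, g (circleMap z ρ θ) ∂angleMeasure = Real.circleAverage g z ρ := by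
  rw [integral_angleMeasure, Real.circleAverage]

lemma integrable_angleMeasure_iff {E : Type*} [NormedAddCommGroup E] (g : ℝ → E) :
    Integrable g angleMeasure ↔ IntervalIntegrable g volume 0 (2 * π) := by
  rw [angleMeasure, integrable_smul_measure (by simp; positivity) (by simp),
    intervalIntegrable_iff_integrableOn_Ioc_of_le (by positivity), IntegrableOn]

lemma integrable_angleMeasure_circleMap_iff {E : Type*} [NormedAddCommGroup E]
    (g : ℂ → E) (z : ℂ) (ρ : ℝ) :
    Integrable (fun θ => g (circleMap z ρ θ)) angleMeasure ↔ CircleIntegrable g z ρ := by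
  rw [integrable_angleMeasure_iff, circleIntegrable_def]

lemma integrable_log_circleMap (z w : ℂ) (ρ : ℝ) :
    Integrable (fun θ => Real.log ‖circleMap z ρ θ - w‖) angleMeasure :=
  (integrable_angleMeasure_circleMap_iff (fun x => Real.log ‖x - w‖) z ρ).2
    (circleIntegrable_log_norm_sub_const ρ)

/-- Up to sign, the potential of the uniform measure on a circle: constant inside by Jensen's
formula, that of a unit mass at the center outside. -/
lemma integral_log_circleMap (z w : ℂ) {ρ : ℝ} (hρ : 0 < ρ) :
    ∫ θ, Real.log ‖circleMap z ρ θ - w‖ ∂angleMeasure = Real.log (max ρ ‖z - w‖) := by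
  rw [integral_angleMeasure_circleMap (fun x => Real.log ‖x - w‖),
    circleAverage_log_norm_sub_const_eq_log_radius_add_posLog hρ.ne', Real.posLog]
  rcases le_total ρ ‖z - w‖ with h | h
  · have h0 : 0 < ‖z - w‖ := hρ.trans_le h
    rw [max_eq_right h, max_eq_right, Real.log_mul (by positivity) h0.ne', Real.log_inv]
    · ring
    · exact Real.log_nonneg (by rw [inv_mul_eq_div, one_le_div hρ]; exact h)
  · rw [max_eq_left h, max_eq_left, add_zero]
    refine Real.log_nonpos (by positivity) ?_
    rw [inv_mul_eq_div, div_le_one hρ]; exact h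

/-- The uniform probability measure on a circle. -/
def circleMeasure (z : ℂ) (ρ : ℝ) : Measure ℂ := angleMeasure.map (circleMap z ρ)

instance (z : ℂ) (ρ : ℝ) : IsProbabilityMeasure (circleMeasure z ρ) :=
  Measure.isProbabilityMeasure_map (measurable_circleMap z ρ).aemeasurable

lemma integral_circleMeasure {E : Type*} [NormedAddCommGroup E] [NormedSpace ℝ E] {g : ℂ → E}
    {z : ℂ} {ρ : ℝ} (hg : AEStronglyMeasurable g (circleMeasure z ρ)) :
    ∫ x, g x ∂circleMeasure z ρ = ∫ θ, g (circleMap z ρ θ) ∂angleMeasure :=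
  integral_map (measurable_circleMap z ρ).aemeasurable hg

lemma circleMeasure_compl_sphere (z : ℂ) {ρ : ℝ} (hρ : 0 ≤ ρ) :
    circleMeasure z ρ (sphere z ρ)ᶜ = 0 := by
  rw [circleMeasure, Measure.map_apply (measurable_circleMap z ρ)
    isClosed_sphere.measurableSet.compl]
  convert measure_empty (μ := angleMeasure)
  ext θ
  simp [abs_of_nonneg hρ]

lemma noAtoms_circleMeasure (z : ℂ) {ρ : ℝ} (hρ : 0 < ρ) :
    NullSingletonClass (circleMeasure z ρ) := by
  refine ⟨fun w => ?_⟩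
  rw [circleMeasure, Measure.map_apply (measurable_circleMap z ρ) (measurableSet_singleton w),
    angleMeasure, Measure.smul_apply, smul_eq_mul,
    Measure.restrict_apply (measurable_circleMap z ρ (measurableSet_singleton w))]
  have : (circleMap z ρ ⁻¹' {w} ∩ Ioc 0 (2 * π)).Subsingleton := by
    rintro a ⟨ha, ha'⟩ b ⟨hb, hb'⟩
    refine injOn_circleMap_of_abs_sub_le (a := 0) (b := 2 * π) hρ.ne' ?_ ?_ ?_
      (ha.trans hb.symm)
    · rw [zero_sub, abs_neg, abs_of_pos Real.two_pi_pos]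
    · rwa [uIoc_of_le Real.two_pi_pos.le]
    · rwa [uIoc_of_le Real.two_pi_pos.le]
  rw [this.measure_zero, mul_zero]

/-! ### The variational inequality -/

lemma integrable_log_circleMeasure (z w : ℂ) (ρ : ℝ) :
    Integrable (fun x => Real.log ‖x - w‖) (circleMeasure z ρ) :=
  (integrable_map_measure (by fun_prop : Measurable fun x : ℂ =>
    Real.log ‖x - w‖).aestronglyMeasurable (measurable_circleMap z ρ).aemeasurable).2
    (integrable_log_circleMap z w ρ)

lemma integral_log_circleMeasure (z w : ℂ) {ρ : ℝ} (hρ : 0 < ρ) :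
    ∫ x, Real.log ‖x - w‖ ∂circleMeasure z ρ = Real.log (max ρ ‖z - w‖) := by
  rw [integral_circleMeasure (by fun_prop : Measurable fun x : ℂ =>
    Real.log ‖x - w‖).aestronglyMeasurable, integral_log_circleMap z w hρ]

lemma exists_norm_sub_le {K : Set ℂ} (hK : Bornology.IsBounded K) :
    ∃ R : ℝ, ∀ z ∈ K, ∀ w ∈ K, ‖z - w‖ ≤ R := by
  obtain ⟨R, hR⟩ := isBounded_iff.1 hK
  exact ⟨R, fun z hz w hw => by rw [← dist_eq_norm]; exact hR hz hw⟩

/-- The potential of the circle is at most log(1/ρ) everywhere, so the circle has finite mutual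
energy with every finite measure on K, itself included; this makes it an admissible competitor. -/
lemma integrable_log_circleMeasure_prod {K : Set ℂ} (hK : Bornology.IsBounded K)
    {z : ℂ} {ρ : ℝ} (hρ : 0 < ρ) (hz : sphere z ρ ⊆ K) {σ : Measure ℂ} [IsFiniteMeasure σ]
    (hσ : ∀ᵐ w ∂σ, w ∈ K) :
    Integrable (fun p : ℂ × ℂ => Real.log ‖p.1 - p.2‖) ((circleMeasure z ρ).prod σ) := by
  obtain ⟨R, hR⟩ := exists_norm_sub_le hK
  refine integrable_log_norm_sub_prod (circleMeasure z ρ) measurable_id σ (R := R)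
    (M := -Real.log ρ) ?_ (ae_of_all _ fun w => integrable_log_circleMeasure z w ρ)
    (ae_of_all _ fun w => ?_)
  · filter_upwards [hσ] with w hw
    have : ∀ᵐ x ∂circleMeasure z ρ, x ∈ sphere z ρ := circleMeasure_compl_sphere z hρ.le
    filter_upwards [this] with x hx using hR x (hz hx) w hw
  · simp only [id]
    rw [integral_log_circleMeasure z w hρ, neg_neg]
    exact Real.log_le_log hρ (le_max_left _ _)

lemma integrable_of_continuous_of_bounded {E : Type*} [NormedAddCommGroup E]
    [SecondCountableTopology E] {V : ℂ → E} (hV : Continuous V) {K : Set ℂ}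
    (hK : Bornology.IsBounded K) {σ : Measure ℂ} [IsFiniteMeasure σ] (hσ : ∀ᵐ w ∂σ, w ∈ K) :
    Integrable V σ := by
  obtain ⟨C, hC⟩ := hK.isCompact_closure.exists_bound_of_continuousOn hV.continuousOn
  exact Integrable.of_bound hV.aestronglyMeasurable C
    (hσ.mono fun w hw => hC w (subset_closure hw))

section

variable {V : ℂ → ℝ} {K : Set ℂ} {μ : Measure ℂ}

/-- A circle inside K has finite energy, hence so does the minimizer. -/
lemma IsEquilibriumMeasure.integrable_log (hμ : IsEquilibriumMeasure V K μ) (hV : Continuous V)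
    (hK : Bornology.IsBounded K) (hK0 : (interior K).Nonempty) :
    Integrable (fun p : ℂ × ℂ => Real.log ‖p.1 - p.2‖) (μ.prod μ) ∧ NullSingletonClass μ := by
  have := hμ.prob
  have hμK : ∀ᵐ z ∂μ, z ∈ K := hμ.carried
  obtain ⟨R, hR⟩ := exists_norm_sub_le hK
  obtain ⟨z, hz⟩ := hK0
  obtain ⟨ρ, hρ, hball⟩ := nhds_basis_closedBall.mem_iff.1 (isOpen_interior.mem_nhds hz)
  have hs : sphere z ρ ⊆ K := sphere_subset_closedBall.trans (hball.trans interior_subset)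
  have hcK : ∀ᵐ x ∂circleMeasure z ρ, x ∈ K := by
    have : ∀ᵐ x ∂circleMeasure z ρ, x ∈ sphere z ρ := circleMeasure_compl_sphere z hρ.le
    exact this.mono fun x hx => hs hx
  have := noAtoms_circleMeasure z hρ
  obtain ⟨M, hM⟩ := hK.isCompact_closure.exists_bound_of_continuousOn hV.continuousOn
  refine integrable_log_of_energy_ne_top (V := V) (R := R) (M := M) ?_ ?_ ?_
  · filter_upwards [hμK] with z hz
    filter_upwards [hμK] with w hw using hR z hz w hw
  · filter_upwards [hμK] with z hz using (abs_le.1 (hM z (subset_closure hz))).1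
  · refine ne_top_of_le_ne_top ?_ (hμ.minimal (circleMeasure z ρ) inferInstance hcK)
    rw [energy_eq_coe (integrable_of_continuous_of_bounded hV hK hcK)
      (integrable_log_circleMeasure_prod hK hρ hs hcK)]
    exact EReal.coe_ne_top _

lemma nonneg_of_forall_add_mul_nonneg {X Y : ℝ} (h : ∀ t ∈ Ioo (0 : ℝ) 1, 0 ≤ X + t * Y) :
    0 ≤ X := by
  have h1 : Tendsto (fun t : ℝ => X + t * Y) (𝓝[>] 0) (𝓝 (X + 0 * Y)) :=
    ((by fun_prop : Continuous fun t : ℝ => X + t * Y).tendsto 0).mono_left nhdsWithin_le_nhds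
  rw [zero_mul, add_zero] at h1
  exact ge_of_tendsto h1 (eventually_of_mem (Ioo_mem_nhdsGT one_pos) h)

/-- The first variation of the energy at an equilibrium measure is nonnegative. -/
lemma IsEquilibriumMeasure.variation (hμ : IsEquilibriumMeasure V K μ) (hV : Continuous V)
    (hK : Bornology.IsBounded K) [NullSingletonClass μ]
    (hi : Integrable (fun p : ℂ × ℂ => Real.log ‖p.1 - p.2‖) (μ.prod μ))
    {ν : Measure ℂ} [IsProbabilityMeasure ν] [NullSingletonClass ν] (hνK : ∀ᵐ z ∂ν, z ∈ K)
    (hνν : Integrable (fun p : ℂ × ℂ => Real.log ‖p.1 - p.2‖) (ν.prod ν))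
    (hνμ : Integrable (fun p : ℂ × ℂ => Real.log ‖p.1 - p.2‖) (ν.prod μ)) :
    ∫ z, V z ∂μ - 2 * ∫ p, Real.log ‖p.1 - p.2‖ ∂μ.prod μ ≤
      ∫ z, V z ∂ν - 2 * ∫ p, Real.log ‖p.1 - p.2‖ ∂ν.prod μ := by
  have := hμ.prob
  have hμK : ∀ᵐ z ∂μ, z ∈ K := hμ.carried
  have hsymm : (fun p : ℂ × ℂ => Real.log ‖p.1 - p.2‖) ∘ Prod.swap =
      fun p : ℂ × ℂ => Real.log ‖p.1 - p.2‖ := by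
    ext p; simp [norm_sub_rev]
  have hμν : Integrable (fun p : ℂ × ℂ => Real.log ‖p.1 - p.2‖) (μ.prod ν) := by
    rw [← hsymm]; exact hνμ.swap
  have hB : ∫ p, Real.log ‖p.1 - p.2‖ ∂μ.prod ν = ∫ p, Real.log ‖p.1 - p.2‖ ∂ν.prod μ := by
    rw [← integral_prod_swap]
    simp [norm_sub_rev]
  set A := ∫ p, Real.log ‖p.1 - p.2‖ ∂μ.prod μ
  set B := ∫ p, Real.log ‖p.1 - p.2‖ ∂ν.prod μ
  set C := ∫ p, Real.log ‖p.1 - p.2‖ ∂ν.prod ν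
  have hVμ := integrable_of_continuous_of_bounded hV hK hμK
  have hVν := integrable_of_continuous_of_bounded hV hK hνK
  -- Along (1-t)μ + tν the energy is quadratic in t, and t times this expression is its increment.
  -- Letting t tend to 0 leaves the first variation; the factor 2 comes from the two equal cross
  -- terms.
  suffices h : ∀ t ∈ Ioo (0 : ℝ) 1, 0 ≤ (∫ z, V z ∂ν - ∫ z, V z ∂μ + 2 * A - 2 * B) +
      t * (2 * B - A - C) by
    linarith [nonneg_of_forall_add_mul_nonneg h]
  rintro t ⟨ht0, ht1⟩
  set s := ENNReal.ofReal (1 - t)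
  set s' := ENNReal.ofReal t
  have hs : s ≠ ⊤ := ENNReal.ofReal_ne_top
  have hs' : s' ≠ ⊤ := ENNReal.ofReal_ne_top
  have hst : s.toReal = 1 - t := ENNReal.toReal_ofReal (by linarith)
  have hst' : s'.toReal = t := ENNReal.toReal_ofReal ht0.le
  set m := s • μ + s' • ν with hm
  have hmp : IsProbabilityMeasure m := by
    constructor
    rw [hm, Measure.add_apply, Measure.smul_apply, Measure.smul_apply, measure_univ, measure_univ,
      smul_eq_mul, smul_eq_mul, mul_one, mul_one, ← ENNReal.ofReal_add (by linarith) ht0.le]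
    simp
  have hmK : ∀ᵐ z ∂m, z ∈ K := by
    rw [hm, ae_add_measure_iff]
    exact ⟨Measure.ae_smul_measure hμK _, Measure.ae_smul_measure hνK _⟩
  have hmn : NullSingletonClass m := ⟨fun z => by simp [hm]⟩
  have hprod : m.prod m = (s • s • μ.prod μ + s • s' • ν.prod μ) +
      (s' • s • μ.prod ν + s' • s' • ν.prod ν) := by
    rw [hm, Measure.prod_add, Measure.prod_smul_right, Measure.prod_smul_right, Measure.add_prod,
      Measure.add_prod, Measure.prod_smul_left, Measure.prod_smul_left, Measure.prod_smul_left,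
      Measure.prod_smul_left]
    simp only [smul_add]
  have i1 := (hi.smul_measure hs).smul_measure hs
  have i2 := (hνμ.smul_measure hs').smul_measure hs
  have i3 := (hμν.smul_measure hs).smul_measure hs'
  have i4 := (hνν.smul_measure hs').smul_measure hs'
  have him : Integrable (fun p : ℂ × ℂ => Real.log ‖p.1 - p.2‖) (m.prod m) := by
    rw [hprod]
    exact (i1.add_measure i2).add_measure (i3.add_measure i4)
  have hmin := hμ.minimal m hmp hmK
  rw [energy_eq_coe hVμ hi, energy_eq_coe (integrable_of_continuous_of_bounded hV hK hmK) him,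
    EReal.coe_le_coe_iff, ← integral_prod _ hi, ← integral_prod _ him, hprod,
    integral_add_measure (i1.add_measure i2) (i3.add_measure i4), integral_add_measure i1 i2,
    integral_add_measure i3 i4, hm,
    integral_add_measure (hVμ.smul_measure hs) (hVν.smul_measure hs')] at hmin
  simp only [integral_smul_measure, hst, hst', smul_eq_mul, hB] at hmin
  have h5 : 0 ≤ t * ((∫ z, V z ∂ν - ∫ z, V z ∂μ + 2 * A - 2 * B) + t * (2 * B - A - C)) := by
    linear_combination hmin
  exact (mul_nonneg_iff_of_pos_left ht0).1 h5

/-- Testing the variational inequality with uniform measures on circles. -/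
lemma IsEquilibriumMeasure.circle_variation (hμ : IsEquilibriumMeasure V K μ)
    (hV : Continuous V) (hK : Bornology.IsBounded K) [NullSingletonClass μ]
    (hi : Integrable (fun p : ℂ × ℂ => Real.log ‖p.1 - p.2‖) (μ.prod μ))
    {z : ℂ} {ρ : ℝ} (hρ : 0 < ρ) (hz : sphere z ρ ⊆ K) :
    ∫ x, (V x - 2 * ∫ w, Real.log ‖x - w‖ ∂μ) ∂μ ≤
      Real.circleAverage V z ρ - 2 * ∫ w, Real.log (max ρ ‖z - w‖) ∂μ := by
  have := hμ.prob
  have hμK : ∀ᵐ z ∂μ, z ∈ K := hμ.carried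
  have hcK : ∀ᵐ x ∂circleMeasure z ρ, x ∈ K := by
    have : ∀ᵐ x ∂circleMeasure z ρ, x ∈ sphere z ρ := circleMeasure_compl_sphere z hρ.le
    exact this.mono fun x hx => hz hx
  have := noAtoms_circleMeasure z hρ
  have hp := integrable_log_circleMeasure_prod hK hρ hz hμK
  have h := hμ.variation hV hK hi hcK (integrable_log_circleMeasure_prod hK hρ hz hcK) hp
  have hj : Integrable (fun x => ∫ w, Real.log ‖x - w‖ ∂μ) μ := hi.integral_prod_left
  rw [integral_prod _ hi, integral_prod_symm _ hp, integral_circleMeasure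
    hV.aestronglyMeasurable, integral_angleMeasure_circleMap] at h
  rw [integral_sub (integrable_of_continuous_of_bounded hV hK hμK) (hj.const_mul 2),
    integral_const_mul]
  simpa only [integral_log_circleMeasure z _ hρ] using h

end

/-! ### Boundedness of the density -/

/-- Besicovitch: centred closed balls form a Vitali family for μ, so a comparison on small balls
around almost every point becomes a comparison of measures. -/
lemma measure_le_smul_volume {μ : Measure ℂ} [IsFiniteMeasure μ] {C : NNReal}
    (h : ∀ᵐ z ∂μ, ∀ᶠ s in 𝓝[>] (0 : ℝ),
      μ (closedBall z s) ≤ C * volume (closedBall z s)) : μ ≤ C • volume := by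
  refine Measure.le_iff'.2 fun s => ?_
  set G := {z | ∀ᶠ s in 𝓝[>] (0 : ℝ), μ (closedBall z s) ≤ C * volume (closedBall z s)} with hG
  calc μ s ≤ μ (s ∩ G) + μ (s \ G) := measure_le_inter_add_sdiff μ s G
    _ = μ (s ∩ G) := by
        have : μ (s \ G) = 0 := measure_mono_null (fun z hz => hz.2) h
        rw [this, add_zero]
    _ ≤ (C • volume : Measure ℂ) (s ∩ G) := by
        refine (Besicovitch.vitaliFamily μ).measure_le_of_frequently_le _
          Measure.AbsolutelyContinuous.rfl _ fun z hz => ?_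
        refine (Besicovitch.tendsto_filterAt μ z).frequently (Eventually.frequently ?_)
        exact hz.2
    _ ≤ (C • volume : Measure ℂ) s := measure_mono inter_subset_left

section

variable {V : ℂ → ℝ} {K : Set ℂ} {μ : Measure ℂ} {κ : ℝ}

lemma integrable_log_max {K : Set ℂ} (hK : Bornology.IsBounded K) {σ : Measure ℂ}
    [IsFiniteMeasure σ] (hσ : ∀ᵐ w ∂σ, w ∈ K) (z : ℂ) {ρ : ℝ} (hρ : 0 < ρ) :
    Integrable (fun w => Real.log (max ρ ‖z - w‖)) σ := by
  refine integrable_of_continuous_of_bounded ?_ hK hσ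
  exact (by fun_prop : Continuous fun w : ℂ => max ρ ‖z - w‖).log
    fun w => (hρ.trans_le (le_max_left _ _)).ne'

/-- Euler-Lagrange inequality inside the cut-off. -/
lemma IsEquilibriumMeasure.le_of_mem_interior (hμ : IsEquilibriumMeasure V K μ)
    (hV : Continuous V) (hVavg : ∀ z ρ, 0 < ρ → Real.circleAverage V z ρ = V z + κ * ρ ^ 2)
    (hK : Bornology.IsBounded K) [NullSingletonClass μ]
    (hi : Integrable (fun p : ℂ × ℂ => Real.log ‖p.1 - p.2‖) (μ.prod μ))
    {z : ℂ} (hz : z ∈ interior K) (hzi : Integrable (fun w => Real.log ‖z - w‖) μ) :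
    ∫ x, (V x - 2 * ∫ w, Real.log ‖x - w‖ ∂μ) ∂μ ≤ V z - 2 * ∫ w, Real.log ‖z - w‖ ∂μ := by
  have := hμ.prob
  have h1 : Tendsto (fun ρ : ℝ => V z + κ * ρ ^ 2 - 2 * ∫ w, Real.log ‖z - w‖ ∂μ) (𝓝[>] 0)
      (𝓝 (V z + κ * 0 ^ 2 - 2 * ∫ w, Real.log ‖z - w‖ ∂μ)) :=
    ((by fun_prop : Continuous fun ρ : ℝ =>
      V z + κ * ρ ^ 2 - 2 * ∫ w, Real.log ‖z - w‖ ∂μ).tendsto 0).mono_left nhdsWithin_le_nhds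
  rw [zero_pow two_ne_zero, mul_zero, add_zero] at h1
  obtain ⟨ε, hε, hball⟩ := nhds_basis_closedBall.mem_iff.1 (isOpen_interior.mem_nhds hz)
  refine ge_of_tendsto h1 (eventually_of_mem (Ioo_mem_nhdsGT hε) fun ρ hρ => ?_)
  have hs : sphere z ρ ⊆ K := sphere_subset_closedBall.trans
    ((closedBall_subset_closedBall hρ.2.le).trans (hball.trans interior_subset))
  have h2 := hμ.circle_variation hV hK hi hρ.1 hs
  rw [hVavg z ρ hρ.1] at h2
  refine h2.trans ?_
  -- The smoothing of the logarithm is dropped before ρ tends to 0, so only the circle average of V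
  -- has to converge.
  have h3 : ∫ w, Real.log ‖z - w‖ ∂μ ≤ ∫ w, Real.log (max ρ ‖z - w‖) ∂μ := by
    refine integral_mono_ae hzi (integrable_log_max hK hμ.carried z hρ.1) ?_
    have : ∀ᵐ w ∂μ, w ≠ z := by simp [ae_iff]
    filter_upwards [this] with w hw
    exact Real.log_le_log (norm_sub_pos_iff.2 hw.symm) (le_max_right _ _)
  linarith

/-- The right side is the μ-mean of a function that is almost everywhere at least that mean. -/
lemma IsEquilibriumMeasure.ae_eq (hμ : IsEquilibriumMeasure V K μ)
    (hV : Continuous V) (hVavg : ∀ z ρ, 0 < ρ → Real.circleAverage V z ρ = V z + κ * ρ ^ 2)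
    (hK : Bornology.IsBounded K) (hKi : ∀ᵐ z ∂μ, z ∈ interior K) [NullSingletonClass μ]
    (hi : Integrable (fun p : ℂ × ℂ => Real.log ‖p.1 - p.2‖) (μ.prod μ)) :
    ∀ᵐ z ∂μ, V z - 2 * ∫ w, Real.log ‖z - w‖ ∂μ =
      ∫ x, (V x - 2 * ∫ w, Real.log ‖x - w‖ ∂μ) ∂μ := by
  have := hμ.prob
  set F := ∫ x, (V x - 2 * ∫ w, Real.log ‖x - w‖ ∂μ) ∂μ with hF
  have hj : Integrable (fun x => ∫ w, Real.log ‖x - w‖ ∂μ) μ := hi.integral_prod_left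
  have hW : Integrable (fun x => V x - 2 * ∫ w, Real.log ‖x - w‖ ∂μ) μ :=
    (integrable_of_continuous_of_bounded hV hK hμ.carried).sub (hj.const_mul 2)
  have h0 : 0 ≤ᵐ[μ] fun x => V x - 2 * ∫ w, Real.log ‖x - w‖ ∂μ - F := by
    filter_upwards [hKi, hi.prod_right_ae] with z hz hzi
    exact sub_nonneg.2 (hμ.le_of_mem_interior hV hVavg hK hi hz hzi)
  have h1 : ∫ x, (V x - 2 * ∫ w, Real.log ‖x - w‖ ∂μ - F) ∂μ = 0 := by
    rw [integral_sub hW (integrable_const _), integral_const, ← hF]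
    simp
  filter_upwards [(integral_eq_zero_iff_of_nonneg_ae h0 (hW.sub (integrable_const _))).1 h1]
    with z hz
  exact sub_eq_zero.1 hz

/-- An equilibrium measure that does not charge the boundary of the cut-off has bounded
density. -/
lemma IsEquilibriumMeasure.le_smul_volume (hμ : IsEquilibriumMeasure V K μ)
    (hV : Continuous V) (hVavg : ∀ z ρ, 0 < ρ → Real.circleAverage V z ρ = V z + κ * ρ ^ 2)
    (hκ : 0 ≤ κ)
    (hK : Bornology.IsBounded K) (hKi : ∀ᵐ z ∂μ, z ∈ interior K) [NullSingletonClass μ]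
    (hi : Integrable (fun p : ℂ × ℂ => Real.log ‖p.1 - p.2‖) (μ.prod μ)) :
    ∃ C : NNReal, μ ≤ C • volume := by
  have := hμ.prob
  -- On the circle of radius 2s around a point of equality, the variational inequality reads 2∫(log
  -- max(2s,|z-w|) - log|z-w|) dμ ≤ κ(2s)². The integrand is nonnegative, and at least log 2 on the
  -- ball of radius s, so that ball has mass at most 2κs²/log 2, to be compared with its area πs².
  refine ⟨Real.toNNReal (2 * κ / (Real.log 2 * π)), measure_le_smul_volume ?_⟩
  filter_upwards [hKi, hi.prod_right_ae, hμ.ae_eq hV hVavg hK hKi hi] with z hz hzi hzF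
  obtain ⟨ε, hε, hball⟩ := nhds_basis_closedBall.mem_iff.1 (isOpen_interior.mem_nhds hz)
  filter_upwards [Ioo_mem_nhdsGT (half_pos hε)] with s hs
  have hs0 : 0 < s := hs.1
  have hρ : 0 < 2 * s := by linarith
  have hsph : sphere z (2 * s) ⊆ K := sphere_subset_closedBall.trans
    ((closedBall_subset_closedBall (by linarith [hs.2])).trans (hball.trans interior_subset))
  have h2 := hμ.circle_variation hV hK hi hρ hsph
  rw [hVavg z _ hρ, ← hzF] at h2
  have him := integrable_log_max hK hμ.carried z hρ
  have hne : ∀ᵐ w ∂μ, w ≠ z := by simp [ae_iff]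
  have h3 : Real.log 2 * μ.real (closedBall z s) ≤
      ∫ w, (Real.log (max (2 * s) ‖z - w‖) - Real.log ‖z - w‖) ∂μ := by
    have : ∫ w, (closedBall z s).indicator (fun _ => Real.log 2) w ∂μ ≤
        ∫ w, (Real.log (max (2 * s) ‖z - w‖) - Real.log ‖z - w‖) ∂μ := by
      refine integral_mono_ae ((integrable_const _).indicator
        isClosed_closedBall.measurableSet) (him.sub hzi) ?_
      filter_upwards [hne] with w hw
      have hp : 0 < ‖z - w‖ := norm_sub_pos_iff.2 hw.symm
      by_cases hws : w ∈ closedBall z s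
      · rw [indicator_of_mem hws]
        have hd : ‖z - w‖ ≤ s := by rwa [mem_closedBall', dist_eq_norm] at hws
        rw [max_eq_left (by linarith), ← Real.log_div hρ.ne' hp.ne']
        refine Real.log_le_log two_pos ?_
        rw [le_div_iff₀ hp]
        linarith
      · rw [indicator_of_notMem hws]
        exact sub_nonneg.2 (Real.log_le_log hp (le_max_right _ _))
    rwa [integral_indicator_const _ isClosed_closedBall.measurableSet, smul_eq_mul,
      mul_comm] at this
  rw [integral_sub him hzi] at h3
  have hlog : 0 < Real.log 2 := Real.log_pos one_lt_two
  have h4 : μ.real (closedBall z s) ≤ 2 * κ / (Real.log 2 * π) * (s ^ 2 * π) := by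
    rw [show 2 * κ / (Real.log 2 * π) * (s ^ 2 * π) = 2 * κ * s ^ 2 / Real.log 2 by
      field_simp, le_div_iff₀ hlog]
    nlinarith
  rw [Complex.volume_closedBall, ← ofReal_measureReal]
  refine (ENNReal.ofReal_le_ofReal h4).trans_eq ?_
  have e : ((NNReal.pi : NNReal) : ℝ≥0∞) = ENNReal.ofReal π := by
    rw [← NNReal.coe_real_pi, ENNReal.ofReal_coe_nnreal]
  rw [ENNReal.ofReal_mul (by positivity), ENNReal.ofReal_mul (by positivity),
    ENNReal.ofReal_pow hs0.le, e]
  rfl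

end

/-! ### Convolution with a locally integrable kernel -/

section

variable {μ : Measure ℂ} {C : NNReal}

/-- The density bound transfers integrability from Lebesgue measure on the compact closure of K to
μ. -/
lemma integrable_kernel_translate {E : Type*} [NormedAddCommGroup E] (hC : μ ≤ C • volume)
    {K : Set ℂ} (hK : Bornology.IsBounded K) (hμK : ∀ᵐ w ∂μ, w ∈ K) {k : ℂ → E}
    (hk : LocallyIntegrable k) (z : ℂ) : Integrable (fun w => k (z - w)) μ := by
  have h1 : LocallyIntegrable (fun w => k (z - w)) := by
    intro w
    obtain ⟨s, hs, hks⟩ := hk (z - w)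
    refine ⟨(fun w => z - w) ⁻¹' s,
      (by fun_prop : Continuous fun w : ℂ => z - w).continuousAt hs, ?_⟩
    have hm : MeasurePreserving (fun w : ℂ => z - w) := Measure.measurePreserving_sub_left volume z
    exact (hm.integrableOn_comp_preimage
      (MeasurableEquiv.subLeft z).measurableEmbedding).2 hks
  have h2 : IntegrableOn (fun w => k (z - w)) (closure K) volume :=
    h1.integrableOn_isCompact hK.isCompact_closure
  have h3 : IntegrableOn (fun w => k (z - w)) (closure K) (C • volume) := by
    rw [IntegrableOn, Measure.restrict_smul]
    exact h2.integrable.smul_measure_nnreal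
  have h4 : IntegrableOn (fun w => k (z - w)) (closure K) μ := h3.mono_measure hC
  rwa [IntegrableOn, Measure.restrict_eq_self_of_ae_mem
    (hμK.mono fun w hw => subset_closure hw)] at h4

/-- The potential of a compactly supported measure with bounded density is continuous. -/
lemma continuous_integral_kernel_translate {E : Type*} [NormedAddCommGroup E] [NormedSpace ℝ E]
    [SecondCountableTopology E] [IsFiniteMeasure μ] (hC : μ ≤ C • volume)
    {K : Set ℂ} (hK : Bornology.IsBounded K) (hμK : ∀ᵐ w ∂μ, w ∈ K) {k : ℂ → E}
    (hk : LocallyIntegrable k) (hkc : ContinuousOn k {0}ᶜ) :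
    Continuous fun z => ∫ w, k (z - w) ∂μ := by
  -- the kernel with a neighbourhood of the singularity cut off
  set χ : ℝ → ℂ → ℝ := fun δ x => max 0 (min 1 (2 * ‖x‖ / δ - 1)) with hχ
  have hχc : ∀ δ, Continuous (χ δ) := fun δ => by fun_prop
  have hχ0 : ∀ δ x, 0 ≤ χ δ x := fun δ x => le_max_left _ _
  have hχ1 : ∀ δ x, χ δ x ≤ 1 := fun δ x => max_le zero_le_one (min_le_left _ _)
  have hχo : ∀ δ > 0, ∀ x, δ ≤ ‖x‖ → χ δ x = 1 := fun δ hδ x hx => by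
    have : 1 ≤ 2 * ‖x‖ / δ - 1 := by
      rw [le_sub_iff_add_le, le_div_iff₀ hδ]; linarith
    simp only [hχ, min_eq_left this, max_eq_right zero_le_one]
  have hχi : ∀ δ > 0, ∀ x, ‖x‖ ≤ δ / 2 → χ δ x = 0 := fun δ hδ x hx => by
    have : 2 * ‖x‖ / δ - 1 ≤ 0 := by
      rw [sub_nonpos, div_le_one hδ]; linarith
    simp only [hχ]
    exact max_eq_left ((min_le_right _ _).trans this)
  have hcont : ∀ δ > 0, Continuous fun x => χ δ x • k x := by
    intro δ hδ
    rw [continuous_iff_continuousAt]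
    intro x
    rcases eq_or_ne x 0 with rfl | hx
    · have : (fun x => χ δ x • k x) =ᶠ[𝓝 0] fun _ => 0 := by
        filter_upwards [closedBall_mem_nhds (0 : ℂ) (half_pos hδ)] with x hx
        rw [hχi δ hδ x (by simpa using hx), zero_smul]
      exact (continuousAt_congr this).2 continuousAt_const
    · exact (hχc δ).continuousAt.smul (hkc.continuousAt (isOpen_compl_singleton.mem_nhds hx))
  have hcc : ∀ n : ℕ, Continuous fun z => ∫ w, χ (1 / (n + 1)) (z - w) • k (z - w) ∂μ := by
    intro n
    have hδ : (0 : ℝ) < 1 / (n + 1) := by positivity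
    rw [continuous_iff_continuousAt]
    intro z₀
    obtain ⟨R, hR⟩ := exists_norm_sub_le (hK.union (isBounded_closedBall (x := z₀) (r := 1)))
    obtain ⟨B, hB⟩ := (isCompact_closedBall (0 : ℂ) R).exists_bound_of_continuousOn
      (hcont _ hδ).continuousOn
    refine continuousAt_of_dominated (bound := fun _ => B) (Eventually.of_forall fun z => ?_) ?_
      (integrable_const _) (ae_of_all _ fun w => ?_)
    · exact ((hcont _ hδ).comp (continuous_const.sub continuous_id)).aestronglyMeasurable
    · filter_upwards [closedBall_mem_nhds z₀ one_pos] with z hz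
      filter_upwards [hμK] with w hw
      refine hB (z - w) ?_
      rw [mem_closedBall_zero_iff]
      exact hR z (Or.inr hz) w (Or.inl hw)
    · exact ((hcont _ hδ).comp (continuous_id.sub continuous_const)).continuousAt
  set g : ℕ → ℂ → ℝ := fun n x => (ball (0 : ℂ) (1 / (n + 1))).indicator (fun x => ‖k x‖) x with hg
  -- The cut-off changes the kernel only within 1/(n+1) of the singularity. The density bound and
  -- translation invariance of Lebesgue measure make the error independent of z, so the convergence
  -- is uniform.
  have hbound : ∀ n : ℕ, ∀ z, ‖∫ w, k (z - w) ∂μ - ∫ w, χ (1 / (n + 1)) (z - w) • k (z - w) ∂μ‖ ≤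
      C * ∫ x, g n x := by
    intro n z
    have hδ : (0 : ℝ) < 1 / (n + 1) := by positivity
    have hgi : Integrable (g n) := by
      refine IntegrableOn.integrable_indicator ?_ isOpen_ball.measurableSet
      exact ((hk.integrableOn_isCompact
        (isCompact_closedBall (0 : ℂ) (1 / (n + 1)))).mono_set ball_subset_closedBall).norm
    have hgz : Integrable (fun w => g n (z - w)) := hgi.comp_sub_left z
    have i1 := integrable_kernel_translate hC hK hμK hk z
    have i2 := integrable_kernel_translate hC hK hμK (hcont _ hδ).locallyIntegrable z
    rw [← integral_sub i1 i2]
    calc _ ≤ ∫ w, g n (z - w) ∂μ := by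
          refine norm_integral_le_of_norm_le ?_ (ae_of_all _ fun w => ?_)
          · exact (hgz.smul_measure_nnreal (c := C)).mono_measure hC
          · by_cases hw : z - w ∈ ball (0 : ℂ) (1 / (n + 1))
            · simp only [hg, indicator_of_mem hw]
              rw [← one_smul ℝ (k (z - w)), smul_smul, mul_one, ← sub_smul, norm_smul, one_smul]
              refine mul_le_of_le_one_left (norm_nonneg _) ?_
              rw [Real.norm_of_nonneg (sub_nonneg.2 (hχ1 _ _))]
              linarith [hχ0 (1 / (n + 1)) (z - w)]
            · simp only [hg, indicator_of_notMem hw]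
              rw [hχo _ hδ _ (by simpa using hw), one_smul, sub_self, norm_zero]
      _ ≤ ∫ w, g n (z - w) ∂(C • volume) := by
          refine integral_mono_measure hC (ae_of_all _ fun w => ?_) hgz.smul_measure_nnreal
          exact indicator_nonneg (fun _ _ => norm_nonneg _) _
      _ = C * ∫ x, g n x := by
          rw [integral_smul_nnreal_measure, integral_sub_left_eq_self (g n) volume z]
          rfl
  have hlim : Tendsto (fun n : ℕ => C * ∫ x, g n x) atTop (𝓝 (C * ∫ x : ℂ, (0 : ℝ))) := by
    refine Tendsto.const_mul _ ?_
    refine tendsto_integral_of_dominated_convergence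
      (fun x => (ball (0 : ℂ) 1).indicator (fun x => ‖k x‖) x) (fun n => ?_) ?_ (fun n => ?_) ?_
    · have : IntegrableOn (fun x => ‖k x‖) (ball (0 : ℂ) (1 / (n + 1))) :=
        ((hk.integrableOn_isCompact
          (isCompact_closedBall (0 : ℂ) (1 / (n + 1)))).mono_set ball_subset_closedBall).norm
      exact (this.integrable_indicator isOpen_ball.measurableSet).aestronglyMeasurable
    · exact IntegrableOn.integrable_indicator ((hk.integrableOn_isCompact
        (isCompact_closedBall (0 : ℂ) 1)).mono_set ball_subset_closedBall).norm
        isOpen_ball.measurableSet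
    · refine ae_of_all _ fun x => ?_
      rw [Real.norm_of_nonneg (indicator_nonneg (fun _ _ => norm_nonneg _) _)]
      refine indicator_le_indicator_of_subset (ball_subset_ball ?_) (fun _ => norm_nonneg _) x
      rw [div_le_one (by positivity)]
      linarith [n.cast_nonneg (α := ℝ)]
    · have : ∀ᵐ x : ℂ, x ≠ 0 := by simp [ae_iff]
      filter_upwards [this] with x hx
      refine tendsto_const_nhds.congr' ?_
      filter_upwards [(tendsto_one_div_add_atTop_nhds_zero_nat (𝕜 := ℝ)).eventually
        (gt_mem_nhds (norm_pos_iff.2 hx))] with n hn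
      rw [hg]
      simp only
      rw [indicator_of_notMem]
      simpa using hn.le
  rw [integral_zero, mul_zero] at hlim
  refine TendstoUniformly.continuous (F := fun (n : ℕ) z =>
    ∫ w, χ (1 / (n + 1)) (z - w) • k (z - w) ∂μ) (p := atTop) ?_
    (Frequently.of_forall hcc)
  rw [tendstoUniformly_iff]
  intro ε hε
  filter_upwards [hlim.eventually (gt_mem_nhds hε)] with n hn z
  rw [dist_eq_norm]
  exact (hbound n z).trans_lt hn

end

/-! ### Weighted circle averages of harmonic functions and logarithms -/

lemma norm_circleMap_zero_one (θ : ℝ) : ‖circleMap 0 1 θ‖ = 1 := by simp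

lemma sub_ne_zero_of_norm_lt_one {b e : ℂ} (hb : ‖b‖ < 1) (he : ‖e‖ = 1) : e - b ≠ 0 := by
  rintro h
  rw [sub_eq_zero.1 h] at he
  linarith

lemma continuous_weight {b : ℂ} (hb : ‖b‖ < 1) :
    Continuous fun θ : ℝ => circleMap 0 1 θ / (circleMap 0 1 θ - b) ^ 2 := by
  refine (continuous_circleMap 0 1).div (by fun_prop) fun θ => ?_
  exact pow_ne_zero 2 (sub_ne_zero_of_norm_lt_one hb (norm_circleMap_zero_one θ))

lemma integrable_angleMeasure_of_continuous {E : Type*} [NormedAddCommGroup E] {g : ℝ → E}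
    (hg : Continuous g) : Integrable g angleMeasure :=
  (integrable_angleMeasure_iff g).2 (hg.intervalIntegrable _ _)

lemma conj_eq_inv_of_norm_eq_one {e : ℂ} (he : ‖e‖ = 1) : conj e = e⁻¹ := by
  rw [Complex.inv_def, Complex.normSq_eq_norm_sq, he]; simp

/-- For G itself this is Cauchy's formula for the derivative at b. The conjugate of G contributes
nothing: since ē = e⁻¹ on the circle, its integrand is the conjugate of w G(w)/(1 - b̄w)², which is
holomorphic on the closed disc and vanishes at 0. -/
lemma integral_weight_mul_re {G : ℂ → ℂ} {R : ℝ} (hR : 1 < R)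
    (hG : DifferentiableOn ℂ G (ball 0 R)) {b : ℂ} (hb : ‖b‖ < 1) :
    ∫ θ, circleMap 0 1 θ / (circleMap 0 1 θ - b) ^ 2 * ((G (circleMap 0 1 θ)).re : ℂ)
      ∂angleMeasure = deriv G b / 2 := by
  have hsub : closedBall (0 : ℂ) 1 ⊆ ball 0 R := closedBall_subset_ball hR
  have hGc : Continuous fun θ => G (circleMap 0 1 θ) :=
    hG.continuousOn.comp_continuous (continuous_circleMap 0 1)
      fun θ => hsub (sphere_subset_closedBall (circleMap_mem_sphere 0 zero_le_one θ))
  have hw := continuous_weight hb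
  have h1 : ∫ θ, circleMap 0 1 θ / (circleMap 0 1 θ - b) ^ 2 * G (circleMap 0 1 θ)
      ∂angleMeasure = deriv G b := by
    rw [integral_angleMeasure_circleMap (fun e => e / (e - b) ^ 2 * G e),
      Real.circleAverage_eq_circleIntegral one_ne_zero,
      ← Complex.two_pi_I_inv_smul_circleIntegral_sub_sq_inv_smul_of_differentiable isOpen_ball
        hsub hG (mem_ball_zero_iff.2 hb)]
    congr 1
    refine circleIntegral.integral_congr zero_le_one fun e he => ?_
    have he1 : ‖e‖ = 1 := by simpa using he
    have he0 : e ≠ 0 := by rintro rfl; simp at he1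
    simp only [smul_eq_mul, sub_zero]
    field_simp
  have h2 : ∫ θ, circleMap 0 1 θ / (circleMap 0 1 θ - b) ^ 2 * conj (G (circleMap 0 1 θ))
      ∂angleMeasure = 0 := by
    have h3 : Real.circleAverage (fun w => w / (1 - conj b * w) ^ 2 * G w) 0 1 = 0 := by
      have hd : DifferentiableOn ℂ (fun w => w / (1 - conj b * w) ^ 2 * G w) (closedBall 0 1) := by
        refine DifferentiableOn.mul (DifferentiableOn.div differentiableOn_id (by fun_prop)
          fun w hw h => ?_) (hG.mono hsub)
        have hw1 : ‖w‖ ≤ 1 := by simpa using hw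
        have h4 : conj b * w = 1 := (sub_eq_zero.1 ((pow_eq_zero_iff two_ne_zero).1 h)).symm
        have h5 : ‖conj b * w‖ < 1 := by
          rw [norm_mul, Complex.norm_conj]
          nlinarith [norm_nonneg b, norm_nonneg w]
        rw [h4, norm_one] at h5
        exact lt_irrefl _ h5
      have h6 := DiffContOnCl.circleAverage (c := 0) (R := 1) (f := fun w =>
        w / (1 - conj b * w) ^ 2 * G w) (by
          rw [abs_one]
          refine ⟨hd.mono ball_subset_closedBall, ?_⟩
          rw [closure_ball _ one_ne_zero]
          exact hd.continuousOn)
      simpa using h6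
    rw [← integral_angleMeasure_circleMap (fun w => w / (1 - conj b * w) ^ 2 * G w)] at h3
    have h7 := congrArg conj h3
    rw [← integral_conj, map_zero] at h7
    refine (integral_congr_ae (ae_of_all _ fun θ => ?_)).trans h7
    have he1 := norm_circleMap_zero_one θ
    set e := circleMap 0 1 θ
    have he0 : e ≠ 0 := by intro h; rw [h] at he1; simp at he1
    have hne := sub_ne_zero_of_norm_lt_one hb he1
    simp only [map_mul, map_div₀, map_pow, map_sub, map_one, Complex.conj_conj,
      conj_eq_inv_of_norm_eq_one he1]
    congr 1
    have h8 : 1 - b * e⁻¹ = (e - b) * e⁻¹ := by field_simp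
    rw [h8]
    field_simp
  have hi1 : Integrable (fun θ => circleMap 0 1 θ / (circleMap 0 1 θ - b) ^ 2 *
      G (circleMap 0 1 θ)) angleMeasure := integrable_angleMeasure_of_continuous (hw.mul hGc)
  have hi2 : Integrable (fun θ => circleMap 0 1 θ / (circleMap 0 1 θ - b) ^ 2 *
      conj (G (circleMap 0 1 θ))) angleMeasure :=
    integrable_angleMeasure_of_continuous (hw.mul (Complex.continuous_conj.comp hGc))
  have h9 : ∀ θ, circleMap 0 1 θ / (circleMap 0 1 θ - b) ^ 2 * ((G (circleMap 0 1 θ)).re : ℂ) =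
      (circleMap 0 1 θ / (circleMap 0 1 θ - b) ^ 2 * G (circleMap 0 1 θ) +
      circleMap 0 1 θ / (circleMap 0 1 θ - b) ^ 2 * conj (G (circleMap 0 1 θ))) / 2 := fun θ => by
    rw [Complex.re_eq_add_conj]; ring
  simp_rw [h9]
  rw [integral_div, integral_add hi1 hi2, h1, h2, add_zero]

lemma ae_circleMap_ne (z w : ℂ) {ρ : ℝ} (hρ : 0 < ρ) :
    ∀ᵐ θ ∂angleMeasure, circleMap z ρ θ ≠ w := by
  have := noAtoms_circleMeasure z hρ
  have h : ∀ᵐ x ∂circleMeasure z ρ, x ≠ w := by simp [ae_iff]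
  exact ae_of_ae_map (measurable_circleMap z ρ).aemeasurable h

/-- Reflection in the unit circle. For |a| ≤ 1 the right side has no zero in the open disc, so log|e
- a| is the boundary value of the real part of a holomorphic logarithm. -/
lemma norm_sub_eq_norm_one_sub {a e : ℂ} (he : ‖e‖ = 1) : ‖e - a‖ = ‖1 - conj a * e‖ := by
  have h : 1 - conj a * e = conj (e - a) * e := by
    rw [map_sub, sub_mul, Complex.conj_mul', he]; simp
  rw [h, norm_mul, Complex.norm_conj, he, mul_one]

lemma integral_weight_mul_log_of_lt {a b : ℂ} (ha : ‖a‖ < 1) (hb : ‖b‖ < 1) :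
    ∫ θ, circleMap 0 1 θ / (circleMap 0 1 θ - b) ^ 2 * (Real.log ‖circleMap 0 1 θ - a‖ : ℂ)
      ∂angleMeasure = -conj a / (2 * (1 - conj a * b)) := by
  obtain ⟨R, hR, haR⟩ : ∃ R : ℝ, 1 < R ∧ ‖a‖ * R < 1 := by
    have h1 : Tendsto (fun R : ℝ => ‖a‖ * R) (𝓝[>] 1) (𝓝 (‖a‖ * 1)) :=
      ((by fun_prop : Continuous fun R : ℝ => ‖a‖ * R).tendsto 1).mono_left nhdsWithin_le_nhds
    rw [mul_one] at h1
    obtain ⟨R, h2, h3⟩ := ((h1.eventually (gt_mem_nhds ha)).and self_mem_nhdsWithin).exists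
    exact ⟨R, h3, h2⟩
  have hslit : ∀ w ∈ ball (0 : ℂ) R, 1 - conj a * w ∈ Complex.slitPlane := by
    intro w hw
    refine Or.inl ?_
    have hw1 : ‖w‖ < R := by simpa using hw
    have h1 : ‖conj a * w‖ < 1 := by
      rw [norm_mul, Complex.norm_conj]
      nlinarith [norm_nonneg a, norm_nonneg w]
    have := (Complex.re_le_norm (conj a * w)).trans_lt h1
    simp only [Complex.sub_re, Complex.one_re]
    linarith
  have hG : DifferentiableOn ℂ (fun w => Complex.log (1 - conj a * w)) (ball 0 R) :=
    DifferentiableOn.clog (by fun_prop) hslit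
  have hbR : b ∈ ball (0 : ℂ) R := by simpa using hb.trans hR
  have hd : deriv (fun w => Complex.log (1 - conj a * w)) b = -conj a / (1 - conj a * b) := by
    have h1 : HasDerivAt (fun w => 1 - conj a * w) (-conj a) b := by
      simpa using ((hasDerivAt_id b).const_mul (conj a)).const_sub 1
    exact (h1.clog (hslit b hbR)).deriv
  rw [mul_comm (2 : ℂ), ← div_div, ← hd, ← integral_weight_mul_re hR hG hb]
  refine integral_congr_ae (ae_of_all _ fun θ => ?_)
  simp only [Complex.log_re, norm_sub_eq_norm_one_sub (a := a) (norm_circleMap_zero_one θ)]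

/-- The case |a| = 1 is needed because a root of h - z reaches the unit circle when z lies on γ. It
is the limit of sa as s increases to 1. -/
lemma integral_weight_mul_log {a b : ℂ} (ha : ‖a‖ ≤ 1) (hb : ‖b‖ < 1) :
    ∫ θ, circleMap 0 1 θ / (circleMap 0 1 θ - b) ^ 2 * (Real.log ‖circleMap 0 1 θ - a‖ : ℂ)
      ∂angleMeasure = -conj a / (2 * (1 - conj a * b)) := by
  rcases ha.lt_or_eq with ha | ha
  · exact integral_weight_mul_log_of_lt ha hb
  have hne : ∀ s : ℝ, s ∈ Icc (0 : ℝ) 1 → 2 * (1 - conj ((s : ℂ) * a) * b) ≠ 0 := by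
    intro s hs h
    have h1 : conj ((s : ℂ) * a) * b = 1 := by
      have := (mul_eq_zero.1 h).resolve_left two_ne_zero
      exact (sub_eq_zero.1 this).symm
    have h2 : ‖conj ((s : ℂ) * a) * b‖ < 1 := by
      rw [norm_mul, Complex.norm_conj, norm_mul, ha, mul_one, Complex.norm_real,
        Real.norm_of_nonneg hs.1]
      nlinarith [hs.2, norm_nonneg b, hs.1]
    rw [h1, norm_one] at h2
    exact lt_irrefl _ h2
  have hlim1 : Tendsto (fun s : ℝ => -conj ((s : ℂ) * a) / (2 * (1 - conj ((s : ℂ) * a) * b)))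
      (𝓝[<] 1) (𝓝 (-conj a / (2 * (1 - conj a * b)))) := by
    have h1 : ContinuousAt (fun s : ℝ => -conj ((s : ℂ) * a) /
        (2 * (1 - conj ((s : ℂ) * a) * b))) 1 := by
      refine ContinuousAt.div ?_ ?_ (hne 1 ⟨zero_le_one, le_rfl⟩) <;>
      · have := Complex.continuous_conj
        fun_prop
    have h2 := h1.tendsto.mono_left (nhdsWithin_le_nhds (s := Iio 1))
    simpa using h2
  have hlim2 : Tendsto (fun s : ℝ => ∫ θ, circleMap 0 1 θ / (circleMap 0 1 θ - b) ^ 2 *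
      (Real.log ‖circleMap 0 1 θ - s * a‖ : ℂ) ∂angleMeasure) (𝓝[<] 1)
      (𝓝 (∫ θ, circleMap 0 1 θ / (circleMap 0 1 θ - b) ^ 2 *
        (Real.log ‖circleMap 0 1 θ - a‖ : ℂ) ∂angleMeasure)) := by
    obtain ⟨B, hB⟩ := (isCompact_Icc (a := (0 : ℝ)) (b := 2 * π)).exists_bound_of_continuousOn
      (continuous_weight hb).continuousOn
    have hBae : ∀ᵐ θ ∂angleMeasure, ‖circleMap 0 1 θ / (circleMap 0 1 θ - b) ^ 2‖ ≤ B := by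
      refine Measure.ae_smul_measure ?_ _
      filter_upwards [ae_restrict_mem measurableSet_Ioc] with θ hθ
      exact hB θ (Ioc_subset_Icc_self hθ)
    refine tendsto_integral_filter_of_dominated_convergence
      (fun θ => B * (Real.log 2 + |Real.log ‖circleMap 0 1 θ - a‖|)) ?_ ?_ ?_ ?_
    · refine Eventually.of_forall fun s => ?_
      refine (continuous_weight hb).aestronglyMeasurable.mul ?_
      exact Measurable.aestronglyMeasurable (by
        have := measurable_circleMap 0 1
        fun_prop)
    · filter_upwards [Ioo_mem_nhdsLT zero_lt_one] with s hs
      filter_upwards [hBae, ae_circleMap_ne 0 a one_pos] with θ h1 h2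
      have he1 := norm_circleMap_zero_one θ
      set e := circleMap 0 1 θ
      rw [norm_mul, Complex.norm_real]
      refine mul_le_mul h1 ?_ (norm_nonneg _) ((norm_nonneg _).trans h1)
      have hsa : ‖(s : ℂ) * a‖ = s := by
        rw [norm_mul, ha, mul_one, Complex.norm_real, Real.norm_of_nonneg hs.1.le]
      have hp : 0 < ‖e - a‖ := norm_sub_pos_iff.2 h2
      have h3 : ‖e - s * a‖ ≤ 2 := by
        have := norm_sub_le e (s * a)
        rw [hsa, he1] at this
        linarith [hs.2]
      -- Both |e - sa| ≥ 1 - s and |sa - a| = 1 - s. This bounds the logarithm from below by a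
      -- quantity independent of s, as dominated convergence requires.
      have h4 : ‖e - a‖ ≤ 2 * ‖e - s * a‖ := by
        have h5 : 1 - s ≤ ‖e - s * a‖ := by
          have := norm_sub_norm_le e (s * a)
          rwa [hsa, he1] at this
        have h6 : ‖(s : ℂ) * a - a‖ = 1 - s := by
          rw [← sub_one_mul, norm_mul, ha, mul_one, ← Complex.ofReal_one, ← Complex.ofReal_sub,
            Complex.norm_real, Real.norm_of_nonpos (by linarith [hs.2])]
          ring
        have := norm_sub_le_norm_sub_add_norm_sub e (s * a) a
        linarith
      have hp' : 0 < ‖e - s * a‖ := by linarith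
      have l1 := Real.log_le_log hp' h3
      have l2 := Real.log_le_log hp h4
      rw [Real.log_mul two_ne_zero hp'.ne'] at l2
      rw [Real.norm_eq_abs, abs_le]
      constructor
      · linarith [neg_abs_le (Real.log ‖e - a‖)]
      · linarith [abs_nonneg (Real.log ‖e - a‖)]
    · exact ((integrable_const _).add (integrable_log_circleMap 0 a 1).abs).const_mul B
    · filter_upwards [ae_circleMap_ne 0 a one_pos] with θ h2
      have h3 : ContinuousAt (fun s : ℝ => circleMap 0 1 θ / (circleMap 0 1 θ - b) ^ 2 *
          (Real.log ‖circleMap 0 1 θ - s * a‖ : ℂ)) 1 := by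
        refine continuousAt_const.mul (Complex.continuous_ofReal.continuousAt.comp ?_)
        refine ContinuousAt.log (by fun_prop) ?_
        simpa [sub_eq_zero] using h2
      have h4 := h3.tendsto.mono_left (nhdsWithin_le_nhds (s := Iio 1))
      simpa using h4
  refine tendsto_nhds_unique hlim2 (hlim1.congr' ?_)
  filter_upwards [Ioo_mem_nhdsLT zero_lt_one] with s hs
  refine (integral_weight_mul_log_of_lt ?_ hb).symm
  rw [norm_mul, ha, mul_one, Complex.norm_real, Real.norm_of_nonneg hs.1.le]
  exact hs.2

lemma integral_inv_circleMap : ∫ θ, (circleMap 0 1 θ)⁻¹ ∂angleMeasure = 0 := by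
  have h := integral_weight_mul_re (G := fun _ => 1) one_lt_two (differentiableOn_const 1)
    (b := 0) (by simp)
  rw [deriv_const, zero_div] at h
  refine (integral_congr_ae (ae_of_all _ fun θ => ?_)).trans h
  have he0 : circleMap 0 1 θ ≠ 0 := circleMap_ne_center one_ne_zero
  simp only [Complex.one_re, Complex.ofReal_one, sub_zero, mul_one]
  field_simp

/-- The first Fourier coefficient of `log |x - w|` on a circle. -/
lemma integral_inv_mul_log_circleMap (z w : ℂ) {ρ : ℝ} (hρ : 0 < ρ) :
    ∫ θ, (circleMap 0 1 θ)⁻¹ * (Real.log ‖circleMap z ρ θ - w‖ : ℂ) ∂angleMeasure =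
      if ‖z - w‖ ≤ ρ then conj (z - w) / (2 * ρ) else ρ / (2 * (z - w)) := by
  have hρ' : (ρ : ℂ) ≠ 0 := Complex.ofReal_ne_zero.2 hρ.ne'
  -- reduction to a point of the closed unit disc
  have key : ∀ (a : ℂ) (c : ℝ), ‖a‖ ≤ 1 → 0 < c →
      (∀ θ, ‖circleMap z ρ θ - w‖ = c * ‖circleMap 0 1 θ - a‖) →
      ∫ θ, (circleMap 0 1 θ)⁻¹ * (Real.log ‖circleMap z ρ θ - w‖ : ℂ) ∂angleMeasure =
        -conj a / 2 := by
    intro a c ha hc h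
    have h1 := integral_weight_mul_log ha (b := 0) (by simp)
    rw [mul_zero, sub_zero, mul_one] at h1
    have hw : Continuous fun θ => (circleMap 0 1 θ)⁻¹ :=
      (continuous_circleMap 0 1).inv₀ fun θ => circleMap_ne_center one_ne_zero
    have hi : Integrable (fun θ => (circleMap 0 1 θ)⁻¹ *
        (Real.log ‖circleMap 0 1 θ - a‖ : ℂ)) angleMeasure := by
      refine (integrable_log_circleMap 0 a 1).ofReal.bdd_mul (c := 1)
        hw.aestronglyMeasurable (ae_of_all _ fun θ => ?_)
      rw [norm_inv, norm_circleMap_zero_one, inv_one]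
    have h2 : ∀ᵐ θ ∂angleMeasure, (circleMap 0 1 θ)⁻¹ * (Real.log ‖circleMap z ρ θ - w‖ : ℂ) =
        (circleMap 0 1 θ)⁻¹ * (Real.log c : ℂ) +
        (circleMap 0 1 θ)⁻¹ * (Real.log ‖circleMap 0 1 θ - a‖ : ℂ) := by
      filter_upwards [ae_circleMap_ne 0 a one_pos] with θ hθ
      rw [h θ, Real.log_mul hc.ne' (norm_sub_pos_iff.2 hθ).ne', Complex.ofReal_add, mul_add]
    rw [integral_congr_ae h2, integral_add
      ((integrable_angleMeasure_of_continuous hw).mul_const _) hi, integral_mul_const,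
      integral_inv_circleMap, zero_mul, zero_add, ← h1]
    refine integral_congr_ae (ae_of_all _ fun θ => ?_)
    have he0 : circleMap 0 1 θ ≠ 0 := circleMap_ne_center one_ne_zero
    simp only [sub_zero]
    field_simp
  have hmap : ∀ θ, circleMap z ρ θ - w = ρ * (circleMap 0 1 θ - (w - z) / ρ) := fun θ => by
    simp only [circleMap]
    field_simp
    push_cast
    ring
  split_ifs with h
  · rw [key ((w - z) / ρ) ρ ?_ hρ ?_]
    · rw [map_div₀, Complex.conj_ofReal, ← neg_sub z w, map_neg]
      field_simp
    · rw [norm_div, Complex.norm_real, Real.norm_of_nonneg hρ.le, div_le_one hρ, norm_sub_rev]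
      exact h
    · intro θ
      rw [hmap, norm_mul, Complex.norm_real, Real.norm_of_nonneg hρ.le]
  · push Not at h
    have hzw : z - w ≠ 0 := norm_pos_iff.1 (hρ.trans h)
    have hwz : w - z ≠ 0 := by rw [← neg_sub]; exact neg_ne_zero.2 hzw
    have hpos : 0 < ‖w - z‖ := norm_pos_iff.2 hwz
    -- When w lies outside the circle, its normalized position is replaced by the reflected point in
    -- the disc, at the cost of the factor |w - z|.
    rw [key (conj (ρ / (w - z))) ‖w - z‖ ?_ hpos ?_]
    · rw [Complex.conj_conj, ← neg_sub z w]
      field_simp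
    · rw [Complex.norm_conj, norm_div, Complex.norm_real, Real.norm_of_nonneg hρ.le,
        div_le_one hpos, norm_sub_rev]
      exact h.le
    · intro θ
      rw [norm_sub_eq_norm_one_sub (norm_circleMap_zero_one θ), Complex.conj_conj, hmap,
        ← norm_mul, ← norm_neg]
      congr 1
      field_simp
      ring

/-! ### The Cauchy transform of the equilibrium measure -/

lemma locallyIntegrable_inv : LocallyIntegrable (fun x : ℂ => x⁻¹) := by
  refine locallyIntegrable_of_norm_le_rpow (C := 1) (α := 1) (by simp) (by simp) ?_
    measurable_inv.aestronglyMeasurable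
  refine ae_of_all _ fun x => ?_
  rw [norm_inv, one_mul, Real.rpow_neg_one]

lemma continuousOn_inv_compl : ContinuousOn (fun x : ℂ => x⁻¹) {0}ᶜ := continuousOn_inv₀

/-- The inequality log t ≤ t - 1, applied to |x| and to 1/|x|, dominates the logarithm by |x| +
1/|x|. -/
lemma locallyIntegrable_log_norm : LocallyIntegrable (fun x : ℂ => Real.log ‖x‖) := by
  have h1 : LocallyIntegrable (fun x : ℂ => ‖x‖ + ‖x⁻¹‖) := by
    intro x
    obtain ⟨s, hs, hi⟩ := locallyIntegrable_inv x
    obtain ⟨t, ht, hj⟩ := continuous_norm.locallyIntegrable (μ := volume) x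
    exact ⟨t ∩ s, inter_mem ht hs, (hj.mono_set inter_subset_left).add
      (hi.mono_set inter_subset_right).norm⟩
  refine h1.mono (by fun_prop : Measurable fun x : ℂ =>
    Real.log ‖x‖).aestronglyMeasurable (ae_of_all _ fun x => ?_)
  rcases eq_or_ne x 0 with rfl | hx
  · simp
  have hp : 0 < ‖x‖ := norm_pos_iff.2 hx
  rw [Real.norm_eq_abs, Real.norm_of_nonneg (by positivity), norm_inv, abs_le]
  have h2 := Real.log_le_sub_one_of_pos hp
  have h3 := Real.log_le_sub_one_of_pos (inv_pos.2 hp)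
  rw [Real.log_inv] at h3
  have := inv_pos.2 hp
  constructor <;> linarith

lemma continuousOn_log_norm : ContinuousOn (fun x : ℂ => Real.log ‖x‖) {0}ᶜ :=
  ContinuousOn.log (by fun_prop) fun _ hx => norm_ne_zero_iff.2 hx

lemma continuous_potential (t₀ : ℝ) (p : Polynomial ℂ) : Continuous (potential t₀ p) := by
  unfold potential
  have := p.continuous
  fun_prop

/-- A polynomial whose real part agrees with the potential on a given circle. -/
def circlePolynomial (t₀ : ℝ) (p : Polynomial ℂ) (z : ℂ) (ρ : ℝ) (x : ℂ) : ℂ :=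
  ((‖z‖ ^ 2 + ρ ^ 2 : ℝ) + 2 * conj z * (x - z) - 2 * p.eval x) / t₀

lemma differentiable_circlePolynomial (t₀ : ℝ) (p : Polynomial ℂ) (z : ℂ) (ρ : ℝ) :
    Differentiable ℂ (circlePolynomial t₀ p z ρ) := by
  unfold circlePolynomial
  have := p.differentiable
  fun_prop

lemma hasDerivAt_circlePolynomial (t₀ : ℝ) (p : Polynomial ℂ) (z : ℂ) (ρ : ℝ) :
    HasDerivAt (circlePolynomial t₀ p z ρ)
      (2 * (conj z - p.derivative.eval z) / t₀) z := by
  have h1 : HasDerivAt (fun x => ((‖z‖ ^ 2 + ρ ^ 2 : ℝ) : ℂ) + 2 * conj z * (x - z))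
      (2 * conj z) z := by
    simpa using (((hasDerivAt_id z).sub_const z).const_mul (2 * conj z)).const_add
      (((‖z‖ ^ 2 + ρ ^ 2 : ℝ) : ℂ))
  have h2 := (h1.sub ((p.hasDerivAt z).const_mul 2)).div_const (t₀ : ℂ)
  rw [mul_sub]
  exact h2

/-- On the circle, |x|² = |z|² + ρ² + 2 Re(z̄(x - z)). The non-harmonic term of V thus becomes the
real part of a polynomial there, so the mean value property and Cauchy's formula apply to V. -/
lemma potential_eq_re_circlePolynomial (t₀ : ℝ) (p : Polynomial ℂ) {z x : ℂ} {ρ : ℝ}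
    (hx : ‖x - z‖ = ρ) : potential t₀ p x = (circlePolynomial t₀ p z ρ x).re := by
  have h : ‖x‖ ^ 2 = ‖z‖ ^ 2 + ρ ^ 2 + 2 * (conj z * (x - z)).re := by
    rw [← hx, ← Complex.normSq_eq_norm_sq, ← Complex.normSq_eq_norm_sq,
      ← Complex.normSq_eq_norm_sq, Complex.normSq_apply, Complex.normSq_apply,
      Complex.normSq_apply]
    simp
    ring
  rw [potential, circlePolynomial, Complex.div_ofReal_re, h]
  simp only [Complex.sub_re, Complex.add_re, Complex.ofReal_re, Complex.mul_re, Complex.re_ofNat,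
    Complex.im_ofNat, Complex.mul_im, Complex.sub_im]
  ring

lemma norm_circleMap_sub (z : ℂ) {ρ : ℝ} (hρ : 0 < ρ) (θ : ℝ) : ‖circleMap z ρ θ - z‖ = ρ := by
  rw [circleMap_sub_center, norm_circleMap_zero, abs_of_pos hρ]

lemma circleAverage_potential (t₀ : ℝ) (p : Polynomial ℂ) (z : ℂ) {ρ : ℝ} (hρ : 0 < ρ) :
    Real.circleAverage (potential t₀ p) z ρ = potential t₀ p z + 1 / t₀ * ρ ^ 2 := by
  have hd := differentiable_circlePolynomial t₀ p z ρ
  have h1 : Real.circleAverage (circlePolynomial t₀ p z ρ) z ρ = circlePolynomial t₀ p z ρ z :=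
    DiffContOnCl.circleAverage hd.diffContOnCl
  have h2 : ∫ θ, potential t₀ p (circleMap z ρ θ) ∂angleMeasure =
      (∫ θ, circlePolynomial t₀ p z ρ (circleMap z ρ θ) ∂angleMeasure).re := by
    have hi : Integrable (fun θ => circlePolynomial t₀ p z ρ (circleMap z ρ θ)) angleMeasure :=
      integrable_angleMeasure_of_continuous (hd.continuous.comp (continuous_circleMap z ρ))
    rw [← Complex.reCLM_apply, ← Complex.reCLM.integral_comp_comm hi]
    exact integral_congr_ae (ae_of_all _ fun θ =>
      potential_eq_re_circlePolynomial t₀ p (norm_circleMap_sub z hρ θ))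
  rw [← integral_angleMeasure_circleMap, h2, integral_angleMeasure_circleMap, h1,
    circlePolynomial, potential, Complex.div_ofReal_re]
  simp only [sub_self, mul_zero, add_zero, Complex.sub_re, Complex.ofReal_re, Complex.mul_re,
    Complex.re_ofNat, Complex.im_ofNat, zero_mul, sub_zero]
  ring

lemma integral_inv_mul_potential (t₀ : ℝ) (p : Polynomial ℂ) (z : ℂ) {ρ : ℝ} (hρ : 0 < ρ) :
    ∫ θ, (circleMap 0 1 θ)⁻¹ * (potential t₀ p (circleMap z ρ θ) : ℂ) ∂angleMeasure =
      ρ * (conj z - p.derivative.eval z) / t₀ := by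
  set H := circlePolynomial t₀ p z ρ
  have hd : Differentiable ℂ fun u : ℂ => H (z + ρ * u) :=
    (differentiable_circlePolynomial t₀ p z ρ).comp (by fun_prop)
  have h1 := integral_weight_mul_re one_lt_two hd.differentiableOn (b := 0) (by simp)
  have h2 : HasDerivAt (fun u : ℂ => H (z + ρ * u))
      (2 * (conj z - p.derivative.eval z) / t₀ * ρ) 0 := by
    refine HasDerivAt.comp (0 : ℂ) (h₂ := H) (h := fun u : ℂ => z + ρ * u) ?_ ?_
    · simpa using hasDerivAt_circlePolynomial t₀ p z ρ
    · simpa using ((hasDerivAt_id (0 : ℂ)).const_mul (ρ : ℂ)).const_add z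
  rw [h2.deriv] at h1
  rw [show ρ * (conj z - p.derivative.eval z) / t₀ =
    2 * (conj z - p.derivative.eval z) / t₀ * ρ / 2 by ring, ← h1]
  refine integral_congr_ae (ae_of_all _ fun θ => ?_)
  have he0 : circleMap 0 1 θ ≠ 0 := circleMap_ne_center one_ne_zero
  have hc : circleMap z ρ θ = z + ρ * circleMap 0 1 θ := by simp [circleMap]
  simp only [sub_zero]
  rw [potential_eq_re_circlePolynomial t₀ p (norm_circleMap_sub z hρ θ), ← hc]
  field_simp
  rfl

/-- If the total potential is constant near `z`, the Cauchy transform is explicit. -/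
lemma cauchyTransform_eq_of_const {t₀ : ℝ} {p : Polynomial ℂ} {μ : Measure ℂ} [IsFiniteMeasure μ]
    {K : Set ℂ} (hK : Bornology.IsBounded K) (hμK : ∀ᵐ w ∂μ, w ∈ K) {C : NNReal}
    (hC : μ ≤ C • volume) {F : ℝ} {z : ℂ}
    (hF : ∀ᶠ x in 𝓝 z, potential t₀ p x - 2 * ∫ w, Real.log ‖x - w‖ ∂μ = F) :
    ∫ w, (z - w)⁻¹ ∂μ = (conj z - p.derivative.eval z) / t₀ := by
  -- Times ρ/2, this is the first Fourier coefficient of log|x - w| on the circle of radius ρ. It is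
  -- dominated by |z - w|⁻¹ and equals the Cauchy kernel once ρ < |z - w|, which replaces a
  -- differentiation of the potential under the integral sign.
  set k : ℝ → ℂ → ℂ := fun ρ w => if ‖z - w‖ ≤ ρ then conj (z - w) / ρ ^ 2 else (z - w)⁻¹ with hk
  have hinv := integrable_kernel_translate hC hK hμK locallyIntegrable_inv z
  have hlog : ∀ x, Integrable (fun w => Real.log ‖x - w‖) μ :=
    integrable_kernel_translate hC hK hμK locallyIntegrable_log_norm
  have hac : μ ≪ volume := (Measure.absolutelyContinuous_of_le hC).trans
    (Measure.AbsolutelyContinuous.rfl.smul_left C)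
  have hne0 : ∀ᵐ w : ℂ, w ≠ z := by simp [ae_iff]
  have hne : ∀ᵐ w ∂μ, w ≠ z := hac.ae_le hne0
  have hlim : Tendsto (fun ρ => ∫ w, k ρ w ∂μ) (𝓝[>] 0) (𝓝 (∫ w, (z - w)⁻¹ ∂μ)) := by
    refine tendsto_integral_filter_of_dominated_convergence (fun w => ‖(z - w)⁻¹‖) ?_ ?_
      hinv.norm ?_
    · refine Eventually.of_forall fun ρ => Measurable.aestronglyMeasurable ?_
      refine Measurable.ite (measurableSet_le (by fun_prop) measurable_const) ?_ (by fun_prop)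
      exact (Complex.continuous_conj.measurable.comp (by fun_prop)).div_const _
    · filter_upwards [self_mem_nhdsWithin] with ρ hρ
      have hρ0 : 0 < ρ := hρ
      filter_upwards [hne] with w hw
      simp only [hk]
      split_ifs with h
      · have hp : 0 < ‖z - w‖ := norm_sub_pos_iff.2 hw.symm
        rw [norm_div, Complex.norm_conj, norm_pow, Complex.norm_real, norm_inv,
          Real.norm_of_nonneg hρ0.le, div_le_iff₀ (by positivity), inv_mul_eq_div, le_div_iff₀ hp]
        nlinarith
      · exact le_rfl
    · filter_upwards [hne] with w hw
      have hp : 0 < ‖z - w‖ := norm_sub_pos_iff.2 hw.symm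
      refine tendsto_const_nhds.congr' ?_
      filter_upwards [Ioo_mem_nhdsGT hp] with ρ hρ
      simp only [hk]
      rw [if_neg (not_le.2 hρ.2)]
  refine tendsto_nhds_unique (hlim.congr' ?_) tendsto_const_nhds
  obtain ⟨ε, hε, hball⟩ := nhds_basis_closedBall.mem_iff.1 hF
  filter_upwards [Ioo_mem_nhdsGT hε] with ρ hρ
  have hρ0 : 0 < ρ := hρ.1
  have hρ' : (ρ : ℂ) ≠ 0 := Complex.ofReal_ne_zero.2 hρ0.ne'
  have hcontinv : Continuous fun θ => (circleMap 0 1 θ)⁻¹ :=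
    (continuous_circleMap 0 1).inv₀ fun θ => circleMap_ne_center one_ne_zero
  have hlogc := continuous_integral_kernel_translate hC hK hμK locallyIntegrable_log_norm
    continuousOn_log_norm
  -- the first Fourier coefficient of the total potential vanishes
  have h1 : ∫ θ, (circleMap 0 1 θ)⁻¹ * ((∫ w, Real.log ‖circleMap z ρ θ - w‖ ∂μ : ℝ) : ℂ)
      ∂angleMeasure = ρ * (conj z - p.derivative.eval z) / t₀ / 2 := by
    rw [← integral_inv_mul_potential t₀ p z hρ0]
    have h2 : ∀ θ, (circleMap 0 1 θ)⁻¹ * ((∫ w, Real.log ‖circleMap z ρ θ - w‖ ∂μ : ℝ) : ℂ) =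
        ((circleMap 0 1 θ)⁻¹ * (potential t₀ p (circleMap z ρ θ) : ℂ) -
          (circleMap 0 1 θ)⁻¹ * F) / 2 := fun θ => by
      have h3 : potential t₀ p (circleMap z ρ θ) -
          2 * ∫ w, Real.log ‖circleMap z ρ θ - w‖ ∂μ = F :=
        hball (closedBall_subset_closedBall hρ.2.le
          (sphere_subset_closedBall (circleMap_mem_sphere z hρ0.le θ)))
      rw [← h3]
      push_cast
      ring
    simp_rw [h2]
    rw [integral_div, integral_sub, integral_mul_const, integral_inv_circleMap, zero_mul, sub_zero]
    · refine integrable_angleMeasure_of_continuous (hcontinv.mul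
        (Complex.continuous_ofReal.comp ?_))
      exact (continuous_potential t₀ p).comp (continuous_circleMap z ρ)
    · exact integrable_angleMeasure_of_continuous (hcontinv.mul continuous_const)
  have hprod : Integrable (fun q : ℝ × ℂ => Real.log ‖circleMap z ρ q.1 - q.2‖)
      (angleMeasure.prod μ) := by
    obtain ⟨R, hR⟩ := exists_norm_sub_le (hK.union (isBounded_closedBall (x := z) (r := ρ)))
    refine integrable_log_norm_sub_prod angleMeasure (measurable_circleMap z ρ) μ (R := R)
      (M := -Real.log ρ) ?_ (ae_of_all _ fun w => integrable_log_circleMap z w ρ)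
      (ae_of_all _ fun w => ?_)
    · filter_upwards [hμK] with w hw
      exact ae_of_all _ fun θ => hR _ (Or.inr (sphere_subset_closedBall
        (circleMap_mem_sphere z hρ0.le θ))) w (Or.inl hw)
    · rw [integral_log_circleMap z w hρ0, neg_neg]
      exact Real.log_le_log hρ0 (le_max_left _ _)
  have hprod' : Integrable (fun q : ℝ × ℂ => (circleMap 0 1 q.1)⁻¹ *
      (Real.log ‖circleMap z ρ q.1 - q.2‖ : ℂ)) (angleMeasure.prod μ) := by
    refine hprod.ofReal.bdd_mul (c := 1) (hcontinv.comp continuous_fst).aestronglyMeasurable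
      (ae_of_all _ fun q => ?_)
    rw [norm_inv, norm_circleMap_zero_one, inv_one]
  have h4 : ∫ θ, (circleMap 0 1 θ)⁻¹ * ((∫ w, Real.log ‖circleMap z ρ θ - w‖ ∂μ : ℝ) : ℂ)
      ∂angleMeasure = ∫ w, ρ / 2 * k ρ w ∂μ := by
    have h5 : ∀ θ, (circleMap 0 1 θ)⁻¹ * ((∫ w, Real.log ‖circleMap z ρ θ - w‖ ∂μ : ℝ) : ℂ) =
        ∫ w, (circleMap 0 1 θ)⁻¹ * (Real.log ‖circleMap z ρ θ - w‖ : ℂ) ∂μ := fun θ => by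
      rw [integral_const_mul, integral_complex_ofReal]
    simp_rw [h5]
    rw [integral_integral_swap hprod']
    refine integral_congr_ae (ae_of_all _ fun w => ?_)
    simp only [hk]
    rw [integral_inv_mul_log_circleMap z w hρ0]
    split_ifs with h
    · field_simp
    · have : z - w ≠ 0 := norm_pos_iff.1 (hρ0.trans (not_le.1 h))
      field_simp
  rw [h4, integral_const_mul] at h1
  have h6 : (ρ : ℂ) / 2 ≠ 0 := div_ne_zero hρ' two_ne_zero
  refine mul_left_cancel₀ h6 (h1.trans ?_)
  ring

/-- An equilibrium measure not charging the boundary of the cut-off has bounded density, and its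
Cauchy transform is explicit inside its support. -/
theorem IsEquilibriumMeasure.cauchyTransform_eq {t₀ : ℝ} (ht₀ : 0 < t₀) {p : Polynomial ℂ}
    {K : Set ℂ} (hK : Bornology.IsBounded K) (hK0 : (interior K).Nonempty)
    {μ : Measure ℂ} (hμ : IsEquilibriumMeasure (potential t₀ p) K μ) (hwall : μ (frontier K) = 0) :
    (∃ C : NNReal, μ ≤ C • volume) ∧ ∀ z ∈ interior μ.support,
      ∫ w, (z - w)⁻¹ ∂μ = (conj z - p.derivative.eval z) / t₀ := by
  have := hμ.prob
  have hV := continuous_potential t₀ p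
  have hVavg : ∀ z ρ, 0 < ρ →
      Real.circleAverage (potential t₀ p) z ρ = potential t₀ p z + 1 / t₀ * ρ ^ 2 :=
    fun z ρ => circleAverage_potential t₀ p z
  have hμK : ∀ᵐ z ∂μ, z ∈ K := hμ.carried
  -- The Euler-Lagrange inequality is established only at interior points of K; as μ does not charge
  -- the frontier, it is available almost everywhere.
  have hKi : ∀ᵐ z ∂μ, z ∈ interior K := by
    have h1 : ∀ᵐ z ∂μ, z ∉ frontier K := measure_eq_zero_iff_ae_notMem.1 hwall
    filter_upwards [h1, hμK] with z h1 h2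
    by_contra h3
    exact h1 ⟨subset_closure h2, h3⟩
  obtain ⟨hi, hna⟩ := hμ.integrable_log hV hK hK0
  obtain ⟨C, hC⟩ := hμ.le_smul_volume hV hVavg (by positivity) hK hKi hi
  refine ⟨⟨C, hC⟩, fun z hz => ?_⟩
  set F := ∫ x, (potential t₀ p x - 2 * ∫ w, Real.log ‖x - w‖ ∂μ) ∂μ with hF
  have hlogc := continuous_integral_kernel_translate hC hK hμK locallyIntegrable_log_norm
    continuousOn_log_norm
  have hcl : IsClosed {x | potential t₀ p x - 2 * ∫ w, Real.log ‖x - w‖ ∂μ = F} :=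
    isClosed_eq (hV.sub (continuous_const.mul hlogc)) continuous_const
  -- The set of equality is closed because the potential is continuous, so it contains the support;
  -- at an interior point of the support the equality then holds on a neighbourhood.
  have hsub := Measure.support_subset_of_isClosed hcl (hμ.ae_eq hV hVavg hK hKi hi)
  exact cauchyTransform_eq_of_const hK hμK hC
    (mem_of_superset (isOpen_interior.mem_nhds hz) (interior_subset.trans hsub))

/-! ### Difference quotients of a Laurent polynomial -/

/-- Divided difference of `w ↦ w⁻¹ ^ l`, as a function of `x = w⁻¹` and `y = u⁻¹`. -/
def powQuotient (l : ℕ) (x y : ℂ) : ℂ :=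
  -(x * y) * ∑ i ∈ Finset.range l, x ^ i * y ^ (l - 1 - i)

/-- Second divided difference of `w ↦ w⁻¹ ^ l`, as a function of `x = w⁻¹` and `y = u⁻¹`. -/
def powQuotient₂ (l : ℕ) (x y : ℂ) : ℂ :=
  -x * ∑ i ∈ Finset.range l, x ^ i * powQuotient (l - i) x y

lemma powQuotient_spec (l : ℕ) {w u : ℂ} (hw : w ≠ 0) (hu : u ≠ 0) :
    w⁻¹ ^ l - u⁻¹ ^ l = (w - u) * powQuotient l w⁻¹ u⁻¹ := by
  rw [powQuotient, ← (Commute.all w⁻¹ u⁻¹).geom_sum₂_mul]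
  field_simp
  ring

/-- Absorbing the factor y into the sum leaves y only in pure powers, to which the first divided
difference applies once more. -/
lemma powQuotient_eq (l : ℕ) (x y : ℂ) :
    powQuotient l x y = -x * ∑ i ∈ Finset.range l, x ^ i * y ^ (l - i) := by
  rw [powQuotient, neg_mul, neg_mul, mul_assoc, Finset.mul_sum]
  congr 2
  refine Finset.sum_congr rfl fun i hi => ?_
  have : l - i = (l - 1 - i) + 1 := by
    have := Finset.mem_range.1 hi
    omega
  rw [this, pow_succ]
  ring

lemma powQuotient₂_spec (l : ℕ) {w u : ℂ} (hw : w ≠ 0) (hu : u ≠ 0) :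
    powQuotient l w⁻¹ w⁻¹ - powQuotient l w⁻¹ u⁻¹ = (w - u) * powQuotient₂ l w⁻¹ u⁻¹ := by
  have h : ∀ i, w⁻¹ ^ i * w⁻¹ ^ (l - i) - w⁻¹ ^ i * u⁻¹ ^ (l - i) =
      (w - u) * (w⁻¹ ^ i * powQuotient (l - i) w⁻¹ u⁻¹) := fun i => by
    rw [← mul_sub, powQuotient_spec _ hw hu]
    ring
  rw [powQuotient_eq, powQuotient_eq, powQuotient₂, ← mul_sub, ← Finset.sum_sub_distrib]
  simp_rw [h]
  rw [← Finset.mul_sum]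
  ring

lemma continuous_powQuotient (l : ℕ) : Continuous fun q : ℂ × ℂ => powQuotient l q.1 q.2 := by
  unfold powQuotient
  fun_prop

lemma continuous_powQuotient₂ (l : ℕ) : Continuous fun q : ℂ × ℂ => powQuotient₂ l q.1 q.2 := by
  unfold powQuotient₂
  have := fun l => continuous_powQuotient l
  fun_prop

lemma differentiable_powQuotient (l : ℕ) (y : ℂ) : Differentiable ℂ fun x => powQuotient l x y := by
  unfold powQuotient
  fun_prop

section

variable (r : ℝ) (n : ℕ) (a : ℕ → ℂ)

/-- The difference quotient `(h w - h u) / (w - u)`. -/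
def slopeMap (w u : ℂ) : ℂ := r + ∑ j ∈ Finset.range (n + 1), a j * powQuotient j w⁻¹ u⁻¹

/-- The difference quotient `(h' w - (h w - h u) / (w - u)) / (w - u)`. -/
def slopeMap₂ (w u : ℂ) : ℂ := ∑ j ∈ Finset.range (n + 1), a j * powQuotient₂ j w⁻¹ u⁻¹

lemma polyMap_sub {w u : ℂ} (hw : w ≠ 0) (hu : u ≠ 0) :
    polyMap r n a w - polyMap r n a u = (w - u) * slopeMap r n a w u := by
  rw [polyMap, polyMap, slopeMap, mul_add, Finset.mul_sum, add_sub_add_comm,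
    ← Finset.sum_sub_distrib, ← mul_sub, mul_comm (r : ℂ)]
  congr 1
  refine Finset.sum_congr rfl fun j _ => ?_
  rw [← mul_sub, powQuotient_spec j hw hu]
  ring

lemma slopeMap_self_sub {w u : ℂ} (hw : w ≠ 0) (hu : u ≠ 0) :
    slopeMap r n a w w - slopeMap r n a w u = (w - u) * slopeMap₂ n a w u := by
  rw [slopeMap, slopeMap, slopeMap₂, Finset.mul_sum, add_sub_add_left_eq_sub,
    ← Finset.sum_sub_distrib]
  refine Finset.sum_congr rfl fun j _ => ?_
  rw [← mul_sub, powQuotient₂_spec j hw hu]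
  ring

lemma continuousOn_inv_prod :
    ContinuousOn (fun q : ℂ × ℂ => (q.1⁻¹, q.2⁻¹)) {q | q.1 ≠ 0 ∧ q.2 ≠ 0} :=
  ContinuousOn.prodMk (continuous_fst.continuousOn.inv₀ fun _ h => h.1)
    (continuous_snd.continuousOn.inv₀ fun _ h => h.2)

lemma continuousOn_slopeMap :
    ContinuousOn (fun q : ℂ × ℂ => slopeMap r n a q.1 q.2) {q | q.1 ≠ 0 ∧ q.2 ≠ 0} := by
  have h : Continuous fun q : ℂ × ℂ =>
      (r : ℂ) + ∑ j ∈ Finset.range (n + 1), a j * powQuotient j q.1 q.2 := by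
    have := continuous_powQuotient
    fun_prop
  have h' := h.comp_continuousOn continuousOn_inv_prod
  simpa only [slopeMap, Function.comp_def] using h'

lemma continuousOn_slopeMap₂ :
    ContinuousOn (fun q : ℂ × ℂ => slopeMap₂ n a q.1 q.2) {q | q.1 ≠ 0 ∧ q.2 ≠ 0} := by
  have h : Continuous fun q : ℂ × ℂ =>
      ∑ j ∈ Finset.range (n + 1), a j * powQuotient₂ j q.1 q.2 := by
    have := continuous_powQuotient₂
    fun_prop
  have h' := h.comp_continuousOn continuousOn_inv_prod
  simpa only [slopeMap₂, Function.comp_def] using h'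

lemma differentiableAt_slopeMap {w : ℂ} (hw : w ≠ 0) (u : ℂ) :
    DifferentiableAt ℂ (fun w => slopeMap r n a w u) w := by
  have h : Differentiable ℂ fun x : ℂ =>
      (r : ℂ) + ∑ j ∈ Finset.range (n + 1), a j * powQuotient j x u⁻¹ := by
    have := fun l => differentiable_powQuotient l u⁻¹
    fun_prop
  exact (h w⁻¹).comp w (differentiableAt_inv hw)

lemma differentiableAt_polyMap {w : ℂ} (hw : w ≠ 0) : DifferentiableAt ℂ (polyMap r n a) w := by
  have h : Differentiable ℂ fun x : ℂ => ∑ j ∈ Finset.range (n + 1), a j * x ^ j := by fun_prop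
  exact (DifferentiableAt.const_mul differentiableAt_id _).add
    ((h w⁻¹).comp w (differentiableAt_inv hw))

lemma hasDerivAt_polyMap {u : ℂ} (hu : u ≠ 0) :
    HasDerivAt (polyMap r n a) (slopeMap r n a u u) u := by
  rw [hasDerivAt_iff_tendsto_slope]
  have h1 : Tendsto (fun w => slopeMap r n a w u) (𝓝[≠] u) (𝓝 (slopeMap r n a u u)) :=
    (differentiableAt_slopeMap r n a hu u).continuousAt.tendsto.mono_left nhdsWithin_le_nhds
  refine h1.congr' ?_
  filter_upwards [self_mem_nhdsWithin, mem_nhdsWithin_of_mem_nhds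
    (isOpen_compl_singleton.mem_nhds hu)] with w h2 h3
  have h4 : w - u ≠ 0 := sub_ne_zero.2 h2
  rw [slope_def_field, polyMap_sub r n a h3 hu]
  field_simp

lemma deriv_polyMap {u : ℂ} (hu : u ≠ 0) : deriv (polyMap r n a) u = slopeMap r n a u u :=
  (hasDerivAt_polyMap r n a hu).deriv

lemma differentiableOn_polyMap : DifferentiableOn ℂ (polyMap r n a) {0}ᶜ := fun _ hw =>
  (differentiableAt_polyMap r n a hw).differentiableWithinAt

lemma continuousOn_polyMap : ContinuousOn (polyMap r n a) {0}ᶜ :=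
  (differentiableOn_polyMap r n a).continuousOn

lemma differentiableOn_deriv_polyMap : DifferentiableOn ℂ (deriv (polyMap r n a)) {0}ᶜ :=
  (differentiableOn_polyMap r n a).deriv isOpen_compl_singleton

lemma continuousOn_deriv_polyMap : ContinuousOn (deriv (polyMap r n a)) {0}ᶜ :=
  (differentiableOn_deriv_polyMap r n a).continuousOn

lemma map_nhds_polyMap {u : ℂ} (hu : u ≠ 0) (h : deriv (polyMap r n a) u ≠ 0) :
    map (polyMap r n a) (𝓝 u) = 𝓝 (polyMap r n a u) := by
  have h1 : AnalyticAt ℂ (polyMap r n a) u :=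
    (differentiableOn_polyMap r n a).analyticAt (isOpen_compl_singleton.mem_nhds hu)
  exact h1.hasStrictDerivAt.map_nhds_eq h

end

/-! ### Collars of the unit circle and injectivity of h on them -/

lemma ne_zero_of_mem_sphere {w : ℂ} (hw : w ∈ sphere (0 : ℂ) 1) : w ≠ 0 := by
  rintro rfl; simp at hw

/-- The closed annulus of half-width `δ` around the unit circle. -/
def collar (δ : ℝ) : Set ℂ := closedBall 0 (1 + δ) \ ball 0 (1 - δ)

lemma mem_collar {δ : ℝ} {w : ℂ} : w ∈ collar δ ↔ ‖w‖ ≤ 1 + δ ∧ 1 - δ ≤ ‖w‖ := by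
  simp [collar]

lemma ne_zero_of_mem_collar {δ : ℝ} (hδ : δ < 1) {w : ℂ} (hw : w ∈ collar δ) : w ≠ 0 := by
  rintro rfl
  have := (mem_collar.1 hw).2
  rw [norm_zero] at this
  linarith

lemma sphere_subset_collar {δ : ℝ} (hδ : 0 ≤ δ) : sphere (0 : ℂ) 1 ⊆ collar δ := by
  intro w hw
  have : ‖w‖ = 1 := by simpa using hw
  rw [mem_collar]
  constructor <;> linarith

lemma collar_mem_nhds {δ : ℝ} (hδ : 0 < δ) {w : ℂ} (hw : w ∈ sphere (0 : ℂ) 1) :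
    collar δ ∈ 𝓝 w := by
  have h1 : ‖w‖ = 1 := by simpa using hw
  have h2 : {w : ℂ | ‖w‖ < 1 + δ ∧ 1 - δ < ‖w‖} ∈ 𝓝 w :=
    ((isOpen_lt continuous_norm continuous_const).inter
      (isOpen_lt continuous_const continuous_norm)).mem_nhds
      ⟨by simp only [mem_ofPred_eq]; linarith, by simp only [mem_ofPred_eq]; linarith⟩
  exact mem_of_superset h2 fun u hu => mem_collar.2 ⟨hu.1.le, hu.2.le⟩

section

variable {r : ℝ} {n : ℕ} {a : ℕ → ℂ}

/-- Off the diagonal this is injectivity, on it h' ≠ 0: both conditions on the curve become the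
nonvanishing of one continuous function. -/
lemma IsSimpleAnalytic.slopeMap_ne_zero (hγ : IsSimpleAnalytic r n a) {w u : ℂ}
    (hw : w ∈ sphere (0 : ℂ) 1) (hu : u ∈ sphere (0 : ℂ) 1) : slopeMap r n a w u ≠ 0 := by
  rcases eq_or_ne w u with rfl | hne
  · rw [← deriv_polyMap r n a (ne_zero_of_mem_sphere hw)]
    exact hγ.regular w hw
  · intro h
    have := polyMap_sub r n a (ne_zero_of_mem_sphere hw) (ne_zero_of_mem_sphere hu)
    rw [h, mul_zero, sub_eq_zero] at this
    exact hne (hγ.simple hw hu this)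

/-- The nonvanishing locus is open and contains the compact torus of pairs of unit vectors, hence a
uniform neighbourhood of it. -/
lemma IsSimpleAnalytic.exists_collar (hγ : IsSimpleAnalytic r n a) :
    ∃ δ ∈ Ioo (0 : ℝ) 1, ∀ w ∈ collar δ, ∀ u ∈ collar δ, slopeMap r n a w u ≠ 0 := by
  set S := sphere (0 : ℂ) 1
  set O : Set (ℂ × ℂ) := {q | q.1 ≠ 0 ∧ q.2 ≠ 0} ∩ (fun q => slopeMap r n a q.1 q.2) ⁻¹' {0}ᶜ
  have hopen : IsOpen O := (continuousOn_slopeMap r n a).isOpen_inter_preimage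
    ((isOpen_ne_fun continuous_fst continuous_const).inter
      (isOpen_ne_fun continuous_snd continuous_const)) isOpen_compl_singleton
  have hsub : S ×ˢ S ⊆ O := fun q hq =>
    ⟨⟨ne_zero_of_mem_sphere hq.1, ne_zero_of_mem_sphere hq.2⟩, hγ.slopeMap_ne_zero hq.1 hq.2⟩
  obtain ⟨ε, hε, hεO⟩ := ((isCompact_sphere (0 : ℂ) 1).prod
    (isCompact_sphere (0 : ℂ) 1)).exists_thickening_subset_open hopen hsub
  have hδ1 : min (ε / 2) (1 / 2) < 1 := (min_le_right _ _).trans_lt (by norm_num)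
  -- The bound ε/2 keeps the radial projection to the unit circle at distance less than ε; the bound
  -- 1/2 keeps the collar away from the origin.
  refine ⟨min (ε / 2) (1 / 2), ⟨by positivity, hδ1⟩, ?_⟩
  have key : ∀ w ∈ collar (min (ε / 2) (1 / 2)), ∃ v ∈ S, dist w v < ε := by
    intro w hw
    have hw0 := ne_zero_of_mem_collar hδ1 hw
    have hp : 0 < ‖w‖ := norm_pos_iff.2 hw0
    have hw0' : (‖w‖ : ℂ) ≠ 0 := Complex.ofReal_ne_zero.2 hp.ne'
    refine ⟨w / ‖w‖, by simp [S, hp.ne'], ?_⟩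
    have h1 : w - w / ‖w‖ = w / ‖w‖ * ((‖w‖ - 1 : ℝ) : ℂ) := by
      push_cast; field_simp
    rw [dist_eq_norm, h1, norm_mul, norm_div, Complex.norm_real, norm_norm, div_self hp.ne',
      one_mul, Complex.norm_real, Real.norm_eq_abs]
    obtain ⟨h2, h3⟩ := mem_collar.1 hw
    have h4 := min_le_left (ε / 2) (1 / 2 : ℝ)
    rw [abs_lt]
    constructor <;> linarith
  intro w hw u hu
  obtain ⟨v, hv, h1⟩ := key w hw
  obtain ⟨v', hv', h2⟩ := key u hu
  have : (w, u) ∈ thickening ε (S ×ˢ S) :=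
    mem_thickening_iff.2 ⟨(v, v'), ⟨hv, hv'⟩, by rw [Prod.dist_eq]; exact max_lt h1 h2⟩
  exact (hεO this).2

lemma polyMap_injOn_collar {δ : ℝ} (hδ : δ < 1)
    (h : ∀ w ∈ collar δ, ∀ u ∈ collar δ, slopeMap r n a w u ≠ 0) :
    InjOn (polyMap r n a) (collar δ) := by
  intro w hw u hu hwu
  have h1 := polyMap_sub r n a (ne_zero_of_mem_collar hδ hw) (ne_zero_of_mem_collar hδ hu)
  rw [hwu, sub_self] at h1
  exact sub_eq_zero.1 ((mul_eq_zero.1 h1.symm).resolve_right (h w hw u hu))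

/-! ### Factorization of `h w - z` -/

/-- Multiplied by wⁿ, h - z becomes a polynomial of degree n + 1 with leading coefficient r. Its
roots reduce log|h - z| and the logarithmic derivative of h - z to sums over linear factors. -/
lemma exists_factorization (hr : r ≠ 0) (z : ℂ) : ∃ c : Fin (n + 1) → ℂ, ∀ w ≠ 0,
    polyMap r n a w - z = r * (w ^ n)⁻¹ * ∏ i, (w - c i) := by
  open Polynomial in
  have hr' : (r : ℂ) ≠ 0 := Complex.ofReal_ne_zero.2 hr
  set q : Polynomial ℂ := ∑ j ∈ Finset.range (n + 1), C (a j) * X ^ (n - j) - C z * X ^ n with hq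
  have hqd : q.degree < (C (r : ℂ) * X ^ (n + 1) : Polynomial ℂ).degree := by
    rw [degree_C_mul_X_pow _ hr']
    refine mem_degreeLT.1 ?_
    refine Submodule.sub_mem _ (Submodule.sum_mem _ fun j _ => ?_) ?_ <;>
    · refine mem_degreeLT.2 ((degree_C_mul_X_pow_le _ _).trans_lt ?_)
      exact_mod_cast (by omega)
  set P : Polynomial ℂ := C (r : ℂ) * X ^ (n + 1) + q with hP
  have hlead : P.leadingCoeff = r := by
    rw [hP, leadingCoeff_add_of_degree_lt' hqd, leadingCoeff_C_mul_X_pow]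
  have hdeg : P.natDegree = n + 1 := by
    rw [hP, natDegree_add_eq_left_of_degree_lt hqd, natDegree_C_mul_X_pow _ _ hr']
  have hsplit : P.Splits := IsAlgClosed.splits P
  have hcard : P.roots.toList.length = n + 1 := by
    rw [Multiset.length_toList, ← hsplit.natDegree_eq_card_roots, hdeg]
  refine ⟨fun i => P.roots.toList.get (i.cast hcard.symm), fun w hw => ?_⟩
  have h1 : P.eval w = r * ∏ i : Fin (n + 1), (w - P.roots.toList.get (i.cast hcard.symm)) := by
    rw [hsplit.eval_eq_prod_roots w, hlead]
    congr 1
    rw [← Fintype.prod_equiv (finCongr hcard) (fun i => w - P.roots.toList.get i) _ (fun i => rfl),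
      ← List.prod_ofFn,
      show (fun x => w - P.roots.toList.get x) = (fun x => w - x) ∘ P.roots.toList.get from rfl,
      ← List.map_ofFn, List.ofFn_get, ← Multiset.prod_coe, ← Multiset.map_coe, Multiset.coe_toList]
  have h2 : P.eval w = w ^ n * (polyMap r n a w - z) := by
    simp only [hP, hq, eval_add, eval_sub, eval_mul, eval_C, eval_pow, eval_X, eval_finsetSum,
      polyMap]
    rw [mul_sub, mul_add, Finset.mul_sum]
    have : ∀ j ∈ Finset.range (n + 1), a j * w ^ (n - j) = w ^ n * (a j * w⁻¹ ^ j) := by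
      intro j hj
      have hj' : j ≤ n := Nat.lt_succ_iff.1 (Finset.mem_range.1 hj)
      rw [inv_pow, ← Nat.sub_add_cancel hj', pow_add, Nat.add_sub_cancel]
      field_simp
    rw [Finset.sum_congr rfl this]
    ring
  rw [h2] at h1
  have hw' : w ^ n ≠ 0 := pow_ne_zero _ hw
  rw [mul_right_comm, ← h1]
  field_simp

lemma deriv_polyMap_div {z : ℂ} {c : Fin (n + 1) → ℂ} (hr : r ≠ 0)
    (hc : ∀ w ≠ 0, polyMap r n a w - z = r * (w ^ n)⁻¹ * ∏ i, (w - c i)) {w : ℂ} (hw : w ≠ 0)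
    (hwc : ∀ i, w ≠ c i) :
    deriv (polyMap r n a) w / (polyMap r n a w - z) = -n / w + ∑ i, (w - c i)⁻¹ := by
  have hr' : (r : ℂ) ≠ 0 := Complex.ofReal_ne_zero.2 hr
  have h1 : (fun w => polyMap r n a w - z) =ᶠ[𝓝 w]
      fun w => r * (w ^ n)⁻¹ * ∏ i, (w - c i) :=
    eventually_of_mem (isOpen_compl_singleton.mem_nhds hw) hc
  have hne : ∀ i ∈ Finset.univ, w - c i ≠ 0 := fun i _ => sub_ne_zero.2 (hwc i)
  have hinv : logDeriv (fun w : ℂ => (w ^ n)⁻¹) w = -n / w := by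
    simp_rw [← one_div]
    rw [logDeriv_div (f := fun _ => (1 : ℂ)) (g := fun w => w ^ n) w one_ne_zero
      (pow_ne_zero n hw) (by fun_prop) (by fun_prop), logDeriv_const,
      logDeriv_pow, Pi.zero_apply, zero_sub, neg_div]
  have h2 : logDeriv (fun w => polyMap r n a w - z) w = -n / w + ∑ i, (w - c i)⁻¹ := by
    rw [(logDeriv_congr_nhds h1).eq_of_nhds,
      logDeriv_mul (f := fun w : ℂ => (r : ℂ) * (w ^ n)⁻¹) w, logDeriv_const_mul,
      hinv, logDeriv_prod hne]
    · congr 1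
      refine Finset.sum_congr rfl fun i _ => ?_
      rw [logDeriv_apply, deriv_sub_const, deriv_id'', one_div]
    · intro i _; fun_prop
    · exact hr'
    · exact mul_ne_zero hr' (inv_ne_zero (pow_ne_zero n hw))
    · exact Finset.prod_ne_zero_iff.2 hne
    · exact DifferentiableAt.const_mul ((differentiableAt_id.pow n).inv (pow_ne_zero n hw)) _
    · fun_prop
  rw [← h2, logDeriv_apply, deriv_sub_const]

lemma circleIntegral_sub_inv_of_lt {c : ℂ} {ρ : ℝ} (hρ : 0 ≤ ρ) (hc : ρ < ‖c‖) :
    ∮ w in C(0, ρ), (w - c)⁻¹ = 0 := by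
  refine DiffContOnCl.circleIntegral_eq_zero hρ ?_
  have : DifferentiableOn ℂ (fun w => (w - c)⁻¹) (closedBall 0 ρ) := by
    refine DifferentiableOn.inv (by fun_prop) fun w hw h => ?_
    rw [sub_eq_zero.1 h] at hw
    simp at hw
    linarith
  exact ⟨this.mono ball_subset_closedBall, this.continuousOn.mono closure_ball_subset_closedBall⟩

/-- By the argument principle, all roots of `h w = z` lie in the disc when `γ` winds once
around `z`. -/
lemma norm_root_lt_one {z : ℂ} {c : Fin (n + 1) → ℂ} (hr : r ≠ 0)
    (hc : ∀ w ≠ 0, polyMap r n a w - z = r * (w ^ n)⁻¹ * ∏ i, (w - c i))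
    (hz : z ∉ polyCurve r n a)
    (hor : contourIntegral r n a (fun x => (x - z)⁻¹) = 2 * π * Complex.I) (i : Fin (n + 1)) :
    ‖c i‖ < 1 := by
  have hne : ∀ i, ‖c i‖ ≠ 1 := by
    intro i hi
    have hmem : c i ∈ sphere (0 : ℂ) 1 := by simpa using hi
    have h0 := hc (c i) (ne_zero_of_mem_sphere hmem)
    rw [Finset.prod_eq_zero (Finset.mem_univ i) (sub_self _), mul_zero, sub_eq_zero] at h0
    exact hz ⟨c i, hmem, h0⟩
  have hci : ∀ i, CircleIntegrable (fun w => (w - c i)⁻¹) 0 1 := by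
    intro i
    refine circleIntegrable_sub_inv_iff.2 (Or.inr ?_)
    simpa using hne i
  have hval : ∀ i, ∮ w in C(0, 1), (w - c i)⁻¹ =
      2 * π * Complex.I * ((if ‖c i‖ < 1 then 1 else 0 : ℕ) : ℂ) := by
    intro i
    split_ifs with h
    · rw [circleIntegral.integral_sub_inv_of_mem_ball (by simpa using h)]; simp
    · rw [circleIntegral_sub_inv_of_lt zero_le_one
        (lt_of_le_of_ne (not_lt.1 h) (hne i).symm)]; simp
  have h0 : ∮ w in C(0, 1), -(n : ℂ) / w = -n * (2 * π * Complex.I) := by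
    have := circleIntegral.integral_sub_center_inv 0 one_ne_zero
    simp only [sub_zero] at this
    simp_rw [div_eq_mul_inv]
    rw [circleIntegral.integral_const_mul, this]
  have h1 : contourIntegral r n a (fun x => (x - z)⁻¹) =
      ∮ w in C(0, 1), (-n / w + ∑ i, (w - c i)⁻¹) := by
    refine circleIntegral.integral_congr zero_le_one fun w hw => ?_
    simp only
    rw [← deriv_polyMap_div hr hc (ne_zero_of_mem_sphere hw) (fun i h => hne i (by
      rw [← h]; simpa using hw)), div_eq_mul_inv, mul_comm]
  have hi0 : CircleIntegrable (fun w : ℂ => -(n : ℂ) / w) 0 1 := by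
    refine ContinuousOn.circleIntegrable zero_le_one ?_
    exact continuousOn_const.div continuousOn_id fun w hw => ne_zero_of_mem_sphere hw
  rw [hor, circleIntegral.integral_add hi0 (by
      simpa [Finset.sum_fn] using CircleIntegrable.sum Finset.univ (fun i _ => hci i)),
    circleIntegral.integral_fun_sum (fun i _ => hci i), h0] at h1
  simp_rw [hval] at h1
  rw [← Finset.mul_sum, ← Nat.cast_sum, neg_mul, neg_add_eq_sub, eq_sub_iff_add_eq,
    mul_comm (n : ℂ), ← mul_one_add] at h1
  have h2 := mul_left_cancel₀ Complex.two_pi_I_ne_zero h1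
  -- The factor w⁻ⁿ contributes -n to the winding number and each root in the disc contributes 1, so
  -- winding number one leaves no root outside.
  have h3 : 1 + n = ∑ i, if ‖c i‖ < 1 then 1 else 0 := by exact_mod_cast h2
  rw [← Finset.card_filter] at h3
  have h4 : (Finset.univ.filter fun i => ‖c i‖ < 1) = Finset.univ := by
    rw [← Finset.card_eq_iff_eq_univ, ← h3, Fintype.card_fin, add_comm]
  have : i ∈ Finset.univ.filter fun i => ‖c i‖ < 1 := by
    rw [h4]; exact Finset.mem_univ i
  exact (Finset.mem_filter.1 this).2

end

/-! ### The domain bounded by the curve -/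

/-- A bounded domain whose boundary is a positively oriented polynomial curve. -/
structure IsCurveDomain (r : ℝ) (n : ℕ) (a : ℕ → ℂ) (G : Set ℂ) : Prop where
  analytic : IsSimpleAnalytic r n a
  isOpen : IsOpen G
  nonempty : G.Nonempty
  bounded : Bornology.IsBounded G
  frontier_eq : frontier G = polyCurve r n a
  oriented : PositivelyOrientedAround r n a G

section

variable {r : ℝ} {n : ℕ} {a : ℕ → ℂ} {G : Set ℂ}

lemma polyMap_mem_polyCurve {w : ℂ} (hw : w ∈ sphere (0 : ℂ) 1) :
    polyMap r n a w ∈ polyCurve r n a := mem_image_of_mem _ hw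

lemma IsCurveDomain.closure_eq (h : IsCurveDomain r n a G) :
    closure G = G ∪ polyCurve r n a := by
  rw [closure_eq_self_union_frontier, h.frontier_eq]

lemma IsCurveDomain.notMem_polyCurve (h : IsCurveDomain r n a G) {z : ℂ} (hz : z ∈ G) :
    z ∉ polyCurve r n a := by
  rw [← h.frontier_eq, h.isOpen.frontier_eq]
  exact fun h' => h'.2 hz

lemma IsCurveDomain.polyMap_mem_closure (h : IsCurveDomain r n a G) {w : ℂ}
    (hw : w ∈ sphere (0 : ℂ) 1) : polyMap r n a w ∈ closure G := by
  rw [h.closure_eq]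
  exact Or.inr (polyMap_mem_polyCurve hw)

/-- For z in G all roots lie in the disc, so |h(w) - z| ≥ r|w|⁻ⁿ(|w| - 1)ⁿ⁺¹. The bound does not
depend on z and therefore passes to the closure. -/
lemma IsCurveDomain.polyMap_notMem_closure (h : IsCurveDomain r n a G) {w : ℂ} (hw : 1 < ‖w‖) :
    polyMap r n a w ∉ closure G := by
  have hr := h.analytic.r_pos
  have hw0 : w ≠ 0 := by rintro rfl; simp at hw; linarith
  set C : ℝ := r * (‖w‖ ^ n)⁻¹ * (‖w‖ - 1) ^ (n + 1) with hC
  have hC0 : 0 < C := by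
    have : 0 < ‖w‖ := by linarith
    have : 0 < ‖w‖ - 1 := by linarith
    positivity
  have hcl : IsClosed {z | C ≤ ‖polyMap r n a w - z‖} :=
    isClosed_le continuous_const (by fun_prop)
  have hsub : G ⊆ {z | C ≤ ‖polyMap r n a w - z‖} := by
    intro z hz
    obtain ⟨c, hc⟩ := exists_factorization (a := a) (n := n) hr.ne' z
    have hci := norm_root_lt_one hr.ne' hc (h.notMem_polyCurve hz) (h.oriented z hz)
    have h1 : (‖w‖ - 1) ^ (n + 1) ≤ ∏ i, ‖w - c i‖ := by
      have : ∏ _i : Fin (n + 1), (‖w‖ - 1) ≤ ∏ i, ‖w - c i‖ := by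
        refine Finset.prod_le_prod (fun i _ => by linarith) fun i _ => ?_
        linarith [norm_sub_norm_le w (c i), hci i]
      simpa using this
    simp only [mem_ofPred_eq]
    rw [hc w hw0, norm_mul, norm_mul, norm_prod, norm_inv, norm_pow, Complex.norm_real,
      Real.norm_of_nonneg hr.le]
    exact mul_le_mul_of_nonneg_left h1 (by positivity)
  intro hmem
  have := closure_minimal hsub hcl hmem
  simp only [mem_ofPred_eq, sub_self, norm_zero] at this
  linarith

/-- For `z` in the closed domain, all roots of `h w = z` lie in the closed disc. -/
lemma IsCurveDomain.norm_root_le_one (h : IsCurveDomain r n a G) {z : ℂ} (hz : z ∈ closure G)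
    {c : Fin (n + 1) → ℂ}
    (hc : ∀ w ≠ 0, polyMap r n a w - z = r * (w ^ n)⁻¹ * ∏ i, (w - c i)) (i : Fin (n + 1)) :
    ‖c i‖ ≤ 1 := by
  by_contra hlt
  push Not at hlt
  have h0 : c i ≠ 0 := by intro h0; rw [h0] at hlt; simp at hlt; linarith
  have h1 := hc (c i) h0
  rw [Finset.prod_eq_zero (Finset.mem_univ i) (sub_self _), mul_zero, sub_eq_zero] at h1
  exact h.polyMap_notMem_closure hlt (h1 ▸ hz)

/-- `h` maps the inner half of a collar into the domain. -/
lemma IsCurveDomain.polyMap_mem_of_lt (h : IsCurveDomain r n a G) {δ : ℝ} (hδ : δ ∈ Ioo (0 : ℝ) 1)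
    (hQ : ∀ w ∈ collar δ, ∀ u ∈ collar δ, slopeMap r n a w u ≠ 0) {w : ℂ}
    (hw1 : 1 - δ ≤ ‖w‖) (hw2 : ‖w‖ < 1) : polyMap r n a w ∈ G := by
  have hinj := polyMap_injOn_collar hδ.2 hQ
  set A : Set ℂ := (fun q : ℝ × ℝ => circleMap 0 q.1 q.2) '' (Ico (1 - δ) 1 ×ˢ univ) with hA
  have hAmem : ∀ v, 1 - δ ≤ ‖v‖ → ‖v‖ < 1 → v ∈ A := fun v h1 h2 =>
    ⟨(‖v‖, v.arg), ⟨⟨h1, h2⟩, mem_univ _⟩, by simp [circleMap]⟩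
  have hA' : ∀ v ∈ A, 1 - δ ≤ ‖v‖ ∧ ‖v‖ < 1 := by
    rintro _ ⟨q, ⟨hq, -⟩, rfl⟩
    have : 0 ≤ q.1 := by linarith [hq.1, hδ.2]
    simpa [abs_of_nonneg this] using hq
  have hAcol : A ⊆ collar δ := fun v hv => mem_collar.2
    ⟨by linarith [(hA' v hv).2, hδ.1], (hA' v hv).1⟩
  have hpre : IsPreconnected (polyMap r n a '' A) := by
    refine IsPreconnected.image (IsPreconnected.image ?_ _ ?_) _ ?_
    · exact isPreconnected_Ico.prod isPreconnected_univ
    · unfold circleMap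
      fun_prop
    · exact (continuousOn_polyMap r n a).mono fun v hv => ne_zero_of_mem_collar hδ.2 (hAcol hv)
  -- The image of the half-open annulus misses γ by injectivity on the collar; being connected, it
  -- lies entirely in G or entirely off the closure.
  have hdisj : polyMap r n a '' A ⊆ G ∪ (closure G)ᶜ := by
    rintro _ ⟨v, hv, rfl⟩
    by_cases hvG : polyMap r n a v ∈ closure G
    · rw [h.closure_eq] at hvG
      refine Or.inl (hvG.resolve_right ?_)
      rintro ⟨u, hu, huv⟩
      have := hinj (sphere_subset_collar hδ.1.le hu) (hAcol hv) huv
      have hv2 := (hA' v hv).2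
      rw [← this] at hv2
      simp at hu
      linarith
    · exact Or.inr hvG
  -- Since h is open at 1, points of G near h(1) have the form h(v). Here |v| = 1 would put h(v) on
  -- γ, and |v| > 1 outside the closure, so |v| < 1.
  have hne : (polyMap r n a '' A ∩ G).Nonempty := by
    have h1 : (1 : ℂ) ∈ sphere (0 : ℂ) 1 := by simp
    have hN : polyMap r n a '' collar δ ∈ 𝓝 (polyMap r n a 1) := by
      rw [← map_nhds_polyMap r n a one_ne_zero (h.analytic.regular 1 h1)]
      exact image_mem_map (collar_mem_nhds hδ.1 h1)
    obtain ⟨_, ⟨v, hv, rfl⟩, hvG⟩ := mem_closure_iff_nhds.1 (h.polyMap_mem_closure h1) _ hN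
    obtain ⟨hv1, hv2⟩ := mem_collar.1 hv
    refine ⟨_, ⟨v, hAmem v hv2 ?_, rfl⟩, hvG⟩
    rcases lt_trichotomy ‖v‖ 1 with hlt | heq | hgt
    · exact hlt
    · exact absurd (polyMap_mem_polyCurve (by simpa using heq)) (h.notMem_polyCurve hvG)
    · exact absurd (subset_closure hvG) (h.polyMap_notMem_closure hgt)
  have hsub := hpre.subset_left_of_subset_union h.isOpen isClosed_closure.isOpen_compl
    (disjoint_compl_right.mono_left subset_closure) hdisj hne
  exact hsub ⟨w, hAmem w hw1 hw2, rfl⟩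

end

/-! ### Cauchy's integral formula for the curve -/

/-- The image curve is compact, so the denominator stays bounded below for points near ζ and
differentiation under the integral is legitimate. -/
lemma differentiableAt_cauchyIntegral {ρ : ℝ} (hρ : 0 ≤ ρ) {φ H : ℂ → ℂ}
    (hφ : ContinuousOn φ (sphere 0 ρ)) (hH : ContinuousOn H (sphere 0 ρ)) {ζ : ℂ}
    (hζ : ζ ∉ H '' sphere 0 ρ) :
    DifferentiableAt ℂ (fun ζ => ∮ w in C(0, ρ), φ w / (H w - ζ)) ζ := by
  have hcpt : IsCompact (H '' sphere 0 ρ) := (isCompact_sphere 0 ρ).image_of_continuousOn hH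
  obtain ⟨ε, hε, hball⟩ := Metric.isOpen_iff.1 hcpt.isClosed.isOpen_compl ζ hζ
  obtain ⟨B, hB⟩ := (isCompact_sphere (0 : ℂ) ρ).exists_bound_of_continuousOn hφ
  have hsph : ∀ θ, circleMap 0 ρ θ ∈ sphere (0 : ℂ) ρ := circleMap_mem_sphere 0 hρ
  have hφc : Continuous fun θ => φ (circleMap 0 ρ θ) :=
    hφ.comp_continuous (continuous_circleMap 0 ρ) hsph
  have hHc : Continuous fun θ => H (circleMap 0 ρ θ) :=
    hH.comp_continuous (continuous_circleMap 0 ρ) hsph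
  have hdc : Continuous (deriv (circleMap 0 ρ)) := by
    have : deriv (circleMap 0 ρ) = fun θ => circleMap 0 ρ θ * Complex.I := by
      ext θ; rw [deriv_circleMap]
    rw [this]
    fun_prop
  have hlow : ∀ x ∈ ball ζ (ε / 2), ∀ θ, ε / 2 ≤ ‖H (circleMap 0 ρ θ) - x‖ := by
    intro x hx θ
    by_contra hlt
    push Not at hlt
    have hmem : H (circleMap 0 ρ θ) ∈ ball ζ ε := by
      rw [mem_ball] at hx ⊢
      rw [← dist_eq_norm] at hlt
      linarith [dist_triangle (H (circleMap 0 ρ θ)) x ζ]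
    exact hball hmem (mem_image_of_mem _ (hsph θ))
  have hne : ∀ x ∈ ball ζ (ε / 2), ∀ θ, H (circleMap 0 ρ θ) - x ≠ 0 := fun x hx θ =>
    norm_pos_iff.1 ((half_pos hε).trans_le (hlow x hx θ))
  have hB0 : 0 ≤ B := (norm_nonneg _).trans (hB _ (hsph 0))
  have key := intervalIntegral.hasDerivAt_integral_of_dominated_loc_of_deriv_le
    (μ := volume) (a := 0) (b := 2 * π) (x₀ := ζ) (s := ball ζ (ε / 2))
    (F := fun x θ => deriv (circleMap 0 ρ) θ • (φ (circleMap 0 ρ θ) / (H (circleMap 0 ρ θ) - x)))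
    (F' := fun x θ => deriv (circleMap 0 ρ) θ •
      (φ (circleMap 0 ρ θ) / (H (circleMap 0 ρ θ) - x) ^ 2))
    (bound := fun _ => ρ * (B / (ε / 2) ^ 2)) (ball_mem_nhds ζ (half_pos hε)) ?_ ?_ ?_ ?_ ?_ ?_
  · exact key.2.differentiableAt
  · filter_upwards [ball_mem_nhds ζ (half_pos hε)] with x hx
    exact (hdc.smul (hφc.div (hHc.sub continuous_const) (hne x hx))).aestronglyMeasurable
  · exact (hdc.smul (hφc.div (hHc.sub continuous_const)
      (hne ζ (mem_ball_self (half_pos hε))))).intervalIntegrable _ _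
  · exact (hdc.smul (hφc.div ((hHc.sub continuous_const).pow 2) fun θ => pow_ne_zero 2
      (hne ζ (mem_ball_self (half_pos hε)) θ))).aestronglyMeasurable
  · refine ae_of_all _ fun θ _ x hx => ?_
    rw [norm_smul, deriv_circleMap, norm_mul, Complex.norm_I, mul_one, norm_circleMap_zero,
      abs_of_nonneg hρ, norm_div, norm_pow]
    refine mul_le_mul_of_nonneg_left ?_ hρ
    exact div_le_div₀ hB0 (hB _ (hsph θ)) (by positivity)
      (pow_le_pow_left₀ (by positivity) (hlow x hx θ) 2)
  · exact intervalIntegrable_const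
  · refine ae_of_all _ fun θ _ x hx => ?_
    have h1 : HasDerivAt (fun x => H (circleMap 0 ρ θ) - x) (-1) x := by
      simpa using (hasDerivAt_id x).const_sub (H (circleMap 0 ρ θ))
    have h2 : HasDerivAt (fun x => φ (circleMap 0 ρ θ) / (H (circleMap 0 ρ θ) - x))
        (φ (circleMap 0 ρ θ) / (H (circleMap 0 ρ θ) - x) ^ 2) x := by
      refine ((hasDerivAt_const x (φ (circleMap 0 ρ θ))).fun_div h1 (hne x hx θ)).congr_deriv ?_
      ring
    exact h2.const_smul (deriv (circleMap 0 ρ) θ)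

/-- Cauchy's integral formula in an annulus. -/
lemma circleIntegral_annulus_sub {ρ R : ℝ} (hρ : 0 < ρ) {Φ : ℂ → ℂ}
    (hΦc : ContinuousOn Φ (closedBall 0 R \ ball 0 ρ))
    (hΦd : ∀ w ∈ ball (0 : ℂ) R \ closedBall 0 ρ, DifferentiableAt ℂ Φ w) {u : ℂ}
    (hu1 : ρ < ‖u‖) (hu2 : ‖u‖ < R) :
    (∮ w in C(0, R), Φ w / (w - u)) - ∮ w in C(0, ρ), Φ w / (w - u) =
      2 * π * Complex.I * Φ u := by
  have hR : 0 < R := hρ.trans (hu1.trans hu2)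
  have huA : u ∈ ball (0 : ℂ) R \ closedBall 0 ρ := ⟨by simpa using hu2, by simpa using hu1⟩
  have hnhds : closedBall (0 : ℂ) R \ ball 0 ρ ∈ 𝓝 u :=
    mem_of_superset ((isOpen_ball.sdiff isClosed_closedBall).mem_nhds huA)
      (sdiff_subset_sdiff ball_subset_closedBall ball_subset_closedBall)
  -- The divided difference is continuous at u and differentiable elsewhere in the annulus, so its
  -- two integrals agree. What was subtracted is Φ(u)∮dw/(w-u), which is 2πiΦ(u) on the outer circle
  -- and 0 on the inner one.
  have hds : (∮ w in C(0, R), dslope Φ u w) = ∮ w in C(0, ρ), dslope Φ u w := by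
    refine Complex.circleIntegral_eq_of_differentiable_on_annulus_off_countable hρ
      (hu1.trans hu2).le (countable_singleton u) ?_ ?_
    · exact (continuousOn_dslope hnhds).2 ⟨hΦc, hΦd u huA⟩
    · exact fun w hw => (differentiableAt_dslope_of_ne hw.2).2 (hΦd w hw.1)
  have hsplit : ∀ s, 0 ≤ s → s ≠ ‖u‖ → sphere (0 : ℂ) s ⊆ closedBall (0 : ℂ) R \ ball 0 ρ →
      (∮ w in C(0, s), dslope Φ u w) =
        (∮ w in C(0, s), Φ w / (w - u)) - Φ u * ∮ w in C(0, s), (w - u)⁻¹ := by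
    intro s hs hsu hsub
    have hne : ∀ w ∈ sphere (0 : ℂ) s, w - u ≠ 0 := by
      intro w hw h0
      rw [sub_eq_zero.1 h0] at hw
      exact hsu (by simpa using hw.symm)
    rw [← circleIntegral.integral_const_mul, ← circleIntegral.integral_sub]
    · refine circleIntegral.integral_congr hs fun w hw => ?_
      have h0 := hne w hw
      rw [dslope_of_ne _ (sub_ne_zero.1 h0), slope_def_field]
      field_simp
    · exact ContinuousOn.circleIntegrable hs ((hΦc.mono hsub).div (by fun_prop) hne)
    · exact ContinuousOn.circleIntegrable hs
        (continuousOn_const.mul (ContinuousOn.inv₀ (by fun_prop) hne))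
  rw [hsplit R hR.le hu2.ne' fun w hw => ?_, hsplit ρ hρ.le hu1.ne fun w hw => ?_,
    circleIntegral.integral_sub_inv_of_mem_ball huA.1, circleIntegral_sub_inv_of_lt hρ.le hu1,
    mul_zero, sub_zero] at hds
  · rw [← hds]; ring
  · have : ‖w‖ = ρ := by simpa using hw
    exact ⟨by simpa [this] using (hu1.trans hu2).le, by simp [this]⟩
  · have : ‖w‖ = R := by simpa using hw
    exact ⟨by simp [this], by simpa [this] using (hu1.trans hu2).le⟩

section

variable {r : ℝ} {n : ℕ} {a : ℕ → ℂ} {G : Set ℂ}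

/-- **Cauchy's integral formula** for functions holomorphic in the domain and continuous up to
the curve. -/
theorem IsCurveDomain.cauchy_formula (h : IsCurveDomain r n a G) {g : ℂ → ℂ}
    (hg : DiffContOnCl ℂ g G) {ζ : ℂ} (hζ : ζ ∈ G) :
    contourIntegral r n a (fun z => g z / (z - ζ)) = 2 * π * Complex.I * g ζ := by
  obtain ⟨δ, hδ, hQ⟩ := h.analytic.exists_collar
  have hin : ∀ w, 1 - δ ≤ ‖w‖ → ‖w‖ < 1 → polyMap r n a w ∈ G :=
    fun w => h.polyMap_mem_of_lt hδ hQ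
  set ρ := 1 - δ with hρdef
  have hρ : 0 < ρ := by linarith [hδ.2]
  have hρ1 : ρ < 1 := by linarith [hδ.1]
  set φ : ℂ → ℂ := fun w => g (polyMap r n a w) * deriv (polyMap r n a) w with hφ
  set A : Set ℂ := closedBall 0 1 \ ball 0 ρ with hA
  have hA0 : ∀ w ∈ A, w ≠ 0 := by
    rintro w hw rfl
    exact hw.2 (by simpa using hρ)
  have hAcol : A ⊆ collar δ := fun w hw => mem_collar.2
    ⟨by have : ‖w‖ ≤ 1 := by simpa using hw.1
        linarith [hδ.1], by have : ρ ≤ ‖w‖ := by simpa using hw.2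
                            exact this⟩
  have hAcl : ∀ w ∈ A, polyMap r n a w ∈ closure G := by
    intro w hw
    have h1 : ‖w‖ ≤ 1 := by simpa using hw.1
    have h2 : ρ ≤ ‖w‖ := by simpa using hw.2
    rcases h1.lt_or_eq with h3 | h3
    · exact subset_closure (hin w h2 h3)
    · exact h.polyMap_mem_closure (by simpa using h3)
  have hφc : ContinuousOn φ A :=
    (hg.continuousOn.comp ((continuousOn_polyMap r n a).mono hA0) hAcl).mul
      ((continuousOn_deriv_polyMap r n a).mono hA0)
  have hφd : ∀ w ∈ ball (0 : ℂ) 1 \ closedBall 0 ρ, DifferentiableAt ℂ φ w := by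
    intro w hw
    have h1 : ‖w‖ < 1 := by simpa using hw.1
    have h2 : ρ < ‖w‖ := by simpa using hw.2
    have h0 : w ≠ 0 := norm_pos_iff.1 (hρ.trans h2)
    have hwG := hin w h2.le h1
    exact ((hg.differentiableAt h.isOpen hwG).comp w (differentiableAt_polyMap r n a h0)).mul
      ((differentiableOn_deriv_polyMap r n a).differentiableAt
        (isOpen_compl_singleton.mem_nhds h0))
  have hs1 : sphere (0 : ℂ) 1 ⊆ A := fun w hw => by
    have : ‖w‖ = 1 := by simpa using hw
    exact ⟨by simp [this], by simpa [this] using hρ1.le⟩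
  have hsρ : sphere (0 : ℂ) ρ ⊆ A := fun w hw => by
    have : ‖w‖ = ρ := by simpa using hw
    exact ⟨by simpa [this] using hρ1.le, by simp [this]⟩
  -- I₁ is the Cauchy integral over γ, Iρ the one over the inner curve h(|w| = ρ). They differ by
  -- 2πi g just inside γ and coincide just outside, so 2πi g - I₁ on G and -I₁ off the closure
  -- continue each other across γ through -Iρ. The result is entire and tends to 0 at infinity.
  set I₁ : ℂ → ℂ := fun ζ => ∮ w in C(0, 1), φ w / (polyMap r n a w - ζ) with hI₁
  set Iρ : ℂ → ℂ := fun ζ => ∮ w in C(0, ρ), φ w / (polyMap r n a w - ζ) with hIρ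
  have hI₁d : ∀ ζ ∉ polyCurve r n a, DifferentiableAt ℂ I₁ ζ := fun ζ hζ =>
    differentiableAt_cauchyIntegral zero_le_one (hφc.mono hs1)
      ((continuousOn_polyMap r n a).mono fun w hw => hA0 w (hs1 hw)) hζ
  have hIρd : ∀ ζ ∈ polyCurve r n a, DifferentiableAt ℂ Iρ ζ := by
    intro ζ hζ
    refine differentiableAt_cauchyIntegral hρ.le (hφc.mono hsρ)
      ((continuousOn_polyMap r n a).mono fun w hw => hA0 w (hsρ hw)) ?_
    rintro ⟨w, hw, rfl⟩
    have : ‖w‖ = ρ := by simpa using hw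
    exact h.notMem_polyCurve (hin w this.ge (this ▸ hρ1)) hζ
  -- the integrand in terms of the difference quotient
  have hquot : ∀ u ∈ collar δ, ∀ w ∈ A,
      φ w / (polyMap r n a w - polyMap r n a u) = φ w / slopeMap r n a w u / (w - u) := by
    intro u hu w hw
    rw [polyMap_sub r n a (hA0 w hw) (ne_zero_of_mem_collar hδ.2 hu), mul_comm, div_div]
  have hΦc : ∀ u ∈ collar δ, ContinuousOn (fun w => φ w / slopeMap r n a w u) A := by
    intro u hu
    refine hφc.div (fun w hw => ?_) fun w hw => hQ w (hAcol hw) u hu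
    exact (differentiableAt_slopeMap r n a (hA0 w hw) u).continuousAt.continuousWithinAt
  have hΦd : ∀ u ∈ collar δ, ∀ w ∈ ball (0 : ℂ) 1 \ closedBall 0 ρ,
      DifferentiableAt ℂ (fun w => φ w / slopeMap r n a w u) w := by
    intro u hu w hw
    have hwA : w ∈ A := ⟨ball_subset_closedBall hw.1, fun h' => hw.2 (ball_subset_closedBall h')⟩
    exact (hφd w hw).div (differentiableAt_slopeMap r n a (hA0 w hwA) u) (hQ w (hAcol hwA) u hu)
  -- In the w-plane the integrand is φ(w)/Q(w,u) divided by w - u, where Q is `slopeMap`; since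
  -- Q(u,u) = h'(u), the residue at u is g(h(u)).
  have hinner : ∀ u, ρ < ‖u‖ → ‖u‖ < 1 →
      I₁ (polyMap r n a u) - Iρ (polyMap r n a u) =
        2 * π * Complex.I * g (polyMap r n a u) := by
    intro u hu1 hu2
    have huc : u ∈ collar δ := mem_collar.2 ⟨by linarith [hδ.1], hu1.le⟩
    have h0 := ne_zero_of_mem_collar hδ.2 huc
    have h1 := circleIntegral_annulus_sub hρ (hΦc u huc) (hΦd u huc) hu1 hu2
    have h2 : φ u / slopeMap r n a u u = g (polyMap r n a u) := by
      rw [hφ]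
      simp only
      rw [deriv_polyMap r n a h0, mul_div_cancel_right₀ _ (hQ u huc u huc)]
    rw [h2] at h1
    rw [← h1, hI₁, hIρ]
    simp only
    rw [circleIntegral.integral_congr zero_le_one fun w hw => hquot u huc w (hs1 hw),
      circleIntegral.integral_congr hρ.le fun w hw => hquot u huc w (hsρ hw)]
  have houter : ∀ u, 1 < ‖u‖ → ‖u‖ < 1 + δ →
      I₁ (polyMap r n a u) = Iρ (polyMap r n a u) := by
    intro u hu1 hu2
    have huc : u ∈ collar δ := mem_collar.2 ⟨hu2.le, by linarith⟩
    have hne : ∀ w ∈ A, w - u ≠ 0 := by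
      intro w hw h0
      have : ‖w‖ ≤ 1 := by simpa using hw.1
      rw [sub_eq_zero.1 h0] at this
      linarith
    rw [hI₁, hIρ]
    simp only
    rw [circleIntegral.integral_congr zero_le_one fun w hw => hquot u huc w (hs1 hw),
      circleIntegral.integral_congr hρ.le fun w hw => hquot u huc w (hsρ hw)]
    refine Complex.circleIntegral_eq_of_differentiable_on_annulus_off_countable hρ hρ1.le
      countable_empty ((hΦc u huc).div (by fun_prop) hne) fun w hw => ?_
    refine (hΦd u huc w hw.1).div (by fun_prop) (hne w ?_)
    exact ⟨ball_subset_closedBall hw.1.1, fun h' => hw.1.2 (ball_subset_closedBall h')⟩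
  -- gluing to an entire function
  classical
  set F : ℂ → ℂ := fun ζ => if ζ ∈ polyCurve r n a then -Iρ ζ else
    if ζ ∈ G then 2 * π * Complex.I * g ζ - I₁ ζ else -I₁ ζ with hF
  have hFG : ∀ ζ ∈ G, F ζ = 2 * π * Complex.I * g ζ - I₁ ζ := fun ζ hζ => by
    simp only [hF]
    rw [if_neg (h.notMem_polyCurve hζ), if_pos hζ]
  have hFo : ∀ ζ ∉ closure G, F ζ = -I₁ ζ := fun ζ hζ => by
    simp only [hF]
    rw [h.closure_eq] at hζ
    rw [if_neg fun h' => hζ (Or.inr h'), if_neg fun h' => hζ (Or.inl h')]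
  have hFc : ∀ u, ρ < ‖u‖ → ‖u‖ < 1 + δ → F (polyMap r n a u) = -Iρ (polyMap r n a u) := by
    intro u hu1 hu2
    rcases lt_trichotomy ‖u‖ 1 with hlt | heq | hgt
    · rw [hFG _ (hin u hu1.le hlt), ← hinner u hu1 hlt]; ring
    · simp only [hF]
      rw [if_pos (polyMap_mem_polyCurve (by simpa using heq))]
    · rw [hFo _ (h.polyMap_notMem_closure hgt), houter u hgt hu2]
  have hFd : Differentiable ℂ F := by
    intro ζ
    by_cases hζγ : ζ ∈ polyCurve r n a
    · obtain ⟨u, hu, rfl⟩ := id hζγ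
      have hu1 : ‖u‖ = 1 := by simpa using hu
      have hev : F =ᶠ[𝓝 (polyMap r n a u)] fun ζ => -Iρ ζ := by
        rw [← map_nhds_polyMap r n a (ne_zero_of_mem_sphere hu) (h.analytic.regular u hu)]
        refine eventually_map.2 ?_
        have hop : {v : ℂ | ρ < ‖v‖ ∧ ‖v‖ < 1 + δ} ∈ 𝓝 u :=
          ((isOpen_lt continuous_const continuous_norm).inter
            (isOpen_lt continuous_norm continuous_const)).mem_nhds
            ⟨by simp only [mem_ofPred_eq]; linarith,
              by simp only [mem_ofPred_eq]; linarith [hδ.1]⟩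
        exact mem_of_superset hop fun v hv => hFc v hv.1 hv.2
      exact hev.differentiableAt_iff.2 (hIρd _ hζγ).neg
    · by_cases hζG : ζ ∈ G
      · have hev : F =ᶠ[𝓝 ζ] fun ζ => 2 * π * Complex.I * g ζ - I₁ ζ :=
          eventually_of_mem (h.isOpen.mem_nhds hζG) hFG
        exact hev.differentiableAt_iff.2
          (((hg.differentiableAt h.isOpen hζG).const_mul _).sub (hI₁d ζ hζγ))
      · have hζc : ζ ∉ closure G := by
          rw [h.closure_eq]
          exact fun h' => h'.elim hζG hζγ
        have hev : F =ᶠ[𝓝 ζ] fun ζ => -I₁ ζ :=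
          eventually_of_mem (isClosed_closure.isOpen_compl.mem_nhds hζc) hFo
        exact hev.differentiableAt_iff.2 (hI₁d ζ hζγ).neg
  have hFlim : Tendsto F (cocompact ℂ) (𝓝 0) := by
    obtain ⟨B, hB⟩ := (isCompact_sphere (0 : ℂ) 1).exists_bound_of_continuousOn (hφc.mono hs1)
    obtain ⟨M, hM⟩ := (isCompact_sphere (0 : ℂ) 1).exists_bound_of_continuousOn
      ((continuousOn_polyMap r n a).mono fun w hw => hA0 w (hs1 hw))
    have h1 : Tendsto (fun ζ : ℂ => 2 * π * 1 * (B / (‖ζ‖ - M))) (cocompact ℂ)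
        (𝓝 (2 * π * 1 * 0)) :=
      ((tendsto_atTop_add_const_right _ (-M)
        (tendsto_norm_cocompact_atTop (E := ℂ))).const_div_atTop B).const_mul _
    rw [mul_zero] at h1
    refine squeeze_zero_norm' ?_ h1
    have hcpt : IsCompact (closure G) := h.bounded.isCompact_closure
    filter_upwards [hcpt.compl_mem_cocompact,
      (tendsto_norm_cocompact_atTop (E := ℂ)).eventually_gt_atTop M] with ζ hζ hζM
    rw [hFo ζ hζ, norm_neg]
    refine circleIntegral.norm_integral_le_of_norm_le_const zero_le_one fun w hw => ?_
    rw [norm_div]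
    refine div_le_div₀ ((norm_nonneg _).trans (hB w hw)) (hB w hw) (by linarith) ?_
    have := norm_sub_norm_le ζ (polyMap r n a w)
    rw [norm_sub_rev] at this
    linarith [hM w hw]
  have hF0 := hFd.apply_eq_of_tendsto_cocompact ζ hFlim
  rw [hFG ζ hζ, sub_eq_zero] at hF0
  rw [hF0, contourIntegral]
  refine circleIntegral.integral_congr zero_le_one fun w _ => ?_
  simp only [hφ]
  ring

/-- **Cauchy's theorem** for functions holomorphic in the domain and continuous up to the
curve. -/
theorem IsCurveDomain.cauchy_theorem (h : IsCurveDomain r n a G) {g : ℂ → ℂ}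
    (hg : DiffContOnCl ℂ g G) : contourIntegral r n a g = 0 := by
  obtain ⟨ζ, hζ⟩ := h.nonempty
  have h0 : Differentiable ℂ fun z : ℂ => z - ζ := by fun_prop
  -- Cauchy's formula at ζ for a function vanishing at ζ.
  have h1 : DiffContOnCl ℂ (fun z => (z - ζ) * g z) G := h0.diffContOnCl.smul hg
  have h2 := h.cauchy_formula h1 hζ
  rw [sub_self, zero_mul, mul_zero] at h2
  rw [← h2, contourIntegral, contourIntegral]
  refine circleIntegral.integral_congr zero_le_one fun w hw => ?_
  have : polyMap r n a w - ζ ≠ 0 := by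
    intro h0
    exact h.notMem_polyCurve hζ (sub_eq_zero.1 h0 ▸ polyMap_mem_polyCurve hw)
  rw [mul_div_cancel_left₀ _ this]

end

/-! ### Contour integrals as integrals over the circle -/

section

variable (r : ℝ) (n : ℕ) (a : ℕ → ℂ)

/-- The parametrization of the curve by the angle. -/
def curvePoint (θ : ℝ) : ℂ := polyMap r n a (circleMap 0 1 θ)

/-- The density of `dz` along the curve with respect to the normalized angle. -/
def curveWeight (θ : ℝ) : ℂ :=
  2 * π * Complex.I * (circleMap 0 1 θ * deriv (polyMap r n a) (circleMap 0 1 θ))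

lemma circleMap_zero_one_mem (θ : ℝ) : circleMap 0 1 θ ∈ sphere (0 : ℂ) 1 :=
  circleMap_mem_sphere 0 zero_le_one θ

lemma continuous_comp_circleMap {g : ℂ → ℂ} (hg : ContinuousOn g {0}ᶜ) :
    Continuous fun θ => g (circleMap 0 1 θ) :=
  hg.comp_continuous (continuous_circleMap 0 1)
    fun θ => ne_zero_of_mem_sphere (circleMap_zero_one_mem θ)

lemma continuous_curvePoint : Continuous (curvePoint r n a) :=
  continuous_comp_circleMap (continuousOn_polyMap r n a)

lemma continuous_curveWeight : Continuous (curveWeight r n a) :=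
  continuous_const.mul ((continuous_circleMap 0 1).mul
    (continuous_comp_circleMap (continuousOn_deriv_polyMap r n a)))

lemma curvePoint_mem (θ : ℝ) : curvePoint r n a θ ∈ polyCurve r n a :=
  mem_image_of_mem _ (circleMap_zero_one_mem θ)

lemma isCompact_polyCurve : IsCompact (polyCurve r n a) :=
  (isCompact_sphere 0 1).image_of_continuousOn
    ((continuousOn_polyMap r n a).mono fun _ hw => ne_zero_of_mem_sphere hw)

lemma circleIntegral_eq_integral_angleMeasure (g : ℂ → ℂ) :
    (∮ w in C(0, 1), g w) =
      ∫ θ, 2 * π * Complex.I * (circleMap 0 1 θ * g (circleMap 0 1 θ)) ∂angleMeasure := by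
  rw [integral_angleMeasure, circleIntegral, ← intervalIntegral.integral_smul]
  congr 1
  ext θ
  rw [deriv_circleMap, smul_eq_mul, Complex.real_smul]
  have : (π : ℂ) ≠ 0 := by exact_mod_cast Real.pi_ne_zero
  push_cast
  field_simp

lemma contourIntegral_eq_integral_angleMeasure (g : ℂ → ℂ) :
    contourIntegral r n a g =
      ∫ θ, curveWeight r n a θ * g (curvePoint r n a θ) ∂angleMeasure := by
  rw [contourIntegral, circleIntegral_eq_integral_angleMeasure]
  congr 1
  ext θ
  rw [curveWeight, curvePoint]
  ring

/-- A differentiable image of a null circle is null; a measure of bounded density therefore does not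
charge γ. -/
lemma volume_polyCurve : volume (polyCurve r n a) = 0 := by
  refine addHaar_image_eq_zero_of_differentiableOn_of_addHaar_eq_zero volume ?_
    (Measure.addHaar_sphere volume (0 : ℂ) 1)
  exact ((differentiableOn_polyMap r n a).mono
    fun w hw => ne_zero_of_mem_sphere hw).restrictScalars ℝ

variable {r n a}

lemma contourIntegral_congr {f g : ℂ → ℂ} (h : ∀ z ∈ polyCurve r n a, f z = g z) :
    contourIntegral r n a f = contourIntegral r n a g := by
  simp_rw [contourIntegral_eq_integral_angleMeasure, h _ (curvePoint_mem r n a _)]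

lemma integrable_curve {g : ℂ → ℂ} (hg : ContinuousOn g (polyCurve r n a)) :
    Integrable (fun θ => curveWeight r n a θ * g (curvePoint r n a θ)) angleMeasure :=
  integrable_angleMeasure_of_continuous ((continuous_curveWeight r n a).mul
    (hg.comp_continuous (continuous_curvePoint r n a) (curvePoint_mem r n a)))

lemma contourIntegral_add {f g : ℂ → ℂ} (hf : ContinuousOn f (polyCurve r n a))
    (hg : ContinuousOn g (polyCurve r n a)) :
    contourIntegral r n a (fun z => f z + g z) =
      contourIntegral r n a f + contourIntegral r n a g := by
  simp_rw [contourIntegral_eq_integral_angleMeasure, mul_add]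
  exact integral_add (integrable_curve hf) (integrable_curve hg)

lemma contourIntegral_const_mul (c : ℂ) (f : ℂ → ℂ) :
    contourIntegral r n a (fun z => c * f z) = c * contourIntegral r n a f := by
  simp_rw [contourIntegral_eq_integral_angleMeasure, ← integral_const_mul]
  congr 1
  ext θ
  ring

end

section

variable {r : ℝ} {n : ℕ} {a : ℕ → ℂ} {G : Set ℂ} {μ : Measure ℂ} [IsFiniteMeasure μ] {C : NNReal}

/-! ### Quadrature identities -/

lemma IsCurveDomain.polyCurve_subset_closure (h : IsCurveDomain r n a G) :
    polyCurve r n a ⊆ closure G := by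
  rw [h.closure_eq]; exact subset_union_right

/-- Justifies Fubini for the Cauchy kernel: by the density bound, ∫|ζ - w|⁻¹ dμ(w) is a continuous
function of ζ, even on γ. -/
lemma integrable_prod_inv_curvePoint (hC : μ ≤ C • volume) (hG : Bornology.IsBounded G)
    (hμG : ∀ᵐ w ∂μ, w ∈ G) :
    Integrable (fun q : ℝ × ℂ => (curvePoint r n a q.1 - q.2)⁻¹) (angleMeasure.prod μ) := by
  have hc := continuous_curvePoint r n a
  have hm : Measurable fun q : ℝ × ℂ => (curvePoint r n a q.1 - q.2)⁻¹ :=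
    ((hc.measurable.comp measurable_fst).sub measurable_snd).inv
  rw [integrable_prod_iff hm.aestronglyMeasurable]
  refine ⟨ae_of_all _ fun θ =>
    integrable_kernel_translate hC hG hμG locallyIntegrable_inv (curvePoint r n a θ), ?_⟩
  have hl : LocallyIntegrable (fun x : ℂ => ‖x⁻¹‖) := fun x => by
    obtain ⟨s, hs, hi⟩ := locallyIntegrable_inv x
    exact ⟨s, hs, hi.norm⟩
  have hk := continuous_integral_kernel_translate hC hG hμG hl continuousOn_inv_compl.norm
  exact integrable_angleMeasure_of_continuous (hk.comp hc)

/-- The Cauchy transform represents integration of holomorphic functions. -/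
theorem IsCurveDomain.contourIntegral_mul_cauchyTransform (h : IsCurveDomain r n a G)
    (hC : μ ≤ C • volume) (hμG : ∀ᵐ w ∂μ, w ∈ G) {f : ℂ → ℂ} (hf : DiffContOnCl ℂ f G) :
    contourIntegral r n a (fun z => f z * ∫ w, (z - w)⁻¹ ∂μ) =
      2 * π * Complex.I * ∫ z, f z ∂μ := by
  have hfc := hf.continuousOn.mono h.polyCurve_subset_closure
  have hW : Continuous fun θ => curveWeight r n a θ * f (curvePoint r n a θ) :=
    (continuous_curveWeight r n a).mul
      (hfc.comp_continuous (continuous_curvePoint r n a) (curvePoint_mem r n a))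
  have hint : Integrable (fun q : ℝ × ℂ => (curveWeight r n a q.1 * f (curvePoint r n a q.1)) *
      (curvePoint r n a q.1 - q.2)⁻¹) (angleMeasure.prod μ) := by
    obtain ⟨B, hB⟩ : ∃ B, ∀ θ, ‖curveWeight r n a θ * f (curvePoint r n a θ)‖ ≤ B := by
      have hc : ContinuousOn (fun w => 2 * π * Complex.I * (w * deriv (polyMap r n a) w) *
          f (polyMap r n a w)) (sphere 0 1) := by
        have h0 : sphere (0 : ℂ) 1 ⊆ {0}ᶜ := fun _ hw => ne_zero_of_mem_sphere hw
        refine (continuousOn_const.mul (continuousOn_id.mul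
          ((continuousOn_deriv_polyMap r n a).mono h0))).mul
          (hfc.comp ((continuousOn_polyMap r n a).mono h0) (mapsTo_image _ _))
      obtain ⟨B, hB⟩ := (isCompact_sphere (0 : ℂ) 1).exists_bound_of_continuousOn hc
      exact ⟨B, fun θ => hB _ (circleMap_zero_one_mem θ)⟩
    exact (integrable_prod_inv_curvePoint hC h.bounded hμG).bdd_mul
      (hW.comp continuous_fst).aestronglyMeasurable (ae_of_all _ fun q => hB q.1)
  rw [contourIntegral_eq_integral_angleMeasure, ← integral_const_mul]
  calc ∫ θ, curveWeight r n a θ * (f (curvePoint r n a θ) *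
        ∫ w, (curvePoint r n a θ - w)⁻¹ ∂μ) ∂angleMeasure
      = ∫ θ, ∫ w, (curveWeight r n a θ * f (curvePoint r n a θ)) *
          (curvePoint r n a θ - w)⁻¹ ∂μ ∂angleMeasure := by
        congr 1
        ext θ
        rw [integral_const_mul, mul_assoc]
    _ = ∫ w, ∫ θ, (curveWeight r n a θ * f (curvePoint r n a θ)) *
          (curvePoint r n a θ - w)⁻¹ ∂angleMeasure ∂μ := integral_integral_swap hint
    _ = ∫ w, 2 * π * Complex.I * f w ∂μ := by
        refine integral_congr_ae ?_
        filter_upwards [hμG] with w hw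
        rw [← h.cauchy_formula hf hw, contourIntegral_eq_integral_angleMeasure]
        congr 1
        ext θ
        ring

/-- Quadrature identity for a measure whose Cauchy transform is `(z̄ - p' z) / t₀` on the curve. -/
theorem IsCurveDomain.integral_eq_contourIntegral (h : IsCurveDomain r n a G)
    (hC : μ ≤ C • volume) (hμG : ∀ᵐ w ∂μ, w ∈ G) {t₀ : ℝ} (ht₀ : t₀ ≠ 0) {p : Polynomial ℂ}
    (hT : ∀ z ∈ polyCurve r n a, ∫ w, (z - w)⁻¹ ∂μ = (conj z - p.derivative.eval z) / t₀)
    {S : ℂ → ℂ} (hS : ∀ z ∈ polyCurve r n a, S z = conj z) {f : ℂ → ℂ}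
    (hf : DiffContOnCl ℂ f G) :
    ∫ z, f z ∂μ =
      1 / (2 * π * Complex.I * t₀) * contourIntegral r n a (fun z => f z * S z) := by
  have ht : (t₀ : ℂ) ≠ 0 := Complex.ofReal_ne_zero.2 ht₀
  have hfc := hf.continuousOn.mono h.polyCurve_subset_closure
  have h1 := h.contourIntegral_mul_cauchyTransform hC hμG hf
  have hp : DiffContOnCl ℂ (fun z => p.derivative.eval z * f z) G :=
    p.derivative.differentiable.diffContOnCl.smul hf
  have hTc : ContinuousOn (fun z => ∫ w, (z - w)⁻¹ ∂μ) (polyCurve r n a) :=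
    (continuous_integral_kernel_translate hC h.bounded hμG locallyIntegrable_inv
      continuousOn_inv_compl).continuousOn
  -- On γ, S equals t₀ times the Cauchy transform plus p', and f p' integrates to zero by Cauchy's
  -- theorem.
  have h2 : contourIntegral r n a (fun z => f z * S z) =
      t₀ * contourIntegral r n a (fun z => f z * ∫ w, (z - w)⁻¹ ∂μ) := by
    have h3 := contourIntegral_add (f := fun z => t₀ * (f z * ∫ w, (z - w)⁻¹ ∂μ))
      (continuousOn_const.mul (hfc.mul hTc)) (hp.continuousOn.mono h.polyCurve_subset_closure)
    rw [h.cauchy_theorem hp, add_zero, contourIntegral_const_mul] at h3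
    rw [← h3]
    refine contourIntegral_congr fun z hz => ?_
    rw [hT z hz, hS z hz]
    field_simp
    ring
  have hπ : (π : ℂ) ≠ 0 := by exact_mod_cast Real.pi_ne_zero
  rw [h2, h1]
  field_simp

/-- The interior of the support of an absolutely continuous measure bounded by the curve. -/
theorem isCurveDomain_interior_support {μ : Measure ℂ} [IsProbabilityMeasure μ]
    (hC : μ ≤ C • volume) (hγ : IsSimpleAnalytic r n a)
    (hb : Bornology.IsBounded μ.support) (hγD : frontier μ.support = polyCurve r n a)
    (hor : PositivelyOrientedAround r n a (interior μ.support)) :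
    IsCurveDomain r n a (interior μ.support) ∧ ∀ᵐ w ∂μ, w ∈ interior μ.support := by
  have hγ0 : μ (polyCurve r n a) = 0 := by
    refine le_antisymm ((hC _).trans ?_) zero_le
    simp [volume_polyCurve]
  have hcl : IsClosed μ.support := Measure.isClosed_support
  have hae : ∀ᵐ w ∂μ, w ∈ interior μ.support := by
    have h1 : ∀ᵐ w ∂μ, w ∈ μ.support := Measure.measure_compl_support
    have h2 : ∀ᵐ w ∂μ, w ∉ polyCurve r n a := measure_eq_zero_iff_ae_notMem.1 hγ0
    filter_upwards [h1, h2] with w hw1 hw2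
    by_contra hw
    exact hw2 (hγD ▸ ⟨subset_closure hw1, hw⟩)
  -- The interior carries all the mass, so its closure already contains the support; hence the
  -- interior has the same frontier as D.
  have hclos : closure (interior μ.support) = μ.support := by
    refine subset_antisymm hcl.closure_interior_subset ?_
    refine Measure.support_subset_of_isClosed isClosed_closure ?_
    filter_upwards [hae] with w hw using subset_closure hw
  refine ⟨⟨hγ, isOpen_interior, ?_, hb.subset interior_subset, ?_, hor⟩, hae⟩
  · obtain ⟨w, hw⟩ := hae.exists
    exact ⟨w, hw⟩
  · rw [isOpen_interior.frontier_eq, hclos, ← hγD, hcl.frontier_eq]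

end

/-! ### Logarithmic potentials on the curve -/

section

variable {r : ℝ} {n : ℕ} {a : ℕ → ℂ} {G : Set ℂ}

lemma ae_curvePoint_ne (hr : 0 < r) (z : ℂ) : ∀ᵐ θ ∂angleMeasure, curvePoint r n a θ ≠ z := by
  obtain ⟨c, hc⟩ := exists_factorization (a := a) (n := n) hr.ne' z
  have h1 : ∀ᵐ θ ∂angleMeasure, ∀ i, circleMap 0 1 θ ≠ c i :=
    ae_all_iff.2 fun i => ae_circleMap_ne 0 (c i) one_pos
  filter_upwards [h1] with θ hθ h
  have he := ne_zero_of_mem_sphere (circleMap_zero_one_mem θ)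
  have h2 := hc _ he
  rw [← curvePoint, sub_eq_zero.2 h, eq_comm] at h2
  refine mul_ne_zero (mul_ne_zero (Complex.ofReal_ne_zero.2 hr.ne')
    (inv_ne_zero (pow_ne_zero n he))) (Finset.prod_ne_zero_iff.2 fun i _ => ?_) h2
  exact sub_ne_zero.2 (hθ i)

lemma log_norm_curvePoint_sub (hr : 0 < r) {z : ℂ} {c : Fin (n + 1) → ℂ}
    (hc : ∀ w ≠ 0, polyMap r n a w - z = r * (w ^ n)⁻¹ * ∏ i, (w - c i)) :
    ∀ᵐ θ ∂angleMeasure, Real.log ‖curvePoint r n a θ - z‖ =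
      Real.log r + ∑ i, Real.log ‖circleMap 0 1 θ - c i‖ := by
  have h1 : ∀ᵐ θ ∂angleMeasure, ∀ i, circleMap 0 1 θ ≠ c i :=
    ae_all_iff.2 fun i => ae_circleMap_ne 0 (c i) one_pos
  filter_upwards [h1] with θ hθ
  have hne : ∀ i ∈ Finset.univ, ‖circleMap 0 1 θ - c i‖ ≠ 0 := fun i _ =>
    norm_ne_zero_iff.2 (sub_ne_zero.2 (hθ i))
  rw [curvePoint, hc _ (ne_zero_of_mem_sphere (circleMap_zero_one_mem θ)), norm_mul, norm_mul,
    norm_prod, norm_inv, norm_pow, norm_circleMap_zero_one, one_pow, inv_one, mul_one,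
    Complex.norm_real, Real.norm_of_nonneg hr.le,
    Real.log_mul hr.ne' (Finset.prod_ne_zero_iff.2 hne), Real.log_prod hne]

lemma IsCurveDomain.integrable_log (h : IsCurveDomain r n a G) (z : ℂ) :
    Integrable (fun θ => Real.log ‖curvePoint r n a θ - z‖) angleMeasure := by
  obtain ⟨c, hc⟩ := exists_factorization (a := a) (n := n) h.analytic.r_pos.ne' z
  refine Integrable.congr ?_ ((log_norm_curvePoint_sub h.analytic.r_pos hc).mono
    fun _ hθ => hθ.symm)
  exact (integrable_const _).add
    (integrable_finsetSum _ fun i _ => integrable_log_circleMap 0 (c i) 1)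

/-- All roots of h - z lie in the closed disc, where the mean of log|e - c| over the circle is log
max(1,|c|) = 0. So the image of the angle measure has constant potential -log r on the closed
domain. -/
lemma IsCurveDomain.integral_log (h : IsCurveDomain r n a G) {z : ℂ} (hz : z ∈ closure G) :
    ∫ θ, Real.log ‖curvePoint r n a θ - z‖ ∂angleMeasure = Real.log r := by
  obtain ⟨c, hc⟩ := exists_factorization (a := a) (n := n) h.analytic.r_pos.ne' z
  rw [integral_congr_ae (log_norm_curvePoint_sub h.analytic.r_pos hc),
    integral_add (integrable_const _)
      (integrable_finsetSum _ fun i _ => integrable_log_circleMap 0 (c i) 1),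
    integral_finsetSum _ fun i _ => integrable_log_circleMap 0 (c i) 1]
  have h1 : ∀ i, ∫ θ, Real.log ‖circleMap 0 1 θ - c i‖ ∂angleMeasure = 0 := fun i => by
    rw [integral_log_circleMap 0 (c i) one_pos, zero_sub, norm_neg,
      max_eq_left (h.norm_root_le_one hz hc i), Real.log_one]
  simp [h1]

lemma IsCurveDomain.integrable_log_prod (h : IsCurveDomain r n a G) {τ : Measure ℂ}
    [IsFiniteMeasure τ] (hτ : ∀ᵐ z ∂τ, z ∈ closure G) :
    Integrable (fun q : ℝ × ℂ => Real.log ‖curvePoint r n a q.1 - q.2‖)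
      (angleMeasure.prod τ) := by
  obtain ⟨R, hR⟩ := exists_norm_sub_le h.bounded.closure
  refine integrable_log_norm_sub_prod angleMeasure (continuous_curvePoint r n a).measurable τ
    (R := R) (M := -Real.log r) ?_ (ae_of_all _ h.integrable_log) ?_
  · filter_upwards [hτ] with z hz
    exact ae_of_all _ fun θ => hR _ (h.polyCurve_subset_closure (curvePoint_mem r n a θ)) _ hz
  · filter_upwards [hτ] with z hz
    rw [h.integral_log hz, neg_neg]

lemma exists_norm_weight_le {b : ℂ} (hb : ‖b‖ < 1) :
    ∃ B, ∀ θ, ‖circleMap 0 1 θ / (circleMap 0 1 θ - b) ^ 2‖ ≤ B := by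
  have hcon : ContinuousOn (fun w : ℂ => w / (w - b) ^ 2) (sphere 0 1) :=
    continuousOn_id.div (by fun_prop) fun w hw =>
      pow_ne_zero 2 (sub_ne_zero_of_norm_lt_one hb (by simpa using hw))
  obtain ⟨B, hB⟩ := (isCompact_sphere (0 : ℂ) 1).exists_bound_of_continuousOn hcon
  exact ⟨B, fun θ => hB _ (circleMap_zero_one_mem θ)⟩

/-- The logarithmic derivative of `h - z` outside the unit disc, in terms of `log |h - z|` on the
circle. -/
lemma IsCurveDomain.conj_deriv_div (h : IsCurveDomain r n a G) {z : ℂ} (hz : z ∈ closure G)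
    {v b : ℂ} (hv : 1 < ‖v‖) (hb : b = (conj v)⁻¹) :
    conj (deriv (polyMap r n a) v / (polyMap r n a v - z)) =
      b - 2 * b ^ 2 * ∫ θ, circleMap 0 1 θ / (circleMap 0 1 θ - b) ^ 2 *
        (Real.log ‖curvePoint r n a θ - z‖ : ℂ) ∂angleMeasure := by
  have hr := h.analytic.r_pos
  obtain ⟨c, hc⟩ := exists_factorization (a := a) (n := n) hr.ne' z
  have hci := h.norm_root_le_one hz hc
  have hv0 : v ≠ 0 := by rintro rfl; simp at hv; linarith
  have hvc : ∀ i, v - c i ≠ 0 := fun i h0 => by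
    have := hci i
    rw [← sub_eq_zero.1 h0] at this
    linarith
  have hb1 : ‖b‖ < 1 := by
    rw [hb, norm_inv, Complex.norm_conj]
    exact inv_lt_one_of_one_lt₀ hv
  have hcb0 : conj v ≠ 0 := by simpa using hv0
  have hi : ∀ i, Integrable (fun θ => circleMap 0 1 θ / (circleMap 0 1 θ - b) ^ 2 *
      (Real.log ‖circleMap 0 1 θ - c i‖ : ℂ)) angleMeasure := by
    intro i
    obtain ⟨B, hB⟩ := exists_norm_weight_le hb1
    exact (integrable_log_circleMap 0 (c i) 1).ofReal.bdd_mul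
      (continuous_weight hb1).aestronglyMeasurable (ae_of_all _ hB)
  have hw0 : ∫ θ, circleMap 0 1 θ / (circleMap 0 1 θ - b) ^ 2 * (Real.log r : ℂ)
      ∂angleMeasure = 0 := by
    have := integral_weight_mul_re (G := fun _ => (Real.log r : ℂ)) one_lt_two
      (differentiableOn_const _) hb1
    simpa using this
  have hint : ∫ θ, circleMap 0 1 θ / (circleMap 0 1 θ - b) ^ 2 *
      (Real.log ‖curvePoint r n a θ - z‖ : ℂ) ∂angleMeasure =
      ∑ i, -conj (c i) / (2 * (1 - conj (c i) * b)) := by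
    calc _ = ∫ θ, (circleMap 0 1 θ / (circleMap 0 1 θ - b) ^ 2 * (Real.log r : ℂ) +
          ∑ i, circleMap 0 1 θ / (circleMap 0 1 θ - b) ^ 2 *
            (Real.log ‖circleMap 0 1 θ - c i‖ : ℂ)) ∂angleMeasure := by
          refine integral_congr_ae ?_
          filter_upwards [log_norm_curvePoint_sub hr hc] with θ hθ
          rw [hθ, ← Finset.mul_sum, ← mul_add]
          push_cast
          rfl
      _ = _ := by
          have hi0 : Integrable (fun θ => circleMap 0 1 θ / (circleMap 0 1 θ - b) ^ 2 *
              (Real.log r : ℂ)) angleMeasure :=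
            integrable_angleMeasure_of_continuous ((continuous_weight hb1).mul continuous_const)
          rw [integral_add hi0
            (integrable_finsetSum _ fun i _ => hi i), integral_finsetSum _ fun i _ => hi i, hw0,
            zero_add]
          exact Finset.sum_congr rfl fun i _ => integral_weight_mul_log (hci i) hb1
  rw [hint, deriv_polyMap_div hr.ne' hc hv0 fun i => sub_ne_zero.1 (hvc i), map_add, map_sum,
    Finset.mul_sum]
  -- With b = 1/v̄ this is 1/(v̄ - c̄) = b + b²c̄/(1 - c̄b). In the sum, the n + 1 terms b and the
  -- term -nb from the factor w⁻ⁿ leave a single b.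
  have hterm : ∀ i, conj ((v - c i)⁻¹) =
      b - 2 * b ^ 2 * (-conj (c i) / (2 * (1 - conj (c i) * b))) := by
    intro i
    have h1 : conj v - conj (c i) ≠ 0 := by
      rw [← map_sub]
      exact (map_ne_zero _).2 (hvc i)
    have h2 : 1 - conj (c i) * b = b * (conj v - conj (c i)) := by
      rw [mul_sub, hb, inv_mul_cancel₀ hcb0]
      ring
    rw [h2, map_inv₀, map_sub, hb]
    field_simp
    ring
  rw [Finset.sum_congr rfl fun i _ => hterm i, Finset.sum_sub_distrib]
  simp only [Finset.sum_const, Finset.card_univ, Fintype.card_fin, nsmul_eq_mul, map_div₀,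
    map_neg, map_natCast]
  rw [div_eq_mul_inv, ← hb]
  push_cast
  ring

/-- Measures on the closed domain with the same potential on the curve have the same Cauchy
transform outside. -/
lemma IsCurveDomain.integral_deriv_div_eq (h : IsCurveDomain r n a G) {τ₁ τ₂ : Measure ℂ}
    [IsProbabilityMeasure τ₁] [IsProbabilityMeasure τ₂] (h₁ : ∀ᵐ z ∂τ₁, z ∈ closure G)
    (h₂ : ∀ᵐ z ∂τ₂, z ∈ closure G)
    (heq : ∀ᵐ θ ∂angleMeasure, ∫ z, Real.log ‖curvePoint r n a θ - z‖ ∂τ₁ =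
      ∫ z, Real.log ‖curvePoint r n a θ - z‖ ∂τ₂) {v : ℂ} (hv : 1 < ‖v‖) :
    ∫ z, deriv (polyMap r n a) v / (polyMap r n a v - z) ∂τ₁ =
      ∫ z, deriv (polyMap r n a) v / (polyMap r n a v - z) ∂τ₂ := by
  set b := (conj v)⁻¹ with hb
  have hb1 : ‖b‖ < 1 := by
    rw [hb, norm_inv, Complex.norm_conj]
    exact inv_lt_one_of_one_lt₀ hv
  -- Integrating `IsCurveDomain.conj_deriv_div` in z leaves on the right only the potential of τ
  -- along the curve; the term b keeps coefficient one because τ has mass one.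
  have key : ∀ (τ : Measure ℂ) [IsProbabilityMeasure τ], (∀ᵐ z ∂τ, z ∈ closure G) →
      conj (∫ z, deriv (polyMap r n a) v / (polyMap r n a v - z) ∂τ) =
        b - 2 * b ^ 2 * ∫ θ, circleMap 0 1 θ / (circleMap 0 1 θ - b) ^ 2 *
          ((∫ z, Real.log ‖curvePoint r n a θ - z‖ ∂τ : ℝ) : ℂ) ∂angleMeasure := by
    intro τ _ hτ
    have hint : Integrable (fun q : ℝ × ℂ => circleMap 0 1 q.1 / (circleMap 0 1 q.1 - b) ^ 2 *
        (Real.log ‖curvePoint r n a q.1 - q.2‖ : ℂ)) (angleMeasure.prod τ) := by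
      obtain ⟨B, hB⟩ := exists_norm_weight_le hb1
      exact (h.integrable_log_prod hτ).ofReal.bdd_mul
        ((continuous_weight hb1).comp continuous_fst).aestronglyMeasurable
        (ae_of_all _ fun q => hB q.1)
    rw [← integral_conj, integral_congr_ae (hτ.mono fun z hz => h.conj_deriv_div hz hv hb),
      integral_sub (integrable_const b) (hint.integral_prod_right.const_mul _), integral_const,
      integral_const_mul, ← integral_integral_swap hint]
    simp only [probReal_univ, one_smul, integral_const_mul, integral_complex_ofReal]
  refine (starRingEnd ℂ).injective ?_
  rw [key τ₁ h₁, key τ₂ h₂]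
  congr 2
  refine integral_congr_ae ?_
  filter_upwards [heq] with θ hθ
  rw [hθ]

/-! ### Arc length -/

/-- Jordan's inequality: sin s ≥ 2s/π on [0, π/2], at half the angle. -/
lemma abs_sub_le_norm_circleMap_sub {x y : ℝ} (h : |x - y| ≤ π) :
    |x - y| ≤ π / 2 * ‖circleMap 0 1 x - circleMap 0 1 y‖ := by
  have h1 : ‖circleMap 0 1 x - circleMap 0 1 y‖ = 2 * |Real.sin ((x - y) / 2)| := by
    have : circleMap 0 1 x - circleMap 0 1 y =
        circleMap 0 1 y * (Complex.exp (Complex.I * ((x - y : ℝ) : ℂ)) - 1) := by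
      simp only [circleMap, zero_add, Complex.ofReal_one, one_mul]
      rw [mul_sub, ← Complex.exp_add, mul_one]
      congr 2
      push_cast
      ring
    rw [this, norm_mul, norm_circleMap_zero_one, one_mul,
      Complex.norm_exp_I_mul_ofReal_sub_one, norm_mul, Real.norm_eq_abs, Real.norm_eq_abs, abs_two]
  have h2 : 2 / π * (|x - y| / 2) ≤ |Real.sin ((x - y) / 2)| := by
    refine (Real.mul_le_sin (by positivity) (by linarith)).trans ?_
    rcases abs_cases (x - y) with ⟨h3, -⟩ | ⟨h3, -⟩
    · rw [h3]; exact le_abs_self _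
    · rw [h3, neg_div, Real.sin_neg]; exact neg_le_abs _
  rw [h1]
  calc |x - y| = π * (2 / π * (|x - y| / 2)) := by field_simp
    _ ≤ π * |Real.sin ((x - y) / 2)| := by gcongr
    _ = _ := by ring

/-- The inverse of `slopeMap` is bounded on the compact torus, so chords of the circle are
controlled by chords of γ. -/
lemma IsSimpleAnalytic.exists_abs_sub_le (hγ : IsSimpleAnalytic r n a) :
    ∃ K : NNReal, ∀ x y, |x - y| ≤ π →
      |x - y| ≤ K * ‖curvePoint r n a x - curvePoint r n a y‖ := by
  have hcon : ContinuousOn (fun q : ℂ × ℂ => (slopeMap r n a q.1 q.2)⁻¹)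
      (sphere 0 1 ×ˢ sphere 0 1) :=
    ((continuousOn_slopeMap r n a).mono fun q hq =>
      ⟨ne_zero_of_mem_sphere hq.1, ne_zero_of_mem_sphere hq.2⟩).inv₀
        fun q hq => hγ.slopeMap_ne_zero hq.1 hq.2
  obtain ⟨B, hB⟩ := ((isCompact_sphere (0 : ℂ) 1).prod
    (isCompact_sphere (0 : ℂ) 1)).exists_bound_of_continuousOn hcon
  have hB0 : 0 ≤ B := (norm_nonneg _).trans
    (hB (circleMap 0 1 0, circleMap 0 1 0) ⟨circleMap_zero_one_mem 0, circleMap_zero_one_mem 0⟩)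
  refine ⟨(π / 2 * B).toNNReal, fun x y h => ?_⟩
  have hx := circleMap_zero_one_mem x
  have hy := circleMap_zero_one_mem y
  have hQ := hγ.slopeMap_ne_zero hx hy
  have h1 : circleMap 0 1 x - circleMap 0 1 y = (curvePoint r n a x - curvePoint r n a y) *
      (slopeMap r n a (circleMap 0 1 x) (circleMap 0 1 y))⁻¹ := by
    rw [curvePoint, curvePoint, polyMap_sub r n a (ne_zero_of_mem_sphere hx)
      (ne_zero_of_mem_sphere hy), mul_inv_cancel_right₀ hQ]
  calc |x - y| ≤ π / 2 * ‖circleMap 0 1 x - circleMap 0 1 y‖ := abs_sub_le_norm_circleMap_sub h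
    _ ≤ π / 2 * (‖curvePoint r n a x - curvePoint r n a y‖ * B) := by
        rw [h1, norm_mul]
        gcongr
        exact hB (_, _) ⟨hx, hy⟩
    _ = _ := by
        rw [Real.coe_toNNReal _ (by positivity)]
        ring

/-- A property holding almost everywhere on the curve for arc length holds for almost every
angle. -/
lemma IsSimpleAnalytic.ae_curvePoint (hγ : IsSimpleAnalytic r n a) {P : ℂ → Prop}
    (hP : ∀ᵐ z ∂((μH[1] : Measure ℂ).restrict (polyCurve r n a)), P z) :
    ∀ᵐ θ ∂angleMeasure, P (curvePoint r n a θ) := by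
  obtain ⟨K, hK⟩ := hγ.exists_abs_sub_le
  set N : Set ℂ := {z | z ∈ polyCurve r n a ∧ ¬P z} with hN
  have hN0 : μH[1] N = 0 := by
    rw [ae_restrict_iff' (isCompact_polyCurve r n a).measurableSet, ae_iff] at hP
    simpa [hN] using hP
  -- On angles at mutual distance at most π the parametrization has a Lipschitz inverse, which
  -- preserves sets of zero one-dimensional Hausdorff measure, and on the line that measure is
  -- Lebesgue measure. Two half turns then cover the period.
  have key : ∀ A : Set ℝ, (∀ x ∈ A, ∀ y ∈ A, |x - y| ≤ π) →
      volume {θ | θ ∈ A ∧ ¬P (curvePoint r n a θ)} = 0 := by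
    intro A hA
    set T : Set ℝ := {θ | θ ∈ A ∧ ¬P (curvePoint r n a θ)} with hT
    have hdist : ∀ x ∈ T, ∀ y ∈ T, dist x y ≤ K * dist (curvePoint r n a x) (curvePoint r n a y) :=
      fun x hx y hy => by
        rw [Real.dist_eq, dist_eq_norm]
        exact hK x y (hA x hx.1 y hy.1)
    have hinj : InjOn (curvePoint r n a) T := fun x hx y hy hxy => by
      have := hdist x hx y hy
      rw [hxy, dist_self, mul_zero] at this
      exact dist_le_zero.1 this
    set g := Function.invFunOn (curvePoint r n a) T with hg
    have hgc : ∀ x ∈ T, g (curvePoint r n a x) = x := fun x hx => hinj.leftInvOn_invFunOn hx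
    have hlip : LipschitzOnWith K g (curvePoint r n a '' T) := by
      refine LipschitzOnWith.of_dist_le_mul ?_
      rintro _ ⟨x, hx, rfl⟩ _ ⟨y, hy, rfl⟩
      rw [hgc x hx, hgc y hy]
      exact hdist x hx y hy
    have himg : g '' (curvePoint r n a '' T) = T := by
      rw [image_image]
      exact (image_congr hgc).trans (image_id' T)
    have h1 := hlip.hausdorffMeasure_image_le zero_le_one
    have h2 : μH[1] (curvePoint r n a '' T) = 0 := by
      refine measure_mono_null ?_ hN0
      rintro _ ⟨x, hx, rfl⟩
      exact ⟨curvePoint_mem r n a x, hx.2⟩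
    rw [himg, h2, mul_zero, hausdorffMeasure_real] at h1
    exact le_antisymm h1 zero_le
  have h1 := key (Icc 0 π) fun x hx y hy => abs_sub_le_iff.2
    ⟨by linarith [hx.2, hy.1], by linarith [hy.2, hx.1]⟩
  have h2 := key (Icc π (2 * π)) fun x hx y hy => abs_sub_le_iff.2
    ⟨by linarith [hx.2, hy.1], by linarith [hy.2, hx.1]⟩
  rw [angleMeasure]
  refine Measure.ae_smul_measure ?_ _
  rw [ae_restrict_iff' measurableSet_Ioc, ae_iff]
  refine measure_mono_null ?_ (measure_union_null h1 h2)
  intro θ hθ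
  rw [mem_ofPred_eq, Classical.not_imp] at hθ
  rcases le_total θ π with h | h
  · exact Or.inl ⟨⟨hθ.1.1.le, h⟩, hθ.2⟩
  · exact Or.inr ⟨⟨h, hθ.1.2⟩, hθ.2⟩

/-- Equality of the potentials on the curve, in terms of integrals. -/
lemma IsCurveDomain.ae_integral_log_eq (h : IsCurveDomain r n a G) {τ₁ τ₂ : Measure ℂ}
    [IsFiniteMeasure τ₁] [IsFiniteMeasure τ₂] (h₁ : ∀ᵐ z ∂τ₁, z ∈ closure G)
    (h₂ : ∀ᵐ z ∂τ₂, z ∈ closure G)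
    (heq : ∀ᵐ z ∂((μH[1] : Measure ℂ).restrict (polyCurve r n a)),
      logPotential τ₁ z = logPotential τ₂ z) :
    ∀ᵐ θ ∂angleMeasure, ∫ z, Real.log ‖curvePoint r n a θ - z‖ ∂τ₁ =
      ∫ z, Real.log ‖curvePoint r n a θ - z‖ ∂τ₂ := by
  -- At an atom the potential can be infinite while the real integral, with `Real.log 0 = 0`, does
  -- not see the atom. By Fubini almost no angle meets one, since each point of the plane is hit
  -- only by a null set of angles.
  have hatom : ∀ (τ : Measure ℂ) [IsFiniteMeasure τ],
      ∀ᵐ θ ∂angleMeasure, τ {curvePoint r n a θ} = 0 := by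
    intro τ _
    have hm : MeasurableSet {q : ℝ × ℂ | curvePoint r n a q.1 ≠ q.2} :=
      (isOpen_ne_fun ((continuous_curvePoint r n a).comp continuous_fst)
        continuous_snd).measurableSet
    have := (Measure.ae_ae_comm (μ := angleMeasure) (ν := τ) hm).2
      (ae_of_all _ fun z => ae_curvePoint_ne h.analytic.r_pos z)
    filter_upwards [this] with θ hθ
    rw [ae_iff] at hθ
    simpa [eq_comm] using hθ
  filter_upwards [h.analytic.ae_curvePoint heq, hatom τ₁, hatom τ₂,
    (h.integrable_log_prod h₁).prod_right_ae, (h.integrable_log_prod h₂).prod_right_ae]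
    with θ hθ ha1 ha2 hi1 hi2
  rw [logPotential_eq_coe ha1 hi1, logPotential_eq_coe ha2 hi2, EReal.coe_eq_coe_iff] at hθ
  exact neg_injective hθ

end

/-! ### Approximation by functions holomorphic across the curve -/

lemma eventually_norm_le_of_eq_zero {X : Type*} [PseudoMetricSpace X] {K : Set X}
    (hK : IsCompact K) {F : ℝ → X → ℂ} {s₀ s₁ : ℝ} (hs : s₀ < s₁)
    (hF : ContinuousOn (fun q : ℝ × X => F q.1 q.2) (Icc s₀ s₁ ×ˢ K))
    (h0 : ∀ x ∈ K, F s₀ x = 0) {ε : ℝ} (hε : 0 < ε) :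
    ∀ᶠ s in 𝓝[>] s₀, ∀ x ∈ K, ‖F s x‖ ≤ ε := by
  obtain ⟨η, hη, hF'⟩ := Metric.uniformContinuousOn_iff.1
    ((isCompact_Icc.prod hK).uniformContinuousOn_of_continuous hF) ε hε
  filter_upwards [Ioo_mem_nhdsGT (lt_min hs (lt_add_of_pos_right s₀ hη))] with s hs' x hx
  have h1 : s < s₁ := hs'.2.trans_le (min_le_left _ _)
  have h2 : s < s₀ + η := hs'.2.trans_le (min_le_right _ _)
  have h3 := hF' (s, x) ⟨⟨hs'.1.le, h1.le⟩, hx⟩ (s₀, x) ⟨⟨le_rfl, hs.le⟩, hx⟩ (by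
    rw [Prod.dist_eq, dist_self, Real.dist_eq, abs_of_pos (sub_pos.2 hs'.1)]
    exact max_lt (by linarith) hη)
  simp only [h0 x hx, dist_zero_right] at h3
  exact h3.le

section

variable {r : ℝ} {n : ℕ} {a : ℕ → ℂ} {G : Set ℂ}

/-- Isolates the singular part of the pulled-back Cauchy kernel; the second term is continuous on
pairs of points of the collar, diagonal included. -/
lemma deriv_polyMap_div_sub {w u : ℂ} (hw : w ≠ 0) (hu : u ≠ 0) (hwu : w ≠ u)
    (hQ : slopeMap r n a w u ≠ 0) :
    deriv (polyMap r n a) w / (polyMap r n a w - polyMap r n a u) =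
      (w - u)⁻¹ + slopeMap₂ n a w u / slopeMap r n a w u := by
  have h1 := slopeMap_self_sub r n a hw hu
  have h2 := sub_ne_zero.2 hwu
  rw [deriv_polyMap r n a hw, polyMap_sub r n a hw hu, sub_eq_iff_eq_add.1 h1]
  field_simp
  ring

variable (r n a) in
/-- The Cauchy integral of `f` with the kernel of the slightly larger curve `h (|w| = t)`. -/
def cauchyApprox (f : ℂ → ℂ) (t : ℝ) (z : ℂ) : ℂ :=
  (2 * π * Complex.I : ℂ)⁻¹ * ∮ w in C(0, 1),
    f (polyMap r n a w) * (t * deriv (polyMap r n a) (t * w)) / (polyMap r n a (t * w) - z)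

lemma ofReal_mul_mem_compl {t : ℝ} (ht : 0 < t) {w : ℂ} (hw : w ∈ sphere (0 : ℂ) 1) :
    (t : ℂ) * w ∈ ({0}ᶜ : Set ℂ) :=
  mul_ne_zero (Complex.ofReal_ne_zero.2 ht.ne') (ne_zero_of_mem_sphere hw)

lemma norm_ofReal_mul {t : ℝ} (ht : 0 < t) {w : ℂ} (hw : w ∈ sphere (0 : ℂ) 1) :
    ‖(t : ℂ) * w‖ = t := by
  rw [norm_mul, mem_sphere_zero_iff_norm.1 hw, mul_one, Complex.norm_real,
    Real.norm_of_nonneg ht.le]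

lemma IsCurveDomain.continuousOn_comp (h : IsCurveDomain r n a G) {f : ℂ → ℂ}
    (hf : ContinuousOn f (closure G)) : ContinuousOn (fun w => f (polyMap r n a w)) (sphere 0 1) :=
  hf.comp ((continuousOn_polyMap r n a).mono fun _ hw => ne_zero_of_mem_sphere hw)
    fun _ hw => h.polyMap_mem_closure hw

lemma continuousOn_comp_mul {g : ℂ → ℂ} (hg : ContinuousOn g {0}ᶜ) {t : ℝ} (ht : 0 < t) :
    ContinuousOn (fun w : ℂ => g (t * w)) (sphere 0 1) :=
  hg.comp (by fun_prop) fun _ hw => ofReal_mul_mem_compl ht hw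

lemma IsCurveDomain.polyMap_mul_notMem (h : IsCurveDomain r n a G) {t : ℝ} (ht : 1 < t) {w : ℂ}
    (hw : w ∈ sphere (0 : ℂ) 1) : polyMap r n a (t * w) ∉ closure G :=
  h.polyMap_notMem_closure (by rwa [norm_ofReal_mul (by linarith) hw])

/-- For t > 1 the curve h(|w| = t) misses the closed domain, so the approximant is differentiable at
every point of it although f is only continuous there. -/
lemma IsCurveDomain.diffContOnCl_cauchyApprox (h : IsCurveDomain r n a G) {f : ℂ → ℂ}
    (hf : ContinuousOn f (closure G)) {t : ℝ} (ht : 1 < t) :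
    DiffContOnCl ℂ (cauchyApprox r n a f t) G := by
  have ht0 : 0 < t := by linarith
  refine DifferentiableOn.diffContOnCl fun z hz => DifferentiableAt.differentiableWithinAt ?_
  refine DifferentiableAt.const_mul ?_ _
  refine differentiableAt_cauchyIntegral zero_le_one
    ((h.continuousOn_comp hf).mul (continuousOn_const.mul
      (continuousOn_comp_mul (continuousOn_deriv_polyMap r n a) ht0)))
    (continuousOn_comp_mul (continuousOn_polyMap r n a) ht0) ?_
  rintro ⟨w, hw, rfl⟩
  exact h.polyMap_mul_notMem ht hw hz

/-- By Fubini, τ enters only through its Cauchy transform at the exterior points h(te), which its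
potential on γ determines. -/
lemma IsCurveDomain.integral_cauchyApprox (h : IsCurveDomain r n a G) {f : ℂ → ℂ}
    (hf : ContinuousOn f (closure G)) {t : ℝ} (ht : 1 < t) {τ : Measure ℂ} [IsFiniteMeasure τ]
    (hτ : ∀ᵐ z ∂τ, z ∈ closure G) :
    ∫ z, cauchyApprox r n a f t z ∂τ =
      ∫ θ, circleMap 0 1 θ * f (curvePoint r n a θ) * t *
        ∫ z, deriv (polyMap r n a) (t * circleMap 0 1 θ) /
          (polyMap r n a (t * circleMap 0 1 θ) - z) ∂τ ∂angleMeasure := by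
  have ht0 : 0 < t := by linarith
  have h0 : sphere (0 : ℂ) 1 ⊆ {0}ᶜ := fun _ hw => ne_zero_of_mem_sphere hw
  set A : ℂ → ℂ := fun w => w * f (polyMap r n a w) * t with hA
  have hAc : ContinuousOn A (sphere 0 1) :=
    (continuousOn_id.mul (h.continuousOn_comp hf)).mul continuousOn_const
  have hHc := continuousOn_comp_mul (continuousOn_polyMap r n a) ht0
  have hDc := continuousOn_comp_mul (continuousOn_deriv_polyMap r n a) ht0
  have hint : Integrable (fun q : ℝ × ℂ => A (circleMap 0 1 q.1) *
      (deriv (polyMap r n a) (t * circleMap 0 1 q.1) /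
        (polyMap r n a (t * circleMap 0 1 q.1) - q.2))) (angleMeasure.prod τ) := by
    have hm : Measurable (fun q : ℝ × ℂ => A (circleMap 0 1 q.1) *
        (deriv (polyMap r n a) (t * circleMap 0 1 q.1) /
          (polyMap r n a (t * circleMap 0 1 q.1) - q.2))) := by
      have h1 : Measurable fun θ => A (circleMap 0 1 θ) :=
        (hAc.comp_continuous (continuous_circleMap 0 1) circleMap_zero_one_mem).measurable
      have h2 : Measurable fun θ => polyMap r n a (t * circleMap 0 1 θ) :=
        (hHc.comp_continuous (continuous_circleMap 0 1) circleMap_zero_one_mem).measurable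
      have h3 : Measurable fun θ => deriv (polyMap r n a) (t * circleMap 0 1 θ) :=
        (hDc.comp_continuous (continuous_circleMap 0 1) circleMap_zero_one_mem).measurable
      exact (h1.comp measurable_fst).mul
        ((h3.comp measurable_fst).div ((h2.comp measurable_fst).sub measurable_snd))
    have hcon : ContinuousOn (fun q : ℂ × ℂ => A q.1 *
        (deriv (polyMap r n a) (t * q.1) / (polyMap r n a (t * q.1) - q.2)))
        (sphere 0 1 ×ˢ closure G) := by
      have hfst : MapsTo Prod.fst (sphere (0 : ℂ) 1 ×ˢ closure G) (sphere 0 1) := fun q hq => hq.1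
      refine (hAc.comp continuousOn_fst hfst).mul ((hDc.comp continuousOn_fst hfst).div
        ((hHc.comp continuousOn_fst hfst).sub continuousOn_snd) fun q hq h' => ?_)
      exact h.polyMap_mul_notMem ht hq.1 (sub_eq_zero.1 h' ▸ hq.2)
    obtain ⟨B, hB⟩ := ((isCompact_sphere (0 : ℂ) 1).prod
      h.bounded.isCompact_closure).exists_bound_of_continuousOn hcon
    refine Integrable.of_bound hm.aestronglyMeasurable B ?_
    filter_upwards [Measure.quasiMeasurePreserving_snd.ae hτ] with q hq
    exact hB (circleMap 0 1 q.1, q.2) ⟨circleMap_zero_one_mem _, hq⟩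
  calc ∫ z, cauchyApprox r n a f t z ∂τ
      = ∫ z, ∫ θ, A (circleMap 0 1 θ) * (deriv (polyMap r n a) (t * circleMap 0 1 θ) /
          (polyMap r n a (t * circleMap 0 1 θ) - z)) ∂angleMeasure ∂τ := by
        congr 1
        ext z
        rw [cauchyApprox, circleIntegral_eq_integral_angleMeasure, integral_const_mul,
          inv_mul_cancel_left₀ Complex.two_pi_I_ne_zero]
        congr 1
        ext θ
        simp only [hA]
        ring
    _ = ∫ θ, ∫ z, A (circleMap 0 1 θ) * (deriv (polyMap r n a) (t * circleMap 0 1 θ) /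
          (polyMap r n a (t * circleMap 0 1 θ) - z)) ∂τ ∂angleMeasure :=
        (integral_integral_swap hint).symm
    _ = _ := by simp_rw [integral_const_mul, hA, curvePoint]

lemma inv_bounds {δ : ℝ} (hδ : δ ∈ Ioo (0 : ℝ) 1) {s : ℝ} (hs : s ∈ Icc (1 : ℝ) (1 + δ)) :
    0 < s ∧ s⁻¹ ≤ 1 ∧ 1 - δ ≤ s⁻¹ := by
  have hs0 : 0 < s := by linarith [hs.1]
  refine ⟨hs0, inv_le_one_of_one_le₀ hs.1, ?_⟩
  rw [le_inv_comm₀ (by linarith [hδ.2]) hs0]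
  refine hs.2.trans ?_
  rw [← one_div, le_div_iff₀ (by linarith [hδ.2])]
  nlinarith [hδ.1]

lemma mul_mem_collar {δ : ℝ} (hδ : δ ∈ Ioo (0 : ℝ) 1) {s : ℝ} (hs : s ∈ Icc (1 : ℝ) (1 + δ))
    {w : ℂ} (hw : w ∈ sphere (0 : ℂ) 1) : (s : ℂ) * w ∈ collar δ := by
  rw [mem_collar, norm_ofReal_mul (inv_bounds hδ hs).1 hw]
  exact ⟨hs.2, by linarith [hs.1, hδ.1]⟩

lemma inv_mul_mem_collar {δ : ℝ} (hδ : δ ∈ Ioo (0 : ℝ) 1) {s : ℝ}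
    (hs : s ∈ Icc (1 : ℝ) (1 + δ)) {w : ℂ} (hw : w ∈ sphere (0 : ℂ) 1) :
    ((s⁻¹ : ℝ) : ℂ) * w ∈ collar δ := by
  obtain ⟨h1, h2, h3⟩ := inv_bounds hδ hs
  rw [mem_collar, norm_ofReal_mul (inv_pos.2 h1) hw]
  exact ⟨by linarith [hδ.1], h3⟩

/-- The approximant at h(u) is compared with Cauchy's formula at the interior point h(u/t). The
singular parts cancel exactly, t/(tw - u) = 1/(w - u/t), so only continuous remainders are left and
no jump relation on γ is needed. -/
lemma IsCurveDomain.cauchyApprox_sub (h : IsCurveDomain r n a G) {f : ℂ → ℂ}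
    (hf : DiffContOnCl ℂ f G) {δ : ℝ} (hδ : δ ∈ Ioo (0 : ℝ) 1)
    (hQ : ∀ w ∈ collar δ, ∀ u ∈ collar δ, slopeMap r n a w u ≠ 0) {t : ℝ} (ht : 1 < t)
    (htδ : t ≤ 1 + δ) {u : ℂ} (hu : u ∈ sphere (0 : ℂ) 1) :
    cauchyApprox r n a f t (polyMap r n a u) - f (polyMap r n a ((t⁻¹ : ℝ) * u)) =
      (2 * π * Complex.I : ℂ)⁻¹ * ∮ w in C(0, 1), f (polyMap r n a w) *
        (t * (slopeMap₂ n a (t * w) u / slopeMap r n a (t * w) u) -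
          slopeMap₂ n a w ((t⁻¹ : ℝ) * u) / slopeMap r n a w ((t⁻¹ : ℝ) * u)) := by
  have ht0 : 0 < t := by linarith
  have hti : t⁻¹ < 1 := inv_lt_one_of_one_lt₀ ht
  have hti' : 1 - δ ≤ t⁻¹ := (inv_bounds hδ ⟨ht.le, htδ⟩).2.2
  set s : ℂ := ((t⁻¹ : ℝ) : ℂ) * u with hs
  have hsn : ‖s‖ = t⁻¹ := norm_ofReal_mul (inv_pos.2 ht0) hu
  have hsG : polyMap r n a s ∈ G := h.polyMap_mem_of_lt hδ hQ (hsn ▸ hti') (hsn ▸ hti)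
  have hscol : s ∈ collar δ := mem_collar.2 ⟨by rw [hsn]; linarith [hδ.1], hsn ▸ hti'⟩
  have hcol : ∀ w ∈ sphere (0 : ℂ) 1, (t : ℂ) * w ∈ collar δ := fun w hw =>
    mul_mem_collar hδ ⟨ht.le, htδ⟩ hw
  have hucol := sphere_subset_collar hδ.1.le hu
  have hfc := h.continuousOn_comp hf.continuousOn
  have h0 : sphere (0 : ℂ) 1 ⊆ {0}ᶜ := fun _ hw => ne_zero_of_mem_sphere hw
  have htu : ∀ w ∈ sphere (0 : ℂ) 1, (t : ℂ) * w ≠ u := fun w hw h' => by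
    have := norm_ofReal_mul ht0 hw
    rw [h', mem_sphere_zero_iff_norm.1 hu] at this
    linarith
  have hws : ∀ w ∈ sphere (0 : ℂ) 1, w ≠ s := fun w hw h' => by
    rw [h', mem_sphere_zero_iff_norm, hsn] at hw
    linarith
  have h1 := h.cauchy_formula hf hsG
  rw [contourIntegral] at h1
  have h2 : f (polyMap r n a s) = (2 * π * Complex.I : ℂ)⁻¹ * ∮ w in C(0, 1),
      f (polyMap r n a w) / (polyMap r n a w - polyMap r n a s) * deriv (polyMap r n a) w := by
    rw [h1, inv_mul_cancel_left₀ Complex.two_pi_I_ne_zero]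
  rw [h2, cauchyApprox, ← mul_sub, ← circleIntegral.integral_sub]
  · congr 1
    refine circleIntegral.integral_congr zero_le_one fun w hw => ?_
    have e1 := deriv_polyMap_div_sub (r := r) (n := n) (a := a) (ofReal_mul_mem_compl ht0 hw)
      (h0 hu) (htu w hw) (hQ _ (hcol w hw) u hucol)
    have e2 := deriv_polyMap_div_sub (r := r) (n := n) (a := a) (h0 hw)
      (ne_zero_of_mem_collar hδ.2 hscol) (hws w hw)
      (hQ w (sphere_subset_collar hδ.1.le hw) s hscol)
    have e3 : (t : ℂ) * (t * w - u)⁻¹ = (w - s)⁻¹ := by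
      have ht' : (t : ℂ) ≠ 0 := Complex.ofReal_ne_zero.2 ht0.ne'
      have : (t : ℂ) * w - u = t * (w - s) := by
        rw [hs, Complex.ofReal_inv, mul_sub, mul_inv_cancel_left₀ ht']
      rw [this, mul_inv, mul_inv_cancel_left₀ ht']
    rw [mul_div_assoc, mul_div_assoc, e1, div_mul_eq_mul_div, mul_div_assoc, e2, mul_add, e3]
    ring
  · refine ContinuousOn.circleIntegrable zero_le_one ((hfc.mul (continuousOn_const.mul
      (continuousOn_comp_mul (continuousOn_deriv_polyMap r n a) ht0))).div
      ((continuousOn_comp_mul (continuousOn_polyMap r n a) ht0).sub continuousOn_const)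
      fun w hw h' => ?_)
    exact h.polyMap_mul_notMem ht hw (sub_eq_zero.1 h' ▸ h.polyMap_mem_closure hu)
  · refine ContinuousOn.circleIntegrable zero_le_one ((hfc.div
      (((continuousOn_polyMap r n a).mono h0).sub continuousOn_const) fun w hw h' => ?_).mul
      ((continuousOn_deriv_polyMap r n a).mono h0))
    have h3 : polyMap r n a w = polyMap r n a s := sub_eq_zero.1 h'
    exact h.notMem_polyCurve hsG (h3 ▸ polyMap_mem_polyCurve hw)

lemma continuousOn_ofReal_inv {δ : ℝ} (hδ : δ ∈ Ioo (0 : ℝ) 1) {X : Type*} [TopologicalSpace X]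
    (K : Set X) :
    ContinuousOn (fun q : ℝ × X => ((q.1⁻¹ : ℝ) : ℂ)) (Icc 1 (1 + δ) ×ˢ K) :=
  Complex.continuous_ofReal.comp_continuousOn
    (continuousOn_fst.inv₀ fun _ hq => (inv_bounds hδ hq.1).1.ne')

lemma IsCurveDomain.eventually_norm_sub_le (h : IsCurveDomain r n a G) {f : ℂ → ℂ}
    (hf : ContinuousOn f (closure G)) {δ : ℝ} (hδ : δ ∈ Ioo (0 : ℝ) 1)
    (hQ : ∀ w ∈ collar δ, ∀ u ∈ collar δ, slopeMap r n a w u ≠ 0) {ε : ℝ} (hε : 0 < ε) :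
    ∀ᶠ s : ℝ in 𝓝[>] 1, ∀ u ∈ sphere (0 : ℂ) 1,
      ‖f (polyMap r n a ((s⁻¹ : ℝ) * u)) - f (polyMap r n a u)‖ ≤ ε := by
  refine eventually_norm_le_of_eq_zero (isCompact_sphere (0 : ℂ) 1)
    (F := fun s u => f (polyMap r n a ((s⁻¹ : ℝ) * u)) - f (polyMap r n a u))
    (lt_add_of_pos_right 1 hδ.1) ?_ (fun u _ => by simp) hε
  have hmaps : MapsTo (fun q : ℝ × ℂ => ((q.1⁻¹ : ℝ) : ℂ) * q.2)
      (Icc 1 (1 + δ) ×ˢ sphere (0 : ℂ) 1) {w | 1 - δ ≤ ‖w‖ ∧ ‖w‖ ≤ 1} := fun q hq => by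
    obtain ⟨h1, h2, h3⟩ := inv_bounds hδ hq.1
    rw [mem_ofPred_eq, norm_ofReal_mul (inv_pos.2 h1) hq.2]
    exact ⟨h3, h2⟩
  have hfA : ContinuousOn (fun w => f (polyMap r n a w)) {w | 1 - δ ≤ ‖w‖ ∧ ‖w‖ ≤ 1} := by
    refine hf.comp ((continuousOn_polyMap r n a).mono ?_) ?_
    · rintro w hw rfl
      have := hw.1
      rw [norm_zero] at this
      linarith [hδ.2]
    · intro w hw
      rcases hw.2.lt_or_eq with h3 | h3
      · exact subset_closure (h.polyMap_mem_of_lt hδ hQ hw.1 h3)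
      · exact h.polyMap_mem_closure (mem_sphere_zero_iff_norm.2 h3)
  have c1 := hfA.comp ((continuousOn_ofReal_inv hδ (sphere (0 : ℂ) 1)).mul continuousOn_snd) hmaps
  have c2 := (h.continuousOn_comp hf).comp (s := Icc 1 (1 + δ) ×ˢ sphere (0 : ℂ) 1)
    (f := Prod.snd) continuousOn_snd fun q hq => hq.2
  exact c1.sub c2

lemma eventually_norm_slope_sub_le {δ : ℝ} (hδ : δ ∈ Ioo (0 : ℝ) 1)
    (hQ : ∀ w ∈ collar δ, ∀ u ∈ collar δ, slopeMap r n a w u ≠ 0) {ε : ℝ} (hε : 0 < ε) :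
    ∀ᶠ s : ℝ in 𝓝[>] 1, ∀ q ∈ sphere (0 : ℂ) 1 ×ˢ sphere (0 : ℂ) 1,
      ‖s * (slopeMap₂ n a (s * q.1) q.2 / slopeMap r n a (s * q.1) q.2) -
        slopeMap₂ n a q.1 ((s⁻¹ : ℝ) * q.2) / slopeMap r n a q.1 ((s⁻¹ : ℝ) * q.2)‖ ≤ ε := by
  set k : ℂ × ℂ → ℂ := fun q => slopeMap₂ n a q.1 q.2 / slopeMap r n a q.1 q.2 with hk
  have hcolK : ContinuousOn k (collar δ ×ˢ collar δ) := by
    have hsub : collar δ ×ˢ collar δ ⊆ {q : ℂ × ℂ | q.1 ≠ 0 ∧ q.2 ≠ 0} := fun q hq =>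
      ⟨ne_zero_of_mem_collar hδ.2 hq.1, ne_zero_of_mem_collar hδ.2 hq.2⟩
    exact ((continuousOn_slopeMap₂ n a).mono hsub).div ((continuousOn_slopeMap r n a).mono hsub)
      fun q hq => hQ _ hq.1 _ hq.2
  refine eventually_norm_le_of_eq_zero
    ((isCompact_sphere (0 : ℂ) 1).prod (isCompact_sphere (0 : ℂ) 1))
    (F := fun s q => s * k (s * q.1, q.2) - k (q.1, (s⁻¹ : ℝ) * q.2))
    (lt_add_of_pos_right 1 hδ.1) ?_ (fun u _ => by simp) hε
  have c1 : ContinuousOn (fun q : ℝ × ℂ × ℂ => (((q.1 : ℂ) * q.2.1, q.2.2) : ℂ × ℂ))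
      (Icc 1 (1 + δ) ×ˢ (sphere (0 : ℂ) 1 ×ˢ sphere (0 : ℂ) 1)) := by fun_prop
  have c2 : ContinuousOn (fun q : ℝ × ℂ × ℂ => ((q.2.1, ((q.1⁻¹ : ℝ) : ℂ) * q.2.2) : ℂ × ℂ))
      (Icc 1 (1 + δ) ×ˢ (sphere (0 : ℂ) 1 ×ˢ sphere (0 : ℂ) 1)) :=
    ContinuousOn.prodMk (by fun_prop) ((continuousOn_ofReal_inv hδ _).mul (by fun_prop))
  have d1 := hcolK.comp c1 fun q hq =>
    ⟨mul_mem_collar hδ hq.1 hq.2.1, sphere_subset_collar hδ.1.le hq.2.2⟩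
  have d2 := hcolK.comp c2 fun q hq =>
    ⟨sphere_subset_collar hδ.1.le hq.2.1, inv_mul_mem_collar hδ hq.1 hq.2.2⟩
  have d3 : ContinuousOn (fun q : ℝ × ℂ × ℂ => (q.1 : ℂ))
      (Icc 1 (1 + δ) ×ˢ (sphere (0 : ℂ) 1 ×ˢ sphere (0 : ℂ) 1)) := by fun_prop
  exact (d3.mul d1).sub d2

/-- The approximations converge uniformly on the curve. -/
lemma IsCurveDomain.exists_cauchyApprox_near (h : IsCurveDomain r n a G) {f : ℂ → ℂ}
    (hf : DiffContOnCl ℂ f G) {ε : ℝ} (hε : 0 < ε) :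
    ∃ t : ℝ, 1 < t ∧ ∀ z ∈ polyCurve r n a, ‖cauchyApprox r n a f t z - f z‖ ≤ ε := by
  obtain ⟨δ, hδ, hQ⟩ := h.analytic.exists_collar
  obtain ⟨M, hM⟩ := (isCompact_sphere (0 : ℂ) 1).exists_bound_of_continuousOn
    (h.continuousOn_comp hf.continuousOn)
  have hM0 : 0 ≤ M := (norm_nonneg _).trans (hM _ (circleMap_zero_one_mem 0))
  have hE1 := h.eventually_norm_sub_le hf.continuousOn hδ hQ (half_pos hε)
  -- With |f| ≤ M on γ, the integral in `IsCurveDomain.cauchyApprox_sub` is then at most Mε/(2(M+1))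
  -- ≤ ε/2; using M + 1 allows M = 0.
  have hE2 := eventually_norm_slope_sub_le hδ hQ (ε := ε / (2 * (M + 1))) (by positivity)
  obtain ⟨t, ht1, ht2, ht⟩ := (hE1.and (hE2.and
    (Ioo_mem_nhdsGT (lt_add_of_pos_right 1 hδ.1)))).exists
  refine ⟨t, ht.1, ?_⟩
  rintro _ ⟨u, hu, rfl⟩
  have h1 : ‖cauchyApprox r n a f t (polyMap r n a u) - f (polyMap r n a ((t⁻¹ : ℝ) * u))‖ ≤
      ε / 2 := by
    rw [h.cauchyApprox_sub hf hδ hQ ht.1 ht.2.le hu, ← smul_eq_mul]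
    refine (circleIntegral.norm_two_pi_i_inv_smul_integral_le_of_norm_le_const zero_le_one
      (C := M * (ε / (2 * (M + 1)))) fun w hw => ?_).trans ?_
    · rw [norm_mul]
      exact mul_le_mul (hM w hw) (ht2 (w, u) ⟨hw, hu⟩) (norm_nonneg _) hM0
    · rw [one_mul, mul_div_assoc', div_le_div_iff₀ (by positivity) two_pos]
      nlinarith
  calc _ = ‖(cauchyApprox r n a f t (polyMap r n a u) - f (polyMap r n a ((t⁻¹ : ℝ) * u))) +
        (f (polyMap r n a ((t⁻¹ : ℝ) * u)) - f (polyMap r n a u))‖ := by rw [sub_add_sub_cancel]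
    _ ≤ ε / 2 + ε / 2 := (norm_add_le _ _).trans (add_le_add h1 (ht1 u hu))
    _ = ε := add_halves ε

/-- Measures on the closed domain with the same logarithmic potential on the curve integrate
holomorphic functions in the same way. -/
theorem IsCurveDomain.integral_eq_of_logPotential_eq (h : IsCurveDomain r n a G)
    {τ₁ τ₂ : Measure ℂ} [IsProbabilityMeasure τ₁] [IsProbabilityMeasure τ₂]
    (h₁ : ∀ᵐ z ∂τ₁, z ∈ closure G) (h₂ : ∀ᵐ z ∂τ₂, z ∈ closure G)
    (heq : ∀ᵐ z ∂((μH[1] : Measure ℂ).restrict (polyCurve r n a)),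
      logPotential τ₁ z = logPotential τ₂ z) {f : ℂ → ℂ} (hf : DiffContOnCl ℂ f G) :
    ∫ z, f z ∂τ₁ = ∫ z, f z ∂τ₂ := by
  have hae := h.ae_integral_log_eq h₁ h₂ heq
  have hint : ∀ (τ : Measure ℂ) [IsProbabilityMeasure τ], (∀ᵐ z ∂τ, z ∈ closure G) →
      ∀ g : ℂ → ℂ, ContinuousOn g (closure G) → Integrable g τ := by
    intro τ _ hτ g hg
    rw [← Measure.restrict_eq_self_of_ae_mem hτ]
    exact hg.integrableOn_compact h.bounded.isCompact_closure
  have hclose : ∀ (τ : Measure ℂ) [IsProbabilityMeasure τ], (∀ᵐ z ∂τ, z ∈ closure G) →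
      ∀ g : ℂ → ℂ, DiffContOnCl ℂ g G → ∀ ε : ℝ, (∀ z ∈ polyCurve r n a, ‖g z - f z‖ ≤ ε) →
        dist (∫ z, g z ∂τ) (∫ z, f z ∂τ) ≤ ε := by
    intro τ _ hτ g hg ε hgf
    rw [dist_eq_norm, ← integral_sub (hint τ hτ g hg.continuousOn) (hint τ hτ f hf.continuousOn)]
    refine (norm_integral_le_of_norm_le_const (C := ε) ?_).trans (by simp)
    filter_upwards [hτ] with z hz
    -- The maximum principle carries the estimate from γ to the closed domain, so uniform
    -- approximation on γ suffices.
    exact Complex.norm_le_of_forall_mem_frontier_norm_le h.bounded (hg.sub hf)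
      (fun w hw => hgf w (h.frontier_eq ▸ hw)) hz
  refine eq_of_forall_dist_le fun ε hε => ?_
  obtain ⟨t, ht, hnear⟩ := h.exists_cauchyApprox_near hf (half_pos hε)
  have hg := h.diffContOnCl_cauchyApprox hf.continuousOn ht
  have he : ∫ z, cauchyApprox r n a f t z ∂τ₁ = ∫ z, cauchyApprox r n a f t z ∂τ₂ := by
    rw [h.integral_cauchyApprox hf.continuousOn ht h₁,
      h.integral_cauchyApprox hf.continuousOn ht h₂]
    congr 1
    ext θ
    rw [h.integral_deriv_div_eq h₁ h₂ hae
      (by rwa [norm_ofReal_mul (by linarith) (circleMap_zero_one_mem θ)])]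
  have d1 := hclose τ₁ h₁ _ hg _ hnear
  have d2 := hclose τ₂ h₂ _ hg _ hnear
  rw [he] at d1
  have := dist_triangle_left (∫ z, f z ∂τ₁) (∫ z, f z ∂τ₂) (∫ z, cauchyApprox r n a f t z ∂τ₂)
  linarith

end

end ElbauFelder

end

/-! ### The quadrature identity and the balayage formula -/

theorem mainTheorem4
    -- the Elbau-Felder potential
    (t₀ : ℝ) (p : Polynomial ℂ) (hV : ElbauFelder.IsElbauFelder t₀ p)
    -- the cut-off: the closure of a bounded open set containing the origin
    (U : Set ℂ) (hU : IsOpen U) (hUb : Bornology.IsBounded U) (hU0 : (0 : ℂ) ∈ U)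
    -- its equilibrium measure, which does not charge the boundary of the cut-off
    (μ : Measure ℂ)
    (hμ : ElbauFelder.IsEquilibriumMeasure (ElbauFelder.potential t₀ p) (closure U) μ)
    (hwall : μ (frontier (closure U)) = 0)
    -- the support is bounded by a simple closed analytic polynomial curve
    (D : Set ℂ) (hD : D = μ.support)
    (r : ℝ) (n : ℕ) (a : ℕ → ℂ) (hγ : ElbauFelder.IsSimpleAnalytic r n a)
    (hγD : frontier D = ElbauFelder.polyCurve r n a)
    (hor : ElbauFelder.PositivelyOrientedAround r n a (interior D))
    -- the Schwarz function of the curve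
    (S : ℂ → ℂ) (hS : ElbauFelder.IsSchwarzFunction S (ElbauFelder.polyCurve r n a)) :
    (∀ f : ℂ → ℂ, DiffContOnCl ℂ f (interior D) →
      ∫ z in D, f z ∂μ =
        1 / (2 * π * Complex.I * t₀) *
          ElbauFelder.contourIntegral r n a (fun z => f z * S z)) ∧
    (∀ μ' : Measure ℂ, ElbauFelder.IsBalayage (interior D) μ μ' →
      ∀ f : ℂ → ℂ, DiffContOnCl ℂ f (interior D) →
        ∫ z in ElbauFelder.polyCurve r n a, f z ∂μ' =
          1 / (2 * π * Complex.I * t₀) *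
            ElbauFelder.contourIntegral r n a (fun z => f z * S z)) := by
  have := hμ.prob
  subst hD
  have hKb : Bornology.IsBounded (closure U) := hUb.closure
  have hK0 : (interior (closure U)).Nonempty :=
    ⟨0, interior_mono subset_closure (hU.interior_eq.symm ▸ hU0)⟩
  obtain ⟨⟨C, hC⟩, hT⟩ := hμ.cauchyTransform_eq hV.t₀_pos hKb hK0 hwall
  have hsub : μ.support ⊆ closure U :=
    Measure.support_subset_of_isClosed isClosed_closure hμ.carried
  obtain ⟨h, hμG⟩ := ElbauFelder.isCurveDomain_interior_support hC hγ (hKb.subset hsub) hγD hor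
  obtain ⟨-, -, -, -, hSγ⟩ := hS
  -- Both sides are continuous in the plane, the left one by the density bound, so the identity
  -- extends from the interior of D to its closure, which contains γ.
  have hTγ : ∀ z ∈ ElbauFelder.polyCurve r n a,
      ∫ w, (z - w)⁻¹ ∂μ = (conj z - p.derivative.eval z) / t₀ := by
    intro z hz
    have hp := p.derivative.continuous
    have hcl : IsClosed {z : ℂ | ∫ w, (z - w)⁻¹ ∂μ = (conj z - p.derivative.eval z) / t₀} :=
      isClosed_eq (ElbauFelder.continuous_integral_kernel_translate hC h.bounded hμG
        ElbauFelder.locallyIntegrable_inv ElbauFelder.continuousOn_inv_compl) (by fun_prop)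
    exact closure_minimal hT hcl (h.polyCurve_subset_closure hz)
  have part1 : ∀ f : ℂ → ℂ, DiffContOnCl ℂ f (interior μ.support) →
      ∫ z, f z ∂μ = 1 / (2 * π * Complex.I * t₀) *
        ElbauFelder.contourIntegral r n a (fun z => f z * S z) := fun f hf =>
    h.integral_eq_contourIntegral hC hμG hV.t₀_pos.ne' hTγ hSγ hf
  refine ⟨fun f hf => ?_, fun μ' hμ' f hf => ?_⟩
  · rw [← part1 f hf, Measure.restrict_eq_self_of_ae_mem (hμG.mono fun z hz => interior_subset hz)]
  · have := hμ'.prob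
    have hae : ∀ᵐ z ∂μ', z ∈ ElbauFelder.polyCurve r n a := by
      rw [← h.frontier_eq]
      exact hμ'.carried
    have heq := hμ'.potential_eq
    rw [h.frontier_eq] at heq
    rw [← part1 f hf, Measure.restrict_eq_self_of_ae_mem hae]
    exact (h.integral_eq_of_logPotential_eq (hμG.mono fun z hz => subset_closure hz)
      (hae.mono fun z hz => h.polyCurve_subset_closure hz) heq hf).symm
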